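/- An instance of the Budget-Constrained Max Flow Problem (BCMFP) consists of an undirected multigraph $G=(V,E)$ with $m$ edges, non-negative rational edge costs $c_e$ and capacities $u_e$, a source $s$ and a sink $t\neq s$ in $V$, and a rational budget $B\ge 0$. An $s$-$t$ flow in $(V,A)$, $A\subseteq E$, assigns to each edge $e\in A$ a direction and a real amount between $0$ and $u_e$ so that inflow equals outflow at every vertex other than $s$ and $t$; its value is the net flow out of $s$. Let $\mathrm{OPT}$ be the largest value of a maximum $s$-$t$ flow in $(V,A)$ over all $A\subseteq E$ with $\sum_{e\in A}c_e\le B$. The graph $G$ is series-parallel if, for some pair of terminals $a,b\in V$ (which need not be $s,t$), it is built from single edges, with their two ends as terminals, by repeated series composition (identify the second terminal of one graph with the first terminal of another) and parallel composition (identify the first terminals, and the second terminals, of two graphs). Theorem. There is a fully polynomial time approximation scheme for the BCMFP on undirected series-parallel graphs. That is, there is one algorithm (a random access machine program with addition, truncated subtraction, multiplication and integer division) which, given any BCMFP instance whose graph is series-parallel (the graph is given by its list of edges, without terminals or a decomposition) and any rational $\varepsilon>0$, with all numbers in binary, returns a set $A\subseteq E$ with $\sum_{e\in A}c_e\le B$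 such that the maximum $s$-$t$ flow in $(V,A)$ has value at least $\mathrm{OPT}/(1+\varepsilon)$. Its running time, counted in bit operations (logarithmic cost), is polynomial in the size of the input (the instance and $\varepsilon$) and $1/\varepsilon$. If moreover all capacities are integers, then the number of elementary steps that the same algorithm makes is bounded by a polynomial in $m$, $1/\varepsilon$ and $\log F$ (read as $0$ if $F=0$), where $F$ is the value of a maximum $s$-$t$ flow in $G$. -/

import Mathlib

/-! ### Random access machines with logarithmic cost

A machine has registers `0, 1, 2, …` and random access arrays `0, 1, 2, …`, all holding natural
numbers. A program is a fixed finite text, so it uses finitely many registers and arrays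
(interleaving the arrays gives the usual machine with a single memory). -/

namespace RAM

/-- The contents of the registers and of the arrays. -/
structure State where
  reg : ℕ → ℕ
  arr : ℕ → ℕ → ℕ

/-- Arithmetic operations: addition, truncated subtraction, multiplication, integer division. -/
inductive Op
  | add | sub | mul | div

def Op.apply : Op → ℕ → ℕ → ℕ
  | .add, x, y => x + y
  | .sub, x, y => x - y
  | .mul, x, y => x * y
  | .div, x, y => x / y

inductive Prog
  | skip
  /-- `x := n` -/
  | const (x n : ℕ)
  /-- `x := y op z` -/
  | arith (o : Op) (x y z : ℕ)
  /-- `x := a[y]` -/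
  | load (x a y : ℕ)
  /-- `a[x] := y` -/
  | store (a x y : ℕ)
  /-- `P; Q` -/
  | seq (P Q : Prog)
  /-- `if x ≠ 0 then P else Q` -/
  | cond (x : ℕ) (P Q : Prog)
  /-- `while x ≠ 0 do P` -/
  | loop (x : ℕ) (P : Prog)

namespace State

def setReg (σ : State) (x v : ℕ) : State :=
  { σ with reg := Function.update σ.reg x v }

def setArr (σ : State) (a i v : ℕ) : State :=
  { σ with arr := Function.update σ.arr a (Function.update (σ.arr a) i v) }

end State

/-- `Exec P σ σ' τ β`: the program `P`, started in the state `σ`, halts in the state `σ'` after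
`τ` elementary steps (instructions and tests), whose total logarithmic cost is `β`: a step costs
one plus the binary lengths of all numbers that it handles, addresses included. -/
inductive Exec : Prog → State → State → ℕ → ℕ → Prop
  | skip (σ : State) : Exec .skip σ σ 1 1
  | const (σ : State) (x n : ℕ) : Exec (.const x n) σ (σ.setReg x n) 1 (1 + n.size)
  | arith (σ : State) (o : Op) (x y z : ℕ) :
      Exec (.arith o x y z) σ (σ.setReg x (o.apply (σ.reg y) (σ.reg z))) 1
        (1 + (σ.reg y).size + (σ.reg z).size + (o.apply (σ.reg y) (σ.reg z)).size)
  | load (σ : State) (x a y : ℕ) :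
      Exec (.load x a y) σ (σ.setReg x (σ.arr a (σ.reg y))) 1
        (1 + (σ.reg y).size + (σ.arr a (σ.reg y)).size)
  | store (σ : State) (a x y : ℕ) :
      Exec (.store a x y) σ (σ.setArr a (σ.reg x) (σ.reg y)) 1
        (1 + (σ.reg x).size + (σ.reg y).size)
  | seq {P Q : Prog} {σ₁ σ₂ σ₃ : State} {τ τ' β β' : ℕ} :
      Exec P σ₁ σ₂ τ β → Exec Q σ₂ σ₃ τ' β' → Exec (.seq P Q) σ₁ σ₃ (τ + τ') (β + β')
  | cond_true {x : ℕ} {P Q : Prog} {σ σ' : State} {τ β : ℕ} :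
      σ.reg x ≠ 0 → Exec P σ σ' τ β →
      Exec (.cond x P Q) σ σ' (1 + τ) (1 + (σ.reg x).size + β)
  | cond_false {x : ℕ} {P Q : Prog} {σ σ' : State} {τ β : ℕ} :
      σ.reg x = 0 → Exec Q σ σ' τ β →
      Exec (.cond x P Q) σ σ' (1 + τ) (1 + (σ.reg x).size + β)
  | loop_done {x : ℕ} {P : Prog} {σ : State} :
      σ.reg x = 0 → Exec (.loop x P) σ σ 1 (1 + (σ.reg x).size)
  | loop_step {x : ℕ} {P : Prog} {σ₁ σ₂ σ₃ : State} {τ τ' β β' : ℕ} :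
      σ₁.reg x ≠ 0 → Exec P σ₁ σ₂ τ β → Exec (.loop x P) σ₂ σ₃ τ' β' →
      Exec (.loop x P) σ₁ σ₃ (1 + τ + τ') (1 + (σ₁.reg x).size + β + β')

/-- The machine is deterministic: the final state and both costs are functions of the program
and the initial state. -/
theorem Exec.unique {P : Prog} {σ σ₁ σ₂ : State} {τ₁ τ₂ β₁ β₂ : ℕ}
    (h₁ : Exec P σ σ₁ τ₁ β₁) (h₂ : Exec P σ σ₂ τ₂ β₂) :
    σ₁ = σ₂ ∧ τ₁ = τ₂ ∧ β₁ = β₂ := by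
  induction h₁ generalizing σ₂ τ₂ β₂ with
  | skip | const | arith | load | store => cases h₂; exact ⟨rfl, rfl, rfl⟩
  | seq _ _ ih ih' =>
    cases h₂ with
    | seq k k' =>
      obtain ⟨rfl, rfl, rfl⟩ := ih k
      obtain ⟨rfl, rfl, rfl⟩ := ih' k'
      exact ⟨rfl, rfl, rfl⟩
  | cond_true hx _ ih =>
    cases h₂ with
    | cond_true _ k => obtain ⟨rfl, rfl, rfl⟩ := ih k; exact ⟨rfl, rfl, rfl⟩
    | cond_false h _ => exact absurd h hx
  | cond_false hx _ ih =>
    cases h₂ with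
    | cond_true h _ => exact absurd hx h
    | cond_false _ k => obtain ⟨rfl, rfl, rfl⟩ := ih k; exact ⟨rfl, rfl, rfl⟩
  | loop_done hx =>
    cases h₂ with
    | loop_done _ => exact ⟨rfl, rfl, rfl⟩
    | loop_step h _ _ => exact absurd hx h
  | loop_step hx _ _ ih ih' =>
    cases h₂ with
    | loop_done h => exact absurd h hx
    | loop_step _ k k' =>
      obtain ⟨rfl, rfl, rfl⟩ := ih k
      obtain ⟨rfl, rfl, rfl⟩ := ih' k'
      exact ⟨rfl, rfl, rfl⟩

/-- The initial state: the input word stands in array `0`, everything else is zero. -/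
def start (w : List ℕ) : State where
  reg _ := 0
  arr a i := if a = 0 then w.getD i 0 else 0

/-- The size of an input word: the number of its entries plus their binary lengths. -/
def wordSize (w : List ℕ) : ℕ := (w.map fun x => 1 + x.size).sum

end RAM

/-! ### The budget-constrained max flow problem -/

/-- An instance of the budget-constrained max flow problem: an undirected multigraph with vertex
set `Fin n` and edges indexed by `Fin m` (the edge `e` joins `fst e` and `snd e`; the order of the
two ends is an arbitrary labelling), with costs, capacities, source, sink and budget. -/
structure BCMFP where
  n : ℕ
  m : ℕ
  fst : Fin m → Fin n
  snd : Fin m → Fin n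
  cost : Fin m → ℚ≥0
  cap : Fin m → ℚ≥0
  s : Fin n
  t : Fin n
  s_ne_t : s ≠ t
  budget : ℚ≥0

namespace BCMFP

variable (I : BCMFP)

/-- The edge set `A` forms, on the vertex set `S`, a series-parallel graph with terminals
`a`, `b`. Two subgraphs that share no edge and no vertices but the identified terminals are
composed in series or in parallel. -/
inductive IsSPSub : Finset (Fin I.m) → Finset (Fin I.n) → Fin I.n → Fin I.n → Prop
  | edge (e : Fin I.m) (a b : Fin I.n) (hab : a ≠ b)
      (he : (I.fst e = a ∧ I.snd e = b) ∨ (I.fst e = b ∧ I.snd e = a)) :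
      IsSPSub {e} {a, b} a b
  | series {A₁ A₂ : Finset (Fin I.m)} {S₁ S₂ : Finset (Fin I.n)} {a c b : Fin I.n} :
      IsSPSub A₁ S₁ a c → IsSPSub A₂ S₂ c b → Disjoint A₁ A₂ → S₁ ∩ S₂ = {c} →
      IsSPSub (A₁ ∪ A₂) (S₁ ∪ S₂) a b
  | parallel {A₁ A₂ : Finset (Fin I.m)} {S₁ S₂ : Finset (Fin I.n)} {a b : Fin I.n} :
      IsSPSub A₁ S₁ a b → IsSPSub A₂ S₂ a b → Disjoint A₁ A₂ → S₁ ∩ S₂ = {a, b} →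
      IsSPSub (A₁ ∪ A₂) (S₁ ∪ S₂) a b

/-- The underlying graph is series-parallel, for some pair of terminals (which need not be the
source and the sink). -/
def IsSeriesParallel : Prop :=
  ∃ a b : Fin I.n, I.IsSPSub Finset.univ Finset.univ a b

/-- `f` is an `s`-`t` flow in the subgraph `(V, A)`. The flow on `e` is `|f e|`, directed from
`fst e` to `snd e` if `f e ≥ 0` and from `snd e` to `fst e` if `f e ≤ 0`. -/
def IsFlow (A : Finset (Fin I.m)) (f : Fin I.m → ℝ) : Prop :=
  (∀ e ∈ A, |f e| ≤ (I.cap e : ℝ)) ∧ (∀ e ∉ A, f e = 0) ∧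
    ∀ v : Fin I.n, v ≠ I.s → v ≠ I.t →
      ∑ e with I.snd e = v, f e = ∑ e with I.fst e = v, f e

/-- The value of a flow: the net flow out of the source. -/
def flowValue (f : Fin I.m → ℝ) : ℝ :=
  ∑ e with I.fst e = I.s, f e - ∑ e with I.snd e = I.s, f e

/-- The maximum value of an `s`-`t` flow in the subgraph `(V, A)`. -/
noncomputable def maxFlow (A : Finset (Fin I.m)) : ℝ :=
  sSup (I.flowValue '' {f | I.IsFlow A f})

theorem isCompact_setOf_isFlow (A : Finset (Fin I.m)) : IsCompact {f | I.IsFlow A f} := by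
  refine (isCompact_Icc (a := fun e => -(I.cap e : ℝ))
    (b := fun e => (I.cap e : ℝ))).of_isClosed_subset ?_ ?_
  · have h : {f | I.IsFlow A f} =
        (⋂ e ∈ A, {f : Fin I.m → ℝ | |f e| ≤ (I.cap e : ℝ)}) ∩
        ((⋂ e ∈ {e | e ∉ A}, {f : Fin I.m → ℝ | f e = 0}) ∩
        ⋂ v ∈ {v | v ≠ I.s ∧ v ≠ I.t}, {f : Fin I.m → ℝ |
          ∑ e with I.snd e = v, f e = ∑ e with I.fst e = v, f e}) := by
      ext f; simp [IsFlow]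
    rw [h]
    refine IsClosed.inter ?_ (IsClosed.inter ?_ ?_)
    · exact isClosed_biInter fun e _ => isClosed_le (by fun_prop) (by fun_prop)
    · exact isClosed_biInter fun e _ => isClosed_eq (by fun_prop) (by fun_prop)
    · exact isClosed_biInter fun e _ => isClosed_eq (by fun_prop) (by fun_prop)
  · rintro f ⟨h₁, h₂, -⟩
    have h : ∀ e, |f e| ≤ (I.cap e : ℝ) := fun e => by
      by_cases he : e ∈ A
      · exact h₁ e he
      · rw [h₂ e he, abs_zero]; positivity
    exact ⟨fun e => (abs_le.1 (h e)).1, fun e => (abs_le.1 (h e)).2⟩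

/-- The supremum in the definition of `maxFlow` is attained. -/
theorem isGreatest_maxFlow (A : Finset (Fin I.m)) :
    IsGreatest (I.flowValue '' {f | I.IsFlow A f}) (I.maxFlow A) := by
  refine IsCompact.isGreatest_sSup ((I.isCompact_setOf_isFlow A).image ?_) ?_
  · unfold flowValue; fun_prop
  · exact ⟨_, 0, ⟨fun e _ => by rw [Pi.zero_apply, abs_zero]; positivity, by simp, by simp⟩, rfl⟩

/-- The edge set `A` can be bought within the budget. -/
def IsFeasible (A : Finset (Fin I.m)) : Prop := ∑ e ∈ A, I.cost e ≤ I.budget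

/-- The optimal value: the maximum of `maxFlow A` over the edge sets `A` within the budget. -/
noncomputable def opt : ℝ := by
  classical
  exact (Finset.univ.filter I.IsFeasible).sup' ⟨∅, by simp [IsFeasible]⟩ I.maxFlow

/-- The input word for an instance and an accuracy: all data in binary, rational numbers as
numerator and denominator in lowest terms. -/
def encode (ε : ℚ≥0) : List ℕ :=
  [I.n, I.m, I.s, I.t, I.budget.num, I.budget.den, ε.num, ε.den] ++
    (List.ofFn fun e => [(I.fst e : ℕ), (I.snd e : ℕ),
      (I.cost e).num, (I.cost e).den, (I.cap e).num, (I.cap e).den]).flatten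

/-- The edge set that a final state returns: its indicator stands in array `1`. -/
def output (σ : RAM.State) : Finset (Fin I.m) :=
  Finset.univ.filter fun e => σ.arr 1 e ≠ 0

end BCMFP

/-! # An approximation scheme for budget-constrained flows in series-parallel graphs

By the max-flow min-cut theorem (`BCMFP.maxFlow_le_cutCap`, `BCMFP.le_maxFlow`) an edge set `A` has
flow value at least `r` if and only if every cut of `A` has capacity at least `r`. Fix a scale `V`,
divide it into `N` units, round all capacities down to multiples of a unit, and cap all values at
`2 N` units. For the rounded capacities the best affordable set can be found by dynamic programming,
since a series-parallel graph has an order in which its vertices other than the terminals can be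
eliminated one by one, each having exactly two neighbours `x`, `y` at that time, whereupon `x` and
`y` are joined (`SPFlow.SPG.exists_removable`, `SPFlow.SPG.eliminate`). No decomposition is needed to
find it: any removable vertex may be taken, and the terminals are found by trying all pairs. What has
been eliminated between `x` and `y` acts on the rest of the graph only by its profile, the four
values of its minimal cuts for the placements of `x` and `y`. A profile has finitely many possible
values, `(2 N + 1) ^ 4`, so a cheapest choice of edges for each of them can be stored. Eliminating a
vertex adds the profiles of the pieces at this vertex and takes the minimum over its two sides,
the source and the sink being forced to theirs by a penalty. `SPFlow.eliminate_sound` and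
`SPFlow.eliminate_complete` say that this preserves lower bounds on cuts, hence `SPFlow.solve_sound`
and `SPFlow.solve_complete`.

Costs and capacities are first multiplied by common denominators. The scale starts at `1` and is
doubled as long as the computed value exceeds `N` units. Each doubling shows that the scaled optimum
exceeds the old scale, so there are at most logarithmically many (`SPFlow.numDouble_le`), and the
final scale is at most twice the scaled optimum. Rounding loses less than one unit for each edge,
`m` units in all, and `N = 8 m k` with `k > 1/ε` makes this a small enough fraction of the optimum
(`SPFlow.opt_le_of_solve_le`).

For the running time, the algorithm is a functional program on numbers, pairs and lists. `RAM.Comp`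
says that a function is computed by a machine program in a given number of steps, with pairs and
lists kept on a heap that is only extended; `RAM.Poly` asks for a polynomial number of steps, where
the length of data counts cells and not digits. Thus the polynomial does not depend on the size of
the numbers, as the second bound of the theorem demands. The closure properties of `RAM.Poly` are
lemmas for `fun_prop`, which derives the running times from the definitions of the functions.
For the bit cost, `RAM.Run` keeps track of the growth of numbers: a product is formed only if one
factor is at most the sum of the input word, so each step lengthens the numbers by at most as many
bits as this sum has, plus one, and the logarithmic cost is polynomial in the number of steps and
the size of the input (`RAM.exists_prog`). -/

/-! ### Runs with controlled growth of the numbers -/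

namespace RAM

/-- All numbers in the memory have at most `b` binary digits. -/
def State.Bd (σ : State) (b : ℕ) : Prop :=
  (∀ r, (σ.reg r).size ≤ b) ∧ ∀ a i, (σ.arr a i).size ≤ b

theorem State.Bd.mono {σ : State} {b b' : ℕ} (h : σ.Bd b) (hb : b ≤ b') : σ.Bd b' :=
  ⟨fun r => (h.1 r).trans hb, fun a i => (h.2 a i).trans hb⟩

theorem State.Bd.setReg {σ : State} {b x v : ℕ} (h : σ.Bd b) (hv : v.size ≤ b) :
    (σ.setReg x v).Bd b := by
  refine ⟨fun r => ?_, h.2⟩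
  by_cases hr : r = x
  · subst hr; simpa [State.setReg] using hv
  · simpa [State.setReg, hr] using h.1 r

theorem State.Bd.setArr {σ : State} {b a i v : ℕ} (h : σ.Bd b) (hv : v.size ≤ b) :
    (σ.setArr a i v).Bd b := by
  refine ⟨h.1, fun a' i' => ?_⟩
  by_cases ha : a' = a
  · subst ha
    by_cases hi : i' = i
    · subst hi; simpa [State.setArr] using hv
    · simpa [State.setArr, hi] using h.2 a' i'
  · simpa [State.setArr, ha] using h.2 a' i'

/-- `Run P σ σ' τ`: the program `P` leads from `σ` to `σ'` in `τ` steps, leaves register `1`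
unchanged, and each step lengthens the numbers in memory by at most `1 + size (reg 1)` bits.
Register `1` bounds one factor of every product that the program forms, which is what makes the
growth additive; the logarithmic cost then is at most quadratic in the number of steps. -/
def Run (P : Prog) (σ σ' : State) (τ : ℕ) : Prop :=
  σ'.reg 1 = σ.reg 1 ∧ ∃ β, Exec P σ σ' τ β ∧ ∀ b, σ.Bd b →
    σ'.Bd (b + τ * (1 + (σ.reg 1).size)) ∧
      β ≤ τ * (1 + 3 * (b + τ * (1 + (σ.reg 1).size)))

@[simp] theorem State.reg_setReg_self (σ : State) (x v : ℕ) : (σ.setReg x v).reg x = v := by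
  simp [State.setReg]

theorem State.reg_setReg_ne (σ : State) {x y : ℕ} (v : ℕ) (h : y ≠ x) :
    (σ.setReg x v).reg y = σ.reg y := by
  simp [State.setReg, h]

@[simp] theorem State.arr_setReg (σ : State) (x v : ℕ) : (σ.setReg x v).arr = σ.arr := rfl

@[simp] theorem State.reg_setArr (σ : State) (a i v : ℕ) : (σ.setArr a i v).reg = σ.reg := rfl

theorem State.reg_setReg (σ : State) (x v y : ℕ) :
    (σ.setReg x v).reg y = if y = x then v else σ.reg y := by
  simp [State.setReg, Function.update_apply]

theorem State.arr_setArr (σ : State) (a i v a' i' : ℕ) :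
    (σ.setArr a i v).arr a' i' = if a' = a ∧ i' = i then v else σ.arr a' i' := by
  by_cases ha : a' = a
  · subst ha; by_cases hi : i' = i <;> simp [State.setArr, hi]
  · simp [State.setArr, ha]

theorem size_add_le {x y b : ℕ} (hx : x.size ≤ b) (hy : y.size ≤ b) : (x + y).size ≤ b + 1 := by
  rw [Nat.size_le] at *; rw [pow_succ]; omega

theorem size_mul_le {x y : ℕ} : (x * y).size ≤ x.size + y.size := by
  rw [Nat.size_le, pow_add]
  exact Nat.mul_lt_mul'' (Nat.lt_size_self x) (Nat.lt_size_self y)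

theorem Run.const (σ : State) {x n : ℕ} (hx : x ≠ 1) (hn : n ≤ 1) :
    Run (.const x n) σ (σ.setReg x n) 1 := by
  have h1 : n.size ≤ 1 := by rw [Nat.size_le]; omega
  exact ⟨σ.reg_setReg_ne _ hx.symm, _, .const σ x n, fun b hb =>
    ⟨(hb.mono (by omega)).setReg (by omega), by omega⟩⟩

theorem Run.arith (σ : State) (o : Op) {x y z : ℕ} (hx : x ≠ 1)
    (ho : o = .mul → σ.reg z ≤ σ.reg 1) :
    Run (.arith o x y z) σ (σ.setReg x (o.apply (σ.reg y) (σ.reg z))) 1 := by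
  refine ⟨σ.reg_setReg_ne _ hx.symm, _, .arith σ o x y z, fun b hb => ?_⟩
  have hy := hb.1 y
  have hz := hb.1 z
  have hv : (o.apply (σ.reg y) (σ.reg z)).size ≤ b + 1 * (1 + (σ.reg 1).size) := by
    cases o with
    | add => exact (size_add_le hy hz).trans (by omega)
    | sub => exact (Nat.size_le_size (Nat.sub_le _ _)).trans (by omega)
    | div => exact (Nat.size_le_size (Nat.div_le_self _ _)).trans (by omega)
    | mul =>
      have := Nat.size_le_size (ho rfl)
      exact size_mul_le.trans (by omega)
  exact ⟨(hb.mono (by omega)).setReg hv, by omega⟩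

theorem Run.load (σ : State) {x : ℕ} (a y : ℕ) (hx : x ≠ 1) :
    Run (.load x a y) σ (σ.setReg x (σ.arr a (σ.reg y))) 1 := by
  refine ⟨σ.reg_setReg_ne _ hx.symm, _, .load σ x a y, fun b hb => ?_⟩
  have hy := hb.1 y
  have hz := hb.2 a (σ.reg y)
  exact ⟨(hb.mono (by omega)).setReg (by omega), by omega⟩

theorem Run.store (σ : State) (a x y : ℕ) :
    Run (.store a x y) σ (σ.setArr a (σ.reg x) (σ.reg y)) 1 := by
  refine ⟨rfl, _, .store σ a x y, fun b hb => ?_⟩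
  have hy := hb.1 y
  have hz := hb.1 x
  exact ⟨(hb.mono (by omega)).setArr (by omega), by omega⟩

theorem Run.seq {P Q : Prog} {σ₁ σ₂ σ₃ : State} {τ τ' : ℕ}
    (h : Run P σ₁ σ₂ τ) (h' : Run Q σ₂ σ₃ τ') : Run (.seq P Q) σ₁ σ₃ (τ + τ') := by
  obtain ⟨e, β, hβ, hb⟩ := h
  obtain ⟨e', β', hβ', hb'⟩ := h'
  refine ⟨e'.trans e, _, hβ.seq hβ', fun b hB => ?_⟩
  obtain ⟨h1, h2⟩ := hb b hB
  obtain ⟨h3, h4⟩ := hb' _ h1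
  rw [e] at h3 h4
  set γ := (σ₁.reg 1).size
  have : b + τ * (1 + γ) + τ' * (1 + γ) = b + (τ + τ') * (1 + γ) := by ring
  rw [this] at h3 h4
  refine ⟨h3, ?_⟩
  have h5 : τ * (1 + 3 * (b + τ * (1 + γ))) ≤ τ * (1 + 3 * (b + (τ + τ') * (1 + γ))) := by
    gcongr; omega
  calc β + β' ≤ τ * (1 + 3 * (b + (τ + τ') * (1 + γ))) +
        τ' * (1 + 3 * (b + (τ + τ') * (1 + γ))) := by omega
    _ = _ := by ring

/-- A test of a register costs one step. -/
theorem Run.of_test {P Q : Prog} {σ σ' : State} {τ x : ℕ} (h : Run P σ σ' τ)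
    (hQ : ∀ β, Exec P σ σ' τ β → Exec Q σ σ' (1 + τ) (1 + (σ.reg x).size + β)) :
    Run Q σ σ' (1 + τ) := by
  obtain ⟨e, β, hβ, hb⟩ := h
  refine ⟨e, _, hQ β hβ, fun b hB => ?_⟩
  obtain ⟨h1, h2⟩ := hb b hB
  set γ := (σ.reg 1).size
  have hx := hB.1 x
  have h5 : τ * (1 + 3 * (b + τ * (1 + γ))) ≤ τ * (1 + 3 * (b + (1 + τ) * (1 + γ))) := by
    gcongr; omega
  have h6 : b + τ * (1 + γ) ≤ b + (1 + τ) * (1 + γ) := by gcongr; omega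
  refine ⟨h1.mono h6, ?_⟩
  rw [add_mul 1 τ (1 + 3 * (b + (1 + τ) * (1 + γ)))]
  omega

theorem Run.cond_true {x : ℕ} {P Q : Prog} {σ σ' : State} {τ : ℕ} (hx : σ.reg x ≠ 0)
    (h : Run P σ σ' τ) : Run (.cond x P Q) σ σ' (1 + τ) :=
  h.of_test fun _ hβ => .cond_true hx hβ

theorem Run.cond_false {x : ℕ} {P Q : Prog} {σ σ' : State} {τ : ℕ} (hx : σ.reg x = 0)
    (h : Run Q σ σ' τ) : Run (.cond x P Q) σ σ' (1 + τ) :=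
  h.of_test fun _ hβ => .cond_false hx hβ

theorem Run.loop_done {x : ℕ} {P : Prog} {σ : State} (hx : σ.reg x = 0) :
    Run (.loop x P) σ σ 1 := by
  refine ⟨rfl, _, .loop_done hx, fun b hB => ⟨hB.mono (by omega), ?_⟩⟩
  have := hB.1 x
  omega

theorem Run.loop_step {x : ℕ} {P : Prog} {σ₁ σ₂ σ₃ : State} {τ τ' : ℕ} (hx : σ₁.reg x ≠ 0)
    (h : Run P σ₁ σ₂ τ) (h' : Run (.loop x P) σ₂ σ₃ τ') :
    Run (.loop x P) σ₁ σ₃ (1 + (τ + τ')) := by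
  have h3 := h.seq h'
  refine h3.of_test (x := x) fun β hβ => ?_
  generalize τ + τ' = t at hβ ⊢
  cases hβ with
  | seq k k' =>
    have := Exec.loop_step hx k k'
    simpa only [add_assoc] using this

/-! ### Data in the memory -/

/-- The memory of `σ'` extends the memory of `σ`. Register `0` is the heap pointer, arrays `2` and
`3` hold the heap cells, register `1` the bound for factors, array `0` the input. -/
structure Ext (σ σ' : State) : Prop where
  hp : σ.reg 0 ≤ σ'.reg 0
  guard : σ'.reg 1 = σ.reg 1
  fst : ∀ i < σ.reg 0, σ'.arr 2 i = σ.arr 2 i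
  snd : ∀ i < σ.reg 0, σ'.arr 3 i = σ.arr 3 i
  inp : σ'.arr 0 = σ.arr 0
  out : σ'.arr 1 = σ.arr 1

theorem Ext.refl (σ : State) : Ext σ σ := ⟨le_rfl, rfl, fun _ _ => rfl, fun _ _ => rfl, rfl, rfl⟩

theorem Ext.trans {σ₁ σ₂ σ₃ : State} (h : Ext σ₁ σ₂) (h' : Ext σ₂ σ₃) : Ext σ₁ σ₃ where
  hp := h.hp.trans h'.hp
  guard := h'.guard.trans h.guard
  fst i hi := (h'.fst i (hi.trans_le h.hp)).trans (h.fst i hi)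
  snd i hi := (h'.snd i (hi.trans_le h.hp)).trans (h.snd i hi)
  inp := h'.inp.trans h.inp
  out := h'.out.trans h.out

theorem Ext.setReg (σ : State) {x : ℕ} (v : ℕ) (hx : 2 ≤ x) : Ext σ (σ.setReg x v) where
  hp := (σ.reg_setReg_ne v (by omega)).ge
  guard := σ.reg_setReg_ne v (by omega)
  fst _ _ := rfl
  snd _ _ := rfl
  inp := rfl
  out := rfl

/-- Types whose values can be held in memory: `rep σ v a` says that the number `v` represents
`a` in the state `σ`, directly or as a pointer to the heap. The length `len a` counts cells, not
binary digits, and is what running times are measured against. -/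
class HeapRep (α : Type) where
  rep : State → ℕ → α → Prop
  len : α → ℕ
  mono : ∀ {σ σ' : State} {v : ℕ} {a : α}, Ext σ σ' → rep σ v a → rep σ' v a

end RAM

namespace RAM
open HeapRep (rep len)

instance : HeapRep ℕ where
  rep _ v a := v = a
  len _ := 1
  mono _ h := h

instance : HeapRep Bool where
  rep _ v a := v = a.toNat
  len _ := 1
  mono _ h := h

/-- Numbers that may serve as the second factor of a product: those below the guard register. -/
structure Small where
  val : ℕ

instance : HeapRep Small where
  rep σ v a := v = a.val ∧ a.val ≤ σ.reg 1
  len _ := 1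
  mono h h' := ⟨h'.1, h.guard ▸ h'.2⟩

/-- A pair is a pointer to a heap cell that holds its two components. -/
instance {α β : Type} [HeapRep α] [HeapRep β] : HeapRep (α × β) where
  rep σ v a := v < σ.reg 0 ∧ rep σ (σ.arr 2 v) a.1 ∧ rep σ (σ.arr 3 v) a.2
  len a := len a.1 + len a.2
  mono h h' := ⟨h'.1.trans_le h.hp, (h.fst _ h'.1) ▸ HeapRep.mono h h'.2.1,
    (h.snd _ h'.1) ▸ HeapRep.mono h h'.2.2⟩

/-- Linked lists, `0` being the null pointer. -/
def repList {α : Type} [HeapRep α] (σ : State) : ℕ → List α → Prop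
  | v, [] => v = 0
  | v, a :: l => v ≠ 0 ∧ v < σ.reg 0 ∧ rep σ (σ.arr 2 v) a ∧ repList σ (σ.arr 3 v) l

theorem repList.mono {α : Type} [HeapRep α] {σ σ' : State} (h : Ext σ σ') :
    ∀ {l : List α} {v : ℕ}, repList σ v l → repList σ' v l
  | [], _, h' => h'
  | _ :: _, _, h' => ⟨h'.1, h'.2.1.trans_le h.hp, (h.fst _ h'.2.1) ▸ HeapRep.mono h h'.2.2.1,
      (h.snd _ h'.2.1) ▸ repList.mono h h'.2.2.2⟩

instance {α : Type} [HeapRep α] : HeapRep (List α) where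
  rep := repList
  len l := (l.map fun a => len a + 1).sum + 1
  mono h h' := repList.mono h h'

instance {α : Type} [HeapRep α] {p : α → Prop} : HeapRep (Subtype p) where
  rep σ v a := rep σ v a.1
  len a := len a.1
  mono h h' := HeapRep.mono h h'

/-! ### Computable functions with running times -/

/-- What a run of a program computing `f` on register `d` achieves: the result stands in
register `d + 1`, the registers `2, …, d` are unchanged, the memory is extended. -/
def Computes {α β : Type} [HeapRep α] [HeapRep β] (P : Prog) (d : ℕ) (f : α → β) (T : α → ℕ) :
    Prop :=
  ∀ σ a, σ.reg 0 ≠ 0 → rep σ (σ.reg d) a → ∃ σ' τ, Run P σ σ' τ ∧ τ ≤ T a ∧ Ext σ σ' ∧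
    (∀ r, 2 ≤ r → r ≤ d → σ'.reg r = σ.reg r) ∧ rep σ' (σ'.reg (d + 1)) (f a)

/-- `f` is computable with running time `T`, counted in steps. The register of the argument is
arbitrary, so that a program can be run while the registers below it hold other values. -/
def Comp {α β : Type} [HeapRep α] [HeapRep β] (f : α → β) (T : α → ℕ) : Prop :=
  ∀ d, 2 ≤ d → ∃ P, Computes P d f T

variable {α β γ δ : Type} [HeapRep α] [HeapRep β] [HeapRep γ] [HeapRep δ]

theorem Comp.mono {f : α → β} {T T' : α → ℕ} (h : Comp f T) (hT : ∀ a, T a ≤ T' a) :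
    Comp f T' := fun d hd => by
  obtain ⟨P, hP⟩ := h d hd
  refine ⟨P, fun σ a h0 ha => ?_⟩
  obtain ⟨σ', τ, h1, h2, h3⟩ := hP σ a h0 ha
  exact ⟨σ', τ, h1, h2.trans (hT a), h3⟩

/-- `x := y` -/
def mov (x y : ℕ) : Prog := .seq (.const x 0) (.arith .add x x y)

theorem run_mov (σ : State) {x y : ℕ} (hx : x ≠ 1) (hxy : y ≠ x) :
    Run (mov x y) σ (σ.setReg x (σ.reg y)) 2 := by
  have h1 := Run.const σ hx (Nat.zero_le 1)
  have h2 := Run.arith (σ.setReg x 0) .add (x := x) (y := x) (z := y) hx (by simp)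
  have h := h1.seq h2
  have e : (σ.setReg x 0).setReg x (Op.add.apply ((σ.setReg x 0).reg x) ((σ.setReg x 0).reg y)) =
      σ.setReg x (σ.reg y) := by
    simp [State.setReg, Op.apply, Function.update_of_ne hxy]
  rwa [e] at h

theorem Comp.ident : Comp (fun a : α => a) fun _ => 2 := fun d hd =>
  ⟨mov (d + 1) d, fun σ a _ ha => ⟨_, 2, run_mov σ (by omega) (by omega), le_rfl,
    Ext.setReg σ _ (by omega), fun r _ hr => σ.reg_setReg_ne _ (by omega), by
      rw [State.reg_setReg_self]; exact HeapRep.mono (Ext.setReg σ _ (by omega)) ha⟩⟩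

theorem Comp.comp {f : α → β} {g : β → γ} {T : α → ℕ} {T' : β → ℕ} (hg : Comp g T')
    (hf : Comp f T) : Comp (fun a => g (f a)) fun a => T a + T' (f a) + 2 := fun d hd => by
  obtain ⟨P, hP⟩ := hf d hd
  obtain ⟨Q, hQ⟩ := hg (d + 1) (by omega)
  refine ⟨(P.seq Q).seq (mov (d + 1) (d + 2)), fun σ a h0 ha => ?_⟩
  obtain ⟨σ₁, τ₁, r₁, t₁, e₁, p₁, v₁⟩ := hP σ a h0 ha
  have h1 : σ₁.reg 0 ≠ 0 := by have := e₁.hp; omega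
  obtain ⟨σ₂, τ₂, r₂, t₂, e₂, p₂, v₂⟩ := hQ σ₁ _ h1 v₁
  have e₃ : Ext σ₂ (σ₂.setReg (d + 1) (σ₂.reg (d + 2))) := Ext.setReg _ _ (by omega)
  refine ⟨_, _, (r₁.seq r₂).seq (run_mov σ₂ (by omega) (by omega)), by dsimp only; omega,
    (e₁.trans e₂).trans e₃, fun r h2 hr => ?_, ?_⟩
  · rw [σ₂.reg_setReg_ne _ (by omega), p₂ r h2 (by omega), p₁ r h2 hr]
  · rw [State.reg_setReg_self]; exact HeapRep.mono e₃ v₂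

/-- Allocate a heap cell with the entries `y` and `z` and let `x` point to it. -/
def alloc (x y z t : ℕ) : Prog :=
  ((((Prog.store 2 0 y).seq (.store 3 0 z)).seq (mov x 0)).seq (.const t 1)).seq (.arith .add 0 0 t)

theorem run_alloc (σ : State) {x y z t : ℕ} (hx : 2 ≤ x) (ht : 2 ≤ t) (hxt : x ≠ t) :
    ∃ σ', Run (alloc x y z t) σ σ' 6 ∧ Ext σ σ' ∧
      (∀ r, 2 ≤ r → r ≠ x → r ≠ t → σ'.reg r = σ.reg r) ∧ σ'.reg x = σ.reg 0 ∧
      σ'.reg 0 = σ.reg 0 + 1 ∧ σ'.arr 2 (σ.reg 0) = σ.reg y ∧ σ'.arr 3 (σ.reg 0) = σ.reg z := by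
  have h1 := Run.store σ 2 0 y
  have h2 := Run.store (σ.setArr 2 (σ.reg 0) (σ.reg y)) 3 0 z
  set σ₂ := (σ.setArr 2 (σ.reg 0) (σ.reg y)).setArr 3 (σ.reg 0) (σ.reg z) with hσ₂
  have h3 := run_mov σ₂ (x := x) (y := 0) (by omega) (by omega)
  have h4 := Run.const (σ₂.setReg x (σ₂.reg 0)) (x := t) (n := 1) (by omega) le_rfl
  have h5 := Run.arith ((σ₂.setReg x (σ₂.reg 0)).setReg t 1) .add (x := 0) (y := 0) (z := t)
    (by omega) (by simp)
  refine ⟨_, (((h1.seq h2).seq h3).seq h4).seq h5, ⟨?_, ?_, ?_, ?_, ?_, ?_⟩, ?_, ?_, ?_, ?_, ?_⟩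
  · rw [State.reg_setReg_self, State.reg_setReg_ne _ _ (by omega), State.reg_setReg_ne _ _ (by omega)]
    simp [hσ₂, Op.apply]
  · simp [hσ₂, State.reg_setReg, show (1 : ℕ) ≠ t by omega, show (1 : ℕ) ≠ x by omega]
  · intro i hi
    simp [hσ₂, State.arr_setArr]; omega
  · intro i hi
    simp [hσ₂, State.arr_setArr]; omega
  · funext i; simp [hσ₂, State.arr_setArr]
  · funext i; simp [hσ₂, State.arr_setArr]
  · intro r h2 hrx hrt
    simp [hσ₂, State.reg_setReg, hrx, hrt]; omega
  · simp [hσ₂, State.reg_setReg, hxt]; omega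
  · simp [hσ₂, State.reg_setReg, Op.apply, show (0 : ℕ) ≠ t by omega, show (0 : ℕ) ≠ x by omega]
  · simp [hσ₂, State.arr_setArr]
  · simp [hσ₂, State.arr_setArr]

/-- Two computations on the same argument, the results in the registers `d + 1` and `d + 3`. -/
theorem Comp.both {f : α → β} {g : α → γ} {T T' : α → ℕ} (hf : Comp f T)
    (hg : Comp g T') {d : ℕ} (hd : 2 ≤ d) : ∃ P, ∀ σ a, σ.reg 0 ≠ 0 → rep σ (σ.reg d) a →
      ∃ σ' τ, Run P σ σ' τ ∧ τ ≤ T a + T' a + 2 ∧ Ext σ σ' ∧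
        (∀ r, 2 ≤ r → r ≤ d → σ'.reg r = σ.reg r) ∧
        rep σ' (σ'.reg (d + 1)) (f a) ∧ rep σ' (σ'.reg (d + 3)) (g a) := by
  obtain ⟨P, hP⟩ := hf d hd
  obtain ⟨Q, hQ⟩ := hg (d + 2) (by omega)
  refine ⟨(P.seq (mov (d + 2) d)).seq Q, fun σ a h0 ha => ?_⟩
  obtain ⟨σ₁, τ₁, r₁, t₁, e₁, p₁, v₁⟩ := hP σ a h0 ha
  have e₂ : Ext σ₁ (σ₁.setReg (d + 2) (σ₁.reg d)) := Ext.setReg _ _ (by omega)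
  have h1 : (σ₁.setReg (d + 2) (σ₁.reg d)).reg 0 ≠ 0 := by
    have := e₁.hp; have := e₂.hp; omega
  have v₁' : rep (σ₁.setReg (d + 2) (σ₁.reg d)) ((σ₁.setReg (d + 2) (σ₁.reg d)).reg (d + 2)) a := by
    rw [State.reg_setReg_self]
    refine HeapRep.mono e₂ ?_
    rw [p₁ d hd le_rfl]
    exact HeapRep.mono e₁ ha
  obtain ⟨σ₂, τ₂, r₂, t₂, e₃, p₂, v₂⟩ := hQ _ _ h1 v₁'
  refine ⟨_, _, (r₁.seq (run_mov σ₁ (by omega) (by omega))).seq r₂, by omega,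
    (e₁.trans e₂).trans e₃, fun r h2 hr => ?_, ?_, v₂⟩
  · rw [p₂ r h2 (by omega), State.reg_setReg_ne _ _ (by omega), p₁ r h2 hr]
  · rw [p₂ (d + 1) (by omega) (by omega), State.reg_setReg_ne _ _ (by omega)]
    exact HeapRep.mono (e₂.trans e₃) v₁

/-- A new heap cell with two computed components represents whatever is represented in this way:
a pair, or a nonempty list. -/
theorem Comp.cell {f : α → β} {g : α → γ} {T T' : α → ℕ} (hf : Comp f T) (hg : Comp g T')
    (h : α → δ) (hrep : ∀ σ v a, v ≠ 0 → v < σ.reg 0 → rep σ (σ.arr 2 v) (f a) →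
      rep σ (σ.arr 3 v) (g a) → rep σ v (h a)) : Comp h fun a => T a + T' a + 8 := fun d hd => by
  obtain ⟨P, hP⟩ := hf.both hg hd
  refine ⟨P.seq (alloc (d + 1) (d + 1) (d + 3) (d + 2)), fun σ a h0 ha => ?_⟩
  obtain ⟨σ₁, τ₁, r₁, t₁, e₁, p₁, v₁, v₂⟩ := hP σ a h0 ha
  obtain ⟨σ₂, r₂, e₂, p₂, q₁, q₂, q₃, q₄⟩ := run_alloc σ₁ (x := d + 1) (y := d + 1) (z := d + 3)
    (t := d + 2) (by omega) (by omega) (by omega)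
  refine ⟨σ₂, _, r₁.seq r₂, by dsimp only; omega, e₁.trans e₂, fun r h2 hr => ?_, ?_⟩
  · rw [p₂ r h2 (by omega) (by omega), p₁ r h2 hr]
  · rw [q₁]
    refine hrep _ _ _ ?_ (by omega) ?_ ?_
    · have := e₁.hp; omega
    · rw [q₃]; exact HeapRep.mono e₂ v₁
    · rw [q₄]; exact HeapRep.mono e₂ v₂

theorem Comp.pair {f : α → β} {g : α → γ} {T T' : α → ℕ} (hf : Comp f T) (hg : Comp g T') :
    Comp (fun a => (f a, g a)) fun a => T a + T' a + 8 :=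
  hf.cell hg _ fun _ _ _ _ h1 h2 h3 => ⟨h1, h2, h3⟩

theorem Comp.cons {f : α → β} {g : α → List β} {T T' : α → ℕ} (hf : Comp f T) (hg : Comp g T') :
    Comp (fun a => f a :: g a) fun a => T a + T' a + 8 :=
  hf.cell hg _ fun _ _ _ h0 h1 h2 h3 => ⟨h0, h1, h2, h3⟩

theorem setReg_setReg (σ : State) (x v w : ℕ) : (σ.setReg x v).setReg x w = σ.setReg x w := by
  simp [State.setReg]

/-- Programs that only write register `d + 1`. -/
theorem Comp.of_setReg {f : α → β} {t : ℕ} (P : ℕ → Prog)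
    (h : ∀ d, 2 ≤ d → ∀ σ a, rep σ (σ.reg d) a → ∃ v τ, Run (P d) σ (σ.setReg (d + 1) v) τ ∧
      τ ≤ t ∧ rep σ v (f a)) : Comp f fun _ => t := fun d hd => by
  refine ⟨P d, fun σ a _ ha => ?_⟩
  obtain ⟨v, τ, r, ht, hv⟩ := h d hd σ a ha
  have e : Ext σ (σ.setReg (d + 1) v) := Ext.setReg _ _ (by omega)
  exact ⟨_, τ, r, ht, e, fun r h2 hr => σ.reg_setReg_ne _ (by omega), by
    rw [State.reg_setReg_self]; exact HeapRep.mono e hv⟩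

theorem Comp.fst : Comp (fun a : α × β => a.1) fun _ => 1 :=
  .of_setReg (fun d => .load (d + 1) 2 d) fun _ _ σ _ ha =>
    ⟨_, 1, Run.load σ _ _ (by omega), le_rfl, ha.2.1⟩

theorem Comp.snd : Comp (fun a : α × β => a.2) fun _ => 1 :=
  .of_setReg (fun d => .load (d + 1) 3 d) fun _ _ σ _ ha =>
    ⟨_, 1, Run.load σ _ _ (by omega), le_rfl, ha.2.2⟩

theorem Comp.small_val : Comp (fun a : Small => a.val) fun _ => 2 :=
  .of_setReg (fun d => mov (d + 1) d) fun _ _ σ _ ha =>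
    ⟨_, 2, run_mov σ (by omega) (by omega), le_rfl, ha.1⟩

theorem Comp.subtype_val {p : α → Prop} : Comp (fun a : Subtype p => a.1) fun _ => 2 :=
  .of_setReg (fun d => mov (d + 1) d) fun _ _ σ _ ha =>
    ⟨_, 2, run_mov σ (by omega) (by omega), le_rfl, ha⟩

/-- The input word, as it stands in array `0`, when nothing is known of the guard register. This is
what the preparation of that register works on. -/
structure RawWord where
  val : List ℕ

/-- The input word, when its entries are at most the guard register, so that they may serve as
factors. -/
structure Word where
  val : List ℕ

/-- What counts as the length of the input: besides the number of entries the numbers of vertices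
and of edges, and the inverse of the accuracy. -/
def inputLen (w : List ℕ) : ℕ := w.length + w.getD 0 0 + w.getD 1 0 + w.getD 7 0 / w.getD 6 0 + 1

/-- The word stands in array `0`, so any number represents it. -/
instance : HeapRep RawWord where
  rep σ _ w := ∀ i, σ.arr 0 i = w.val.getD i 0
  len w := inputLen w.val
  mono h h' := by rw [h.inp]; exact h'

instance : HeapRep Word where
  rep σ _ w := (∀ i, σ.arr 0 i = w.val.getD i 0) ∧ ∀ i, w.val.getD i 0 ≤ σ.reg 1
  len w := inputLen w.val
  mono h h' := by rw [h.inp, h.guard]; exact h'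

/-- The entry at position `i`. -/
def RawWord.get (w : RawWord) (i : ℕ) : ℕ := w.val.getD i 0

/-- The entry at position `i`. The definition is irreducible to keep unification from unfolding it
to a list access, for which there is no program. -/
@[irreducible] def Word.get (w : Word) (i : ℕ) : Small := ⟨w.val.getD i 0⟩

theorem Word.get_val (w : Word) (i : ℕ) : (w.get i).val = w.val.getD i 0 := by
  unfold Word.get; rfl

theorem Comp.rawGet : Comp (fun p : RawWord × ℕ => p.1.get p.2) fun _ => 2 :=
  .of_setReg (fun d => (Prog.load (d + 1) 3 d).seq (.load (d + 1) 0 (d + 1))) fun d _ σ p ha => by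
    have h1 := Run.load σ (x := d + 1) 3 d (by omega)
    have h2 := Run.load (σ.setReg (d + 1) (σ.arr 3 (σ.reg d))) (x := d + 1) 0 (d + 1) (by omega)
    have h := h1.seq h2
    rw [setReg_setReg, State.reg_setReg_self, State.arr_setReg] at h
    have e : σ.arr 3 (σ.reg d) = p.2 := ha.2.2
    exact ⟨_, _, h, le_rfl, by rw [e]; exact ha.2.1 _⟩

theorem Comp.get : Comp (fun p : Word × ℕ => p.1.get p.2) fun _ => 2 :=
  .of_setReg (fun d => (Prog.load (d + 1) 3 d).seq (.load (d + 1) 0 (d + 1))) fun d _ σ p ha => by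
    have h1 := Run.load σ (x := d + 1) 3 d (by omega)
    have h2 := Run.load (σ.setReg (d + 1) (σ.arr 3 (σ.reg d))) (x := d + 1) 0 (d + 1) (by omega)
    have h := h1.seq h2
    rw [setReg_setReg, State.reg_setReg_self, State.arr_setReg] at h
    have e : σ.arr 3 (σ.reg d) = p.2 := ha.2.2
    exact ⟨_, _, h, le_rfl, by
      rw [e]; exact ⟨by rw [Word.get_val]; exact ha.2.1.1 _, by rw [Word.get_val]; exact ha.2.1.2 _⟩⟩

theorem Comp.zero : Comp (fun _ : α => 0) fun _ => 1 :=
  .of_setReg (fun d => .const (d + 1) 0) fun _ _ σ _ _ =>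
    ⟨_, 1, Run.const σ (by omega) (by omega), le_rfl, rfl⟩

theorem Comp.one : Comp (fun _ : α => 1) fun _ => 1 :=
  .of_setReg (fun d => .const (d + 1) 1) fun _ _ σ _ _ =>
    ⟨_, 1, Run.const σ (by omega) (by omega), le_rfl, rfl⟩

theorem Comp.isEmpty : Comp (fun l : List α => l.isEmpty) fun _ => 2 :=
  .of_setReg (fun d => .cond d (.const (d + 1) 0) (.const (d + 1) 1)) fun d _ σ l ha => by
    cases l with
    | nil => exact ⟨1, _, Run.cond_false ha (Run.const σ (by omega) le_rfl), le_rfl, rfl⟩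
    | cons a l =>
      exact ⟨0, _, Run.cond_true ha.1 (Run.const σ (by omega) (by omega)), le_rfl, rfl⟩

/-- Two arguments in the registers `d + 1` and `d + 3`, a result formed in register `d + 1`. -/
theorem Comp.binary {f : α → β} {g : α → γ} {T T' : α → ℕ} (hf : Comp f T) (hg : Comp g T')
    (h : α → δ) (t : ℕ) (Q : ℕ → Prog) (hQ : ∀ d, 2 ≤ d → ∀ σ a, rep σ (σ.reg (d + 1)) (f a) →
      rep σ (σ.reg (d + 3)) (g a) → ∃ v τ, Run (Q d) σ (σ.setReg (d + 1) v) τ ∧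
        τ ≤ t ∧ rep σ v (h a)) : Comp h fun a => T a + T' a + 2 + t := fun d hd => by
  obtain ⟨P, hP⟩ := hf.both hg hd
  refine ⟨P.seq (Q d), fun σ a h0 ha => ?_⟩
  obtain ⟨σ₁, τ₁, r₁, t₁, e₁, p₁, v₁, v₂⟩ := hP σ a h0 ha
  obtain ⟨v, τ, r, ht, hv⟩ := hQ d hd σ₁ a v₁ v₂
  have e : Ext σ₁ (σ₁.setReg (d + 1) v) := Ext.setReg _ _ (by omega)
  refine ⟨_, _, r₁.seq r, by dsimp only; omega, e₁.trans e, fun r h2 hr => ?_, ?_⟩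
  · rw [State.reg_setReg_ne _ _ (by omega), p₁ r h2 hr]
  · rw [State.reg_setReg_self]; exact HeapRep.mono e hv

theorem Comp.arith {f g : α → ℕ} {T T' : α → ℕ} (hf : Comp f T) (hg : Comp g T') (o : Op)
    (ho : o ≠ .mul) : Comp (fun a => o.apply (f a) (g a)) fun a => T a + T' a + 2 + 1 :=
  hf.binary hg _ 1 (fun d => .arith o (d + 1) (d + 1) (d + 3)) fun d _ σ a h1 h2 =>
    ⟨_, 1, Run.arith σ o (by omega) (fun h => absurd h ho), le_rfl, by rw [h1, h2]; rfl⟩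

theorem Comp.mul_small {f : α → ℕ} {g : α → Small} {T T' : α → ℕ} (hf : Comp f T)
    (hg : Comp g T') : Comp (fun a => f a * (g a).val) fun a => T a + T' a + 2 + 1 :=
  hf.binary hg _ 1 (fun d => .arith .mul (d + 1) (d + 1) (d + 3)) fun d _ σ a h1 h2 =>
    ⟨_, 1, Run.arith σ .mul (by omega) (fun _ => by rw [h2.1]; exact h2.2), le_rfl, by
      rw [h1, h2.1]; rfl⟩

theorem Comp.cond {c : α → Bool} {f g : α → β} {T₀ T₁ T₂ : α → ℕ} (hc : Comp c T₀)
    (hf : Comp f T₁) (hg : Comp g T₂) :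
    Comp (fun a => bif c a then f a else g a) fun a => T₀ a + T₁ a + T₂ a + 1 := fun d hd => by
  obtain ⟨P, hP⟩ := hc d hd
  obtain ⟨Q, hQ⟩ := hf d hd
  obtain ⟨R, hR⟩ := hg d hd
  refine ⟨P.seq (.cond (d + 1) Q R), fun σ a h0 ha => ?_⟩
  obtain ⟨σ₁, τ₁, r₁, t₁, e₁, p₁, v₁⟩ := hP σ a h0 ha
  have h1 : σ₁.reg 0 ≠ 0 := by have := e₁.hp; omega
  have ha' : rep σ₁ (σ₁.reg d) a := by rw [p₁ d hd le_rfl]; exact HeapRep.mono e₁ ha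
  have v₁ : σ₁.reg (d + 1) = (c a).toNat := v₁
  cases h : c a with
  | true =>
    obtain ⟨σ₂, τ₂, r₂, t₂, e₂, p₂, v₂⟩ := hQ σ₁ a h1 ha'
    exact ⟨σ₂, _, r₁.seq (Run.cond_true (by simp [v₁, h]) r₂), by dsimp only; omega, e₁.trans e₂,
      fun r h2 hr => by rw [p₂ r h2 hr, p₁ r h2 hr], by simpa [h] using v₂⟩
  | false =>
    obtain ⟨σ₂, τ₂, r₂, t₂, e₂, p₂, v₂⟩ := hR σ₁ a h1 ha'
    exact ⟨σ₂, _, r₁.seq (Run.cond_false (by simp [v₁, h]) r₂), by dsimp only; omega, e₁.trans e₂,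
      fun r h2 hr => by rw [p₂ r h2 hr, p₁ r h2 hr], by simpa [h] using v₂⟩

/-- Case distinction on a list; a nonempty list is a pointer to the pair of its head and tail. -/
theorem Comp.listCase {l : α → List β} {g : α → δ} {h : α × β × List β → δ} {T₀ T₁ T₂' : α → ℕ}
    {T₂ : α × β × List β → ℕ} (hl : Comp l T₀) (hg : Comp g T₁) (hh : Comp h T₂)
    (hT : ∀ a b l', l a = b :: l' → T₂ (a, b, l') ≤ T₂' a) :
    Comp (fun a => match l a with | [] => g a | b :: l' => h (a, b, l'))
      fun a => T₀ a + T₁ a + T₂' a + 9 := fun d hd => by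
  obtain ⟨P, hP⟩ := hl d hd
  obtain ⟨Q, hQ⟩ := hg d hd
  obtain ⟨R, hR⟩ := hh (d + 2) (by omega)
  refine ⟨P.seq (.cond (d + 1) (((alloc (d + 2) d (d + 1) (d + 3)).seq R).seq
    (mov (d + 1) (d + 3))) Q), fun σ a h0 ha => ?_⟩
  obtain ⟨σ₁, τ₁, r₁, t₁, e₁, p₁, v₁⟩ := hP σ a h0 ha
  have h1 : σ₁.reg 0 ≠ 0 := by have := e₁.hp; omega
  have ha' : rep σ₁ (σ₁.reg d) a := by rw [p₁ d hd le_rfl]; exact HeapRep.mono e₁ ha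
  have v₁ : repList σ₁ (σ₁.reg (d + 1)) (l a) := v₁
  cases hla : l a with
  | nil =>
    rw [hla] at v₁
    obtain ⟨σ₂, τ₂, r₂, t₂, e₂, p₂, v₂⟩ := hQ σ₁ a h1 ha'
    exact ⟨σ₂, _, r₁.seq (Run.cond_false v₁ r₂), by dsimp only; omega, e₁.trans e₂,
      fun r h2 hr => by rw [p₂ r h2 hr, p₁ r h2 hr], by simpa only [hla] using v₂⟩
  | cons b l' =>
    rw [hla] at v₁
    obtain ⟨σ₂, r₂, e₂, p₂, q₁, q₂, q₃, q₄⟩ := run_alloc σ₁ (x := d + 2) (y := d) (z := d + 1)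
      (t := d + 3) (by omega) (by omega) (by omega)
    have v₂ : rep σ₂ (σ₂.reg (d + 2)) (a, b, l') := by
      rw [q₁]
      refine ⟨by omega, ?_, ?_⟩
      · rw [q₃]; exact HeapRep.mono e₂ ha'
      · rw [q₄]; exact HeapRep.mono (α := β × List β) e₂ v₁.2
    obtain ⟨σ₃, τ₃, r₃, t₃, e₃, p₃, v₃⟩ := hR σ₂ _ (by omega) v₂
    have e₄ : Ext σ₃ (σ₃.setReg (d + 1) (σ₃.reg (d + 3))) := Ext.setReg _ _ (by omega)
    have := hT a b l' hla
    refine ⟨_, _, r₁.seq (Run.cond_true v₁.1 ((r₂.seq r₃).seq (run_mov σ₃ (by omega) (by omega)))),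
      by dsimp only; omega, ((e₁.trans e₂).trans e₃).trans e₄, fun r h2 hr => ?_, ?_⟩
    · rw [State.reg_setReg_ne _ _ (by omega), p₃ r h2 (by omega), p₂ r h2 (by omega) (by omega),
        p₁ r h2 hr]
    · rw [State.reg_setReg_self]; simpa only [hla] using HeapRep.mono e₄ v₃

/-- A while loop: the number `k a` of iterations from the initial value `a` appears in the analysis
only, `M a` bounds the time of each iteration. -/
theorem Comp.while {c : α → Bool} {f : α → α} {T₀ T₁ : α → ℕ} (hc : Comp c T₀) (hf : Comp f T₁)
    (k M : α → ℕ) (hk : ∀ a, ∀ i < k a, c (f^[i] a) = true) (hk' : ∀ a, c (f^[k a] a) = false)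
    (hM : ∀ a, ∀ i ≤ k a, T₀ (f^[i] a) + T₁ (f^[i] a) + 3 ≤ M a) :
    Comp (fun a => f^[k a] a) fun a => (k a + 1) * M a := fun d hd => by
  obtain ⟨P, hP⟩ := hc (d + 1) (by omega)
  obtain ⟨Q, hQ⟩ := hf (d + 1) (by omega)
  refine ⟨((mov (d + 1) d).seq P).seq (.loop (d + 2) ((Q.seq (mov (d + 1) (d + 2))).seq P)),
    fun σ a h0 ha => ?_⟩
  have e₀ : Ext σ (σ.setReg (d + 1) (σ.reg d)) := Ext.setReg _ _ (by omega)
  obtain ⟨σ₁, τ₁, r₁, t₁, e₁, p₁, v₁⟩ := hP (σ.setReg (d + 1) (σ.reg d)) a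
    (by have := e₀.hp; omega) (by rw [State.reg_setReg_self]; exact HeapRep.mono e₀ ha)
  -- the loop, entered with the state in register `d + 1` and its test in register `d + 2`; the
  -- evaluation of the test has been counted already
  have main : ∀ (n : ℕ) (b : α) (σ₁ : State), σ₁.reg 0 ≠ 0 → rep σ₁ (σ₁.reg (d + 1)) b →
      rep σ₁ (σ₁.reg (d + 2)) (c b) → (∀ i < n, c (f^[i] b) = true) → c (f^[n] b) = false →
      ∀ B, (∀ i ≤ n, T₀ (f^[i] b) + T₁ (f^[i] b) + 3 ≤ B) →
      ∃ σ' τ, Run (.loop (d + 2) ((Q.seq (mov (d + 1) (d + 2))).seq P)) σ₁ σ' τ ∧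
        τ + (T₀ b + 2) ≤ (n + 1) * B ∧ Ext σ₁ σ' ∧ (∀ r, 2 ≤ r → r ≤ d → σ'.reg r = σ₁.reg r) ∧
        rep σ' (σ'.reg (d + 1)) (f^[n] b) := by
    intro n
    induction n with
    | zero =>
      intro b σ₁ h0 hb hcb _ h B hB
      have hz : σ₁.reg (d + 2) = (c b).toNat := hcb
      rw [Function.iterate_zero, id_eq] at h
      rw [h] at hz
      have := hB 0 le_rfl
      rw [Function.iterate_zero, id_eq] at this
      exact ⟨σ₁, 1, Run.loop_done hz, by omega, Ext.refl _, fun _ _ _ => rfl, hb⟩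
    | succ n ih =>
      intro b σ₁ h0 hb hcb h h' B hB
      have hz : σ₁.reg (d + 2) = (c b).toNat := hcb
      have hz' := h 0 (by omega)
      rw [Function.iterate_zero, id_eq] at hz'
      rw [hz'] at hz
      obtain ⟨σ₂, τ₂, r₂, t₂, e₂, p₂, v₂⟩ := hQ σ₁ b h0 hb
      have e₃ : Ext σ₂ (σ₂.setReg (d + 1) (σ₂.reg (d + 2))) := Ext.setReg _ _ (by omega)
      have v₃ : rep (σ₂.setReg (d + 1) (σ₂.reg (d + 2)))
          ((σ₂.setReg (d + 1) (σ₂.reg (d + 2))).reg (d + 1)) (f b) := by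
        rw [State.reg_setReg_self]; exact HeapRep.mono e₃ v₂
      have h3 : (σ₂.setReg (d + 1) (σ₂.reg (d + 2))).reg 0 ≠ 0 := by
        have := e₂.hp; have := e₃.hp; omega
      obtain ⟨σ₄, τ₄, r₄, t₄, e₄, p₄, v₄⟩ := hP _ _ h3 v₃
      have v₄' : rep σ₄ (σ₄.reg (d + 1)) (f b) := by
        rw [p₄ _ (by omega) le_rfl]; exact HeapRep.mono e₄ v₃
      obtain ⟨σ₅, τ₅, r₅, t₅, e₅, p₅, v₅⟩ := ih (f b) σ₄ (by have := e₄.hp; omega) v₄' v₄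
        (fun i hi => h (i + 1) (by omega)) h' B (fun i hi => hB (i + 1) (by omega))
      refine ⟨σ₅, _, Run.loop_step (by simp [hz]) ((r₂.seq (run_mov σ₂ (by omega)
        (by omega))).seq r₄) r₅, ?_, ((e₂.trans e₃).trans e₄).trans e₅, fun r h2 hr => ?_, v₅⟩
      · have := hB 0 (by omega)
        rw [Function.iterate_zero, id_eq] at this
        rw [add_mul (n + 1) 1 B]
        omega
      · rw [p₅ r h2 hr, p₄ r h2 (by omega), State.reg_setReg_ne _ _ (by omega),
          p₂ r h2 (by omega)]
  have v₁' : rep σ₁ (σ₁.reg (d + 1)) a := by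
    rw [p₁ _ (by omega) le_rfl, State.reg_setReg_self]; exact HeapRep.mono (e₀.trans e₁) ha
  obtain ⟨σ₂, τ₂, r₂, t₂, e₂, p₂, v₂⟩ := main (k a) a σ₁ (by have := e₀.hp; have := e₁.hp; omega)
    v₁' v₁ (hk a) (hk' a) (M a) (hM a)
  refine ⟨σ₂, _, ((run_mov σ (by omega) (by omega)).seq r₁).seq r₂,
    by dsimp only; omega,
    (e₀.trans e₁).trans e₂, fun r h2 hr => ?_, v₂⟩
  rw [p₂ r h2 hr, p₁ r h2 (by omega), State.reg_setReg_ne _ _ (by omega)]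

end RAM

/-! ### Functions computable in polynomially many steps -/

namespace RAM
open HeapRep (rep len)
open Polynomial

theorem eval_mono (p : ℕ[X]) {x y : ℕ} (h : x ≤ y) : p.eval x ≤ p.eval y := by
  rw [eval_eq_sum, eval_eq_sum]
  exact Finset.sum_le_sum fun i _ =>
    Nat.mul_le_mul_left _ (Nat.pow_le_pow_left h _)

variable {α β γ δ : Type} [HeapRep α] [HeapRep β] [HeapRep γ] [HeapRep δ]

/-- `f` is computable by a program whose number of steps, and with it the length of the result,
is polynomial in the length of the argument. -/
@[fun_prop]
def Poly (f : α → β) : Prop :=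
  ∃ p : ℕ[X], Comp f (fun a => p.eval (len a)) ∧ ∀ a, len (f a) ≤ p.eval (len a)

theorem Poly.of {f : α → β} {T : α → ℕ} (h : Comp f T) (p q : ℕ[X])
    (hp : ∀ a, T a ≤ p.eval (len a)) (hq : ∀ a, len (f a) ≤ q.eval (len a)) : Poly f :=
  ⟨p + q, h.mono fun a => by rw [eval_add]; exact (hp a).trans (Nat.le_add_right _ _),
    fun a => by rw [eval_add]; exact (hq a).trans (Nat.le_add_left _ _)⟩

theorem Poly.of_const {f : α → β} {t : ℕ} (h : Comp f fun _ => t) (q : ℕ[X])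
    (hq : ∀ a, len (f a) ≤ q.eval (len a)) : Poly f :=
  .of h (C t) q (fun a => by simp) hq

theorem Poly.len_le {f : α → β} (h : Poly f) : ∃ q : ℕ[X], ∀ a, len (f a) ≤ q.eval (len a) :=
  let ⟨p, hp⟩ := h; ⟨p, hp.2⟩

theorem Poly.comp {g : β → γ} {f : α → β} (hg : Poly g) (hf : Poly f) :
    Poly (fun a => g (f a)) := by
  obtain ⟨p, h1, h2⟩ := hf
  obtain ⟨q, h3, h4⟩ := hg
  refine .of (h3.comp h1) (p + q.comp p + 2) (q.comp p) (fun a => ?_) fun a => ?_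
  · have := eval_mono q (h2 a)
    simp only [eval_add, eval_comp, eval_ofNat]; omega
  · rw [eval_comp]; exact (h4 _).trans (eval_mono q (h2 a))

@[fun_prop]
theorem Poly.ident : Poly (fun a : α => a) := .of_const .ident X fun a => by simp

@[fun_prop]
theorem Poly.comp' {g : β → γ} {f : α → β} (hg : Poly g) (hf : Poly f) :
    Poly (fun a => g (f a)) := hg.comp hf

@[fun_prop]
theorem Poly.fst {f : α → β × γ} (h : Poly f) : Poly (fun a => (f a).1) :=
  Poly.comp (.of_const .fst X fun a => by simp [len]) h

@[fun_prop]
theorem Poly.snd {f : α → β × γ} (h : Poly f) : Poly (fun a => (f a).2) :=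
  Poly.comp (.of_const .snd X fun a => by simp [len]) h

@[fun_prop]
theorem Poly.prodMk {f : α → β} {g : α → γ} (hf : Poly f) (hg : Poly g) :
    Poly (fun a => (f a, g a)) := by
  obtain ⟨p, h1, h2⟩ := hf
  obtain ⟨q, h3, h4⟩ := hg
  refine .of (h1.pair h3) (p + q + 8) (p + q) (fun a => ?_) fun a => ?_
  · simp
  · have := h2 a; have := h4 a
    change len (f a) + len (g a) ≤ _
    simp only [eval_add]; omega

theorem len_cons (a : α) (l : List α) : len (a :: l) = len a + 1 + len l := by
  simp [len, add_assoc]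

@[fun_prop]
theorem Poly.cons {f : α → β} {g : α → List β} (hf : Poly f) (hg : Poly g) :
    Poly (fun a => f a :: g a) := by
  obtain ⟨p, h1, h2⟩ := hf
  obtain ⟨q, h3, h4⟩ := hg
  refine .of (h1.cons h3) (p + q + 8) (p + q + 1) (fun a => ?_) fun a => ?_
  · simp
  · have := h2 a; have := h4 a; rw [len_cons]; simp only [eval_add, eval_one]; omega

theorem Poly.zero : Poly (fun _ : α => 0) := .of_const .zero 1 fun a => by simp [len]

theorem Poly.one : Poly (fun _ : α => 1) := .of_const .one 1 fun a => by simp [len]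

theorem Poly.arith {f g : α → ℕ} (o : Op) (ho : o ≠ .mul) (hf : Poly f) (hg : Poly g) :
    Poly (fun a => o.apply (f a) (g a)) := by
  obtain ⟨p, h1, h2⟩ := hf
  obtain ⟨q, h3, h4⟩ := hg
  refine .of (h1.arith h3 o ho) (p + q + 2 + 1) 1 (fun a => ?_) fun a => ?_
  · simp
  · simp [len]

@[fun_prop]
theorem Poly.add {f g : α → ℕ} (hf : Poly f) (hg : Poly g) : Poly (fun a => f a + g a) :=
  hf.arith .add nofun hg

@[fun_prop]
theorem Poly.sub {f g : α → ℕ} (hf : Poly f) (hg : Poly g) : Poly (fun a => f a - g a) :=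
  hf.arith .sub nofun hg

@[fun_prop]
theorem Poly.div {f g : α → ℕ} (hf : Poly f) (hg : Poly g) : Poly (fun a => f a / g a) :=
  hf.arith .div nofun hg

@[fun_prop]
theorem Poly.mul_small {f : α → ℕ} {g : α → Small} (hf : Poly f) (hg : Poly g) :
    Poly (fun a => f a * (g a).val) := by
  obtain ⟨p, h1, h2⟩ := hf
  obtain ⟨q, h3, h4⟩ := hg
  refine .of (h1.mul_small h3) (p + q + 2 + 1) 1 (fun a => ?_) fun a => ?_
  · simp
  · simp [len]

@[fun_prop]
theorem Poly.small_val {f : α → Small} (hf : Poly f) : Poly (fun a => (f a).val) :=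
  Poly.comp (.of_const .small_val 1 fun a => by simp [len]) hf

@[fun_prop]
theorem Poly.nat (n : ℕ) : Poly (fun _ : α => n) := by
  induction n with
  | zero => exact .zero
  | succ n ih => exact ih.add .one

@[fun_prop]
theorem Poly.rawGet {f : α → RawWord} {g : α → ℕ} (hf : Poly f) (hg : Poly g) :
    Poly (fun a => (f a).get (g a)) :=
  Poly.comp (.of_const .rawGet 1 fun a => by simp [len]) (hf.prodMk hg)

@[fun_prop]
theorem Poly.get {f : α → Word} {g : α → ℕ} (hf : Poly f) (hg : Poly g) :
    Poly (fun a => (f a).get (g a)) :=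
  Poly.comp (g := fun p : Word × ℕ => p.1.get p.2) (.of_const Comp.get 1 fun a => by simp [len])
    (hf.prodMk hg)

@[fun_prop]
theorem Poly.isEmpty {f : α → List β} (hf : Poly f) : Poly (fun a => (f a).isEmpty) :=
  Poly.comp (.of_const .isEmpty 1 fun a => by simp [len]) hf

@[fun_prop]
theorem Poly.cond {c : α → Bool} {f g : α → β} (hc : Poly c) (hf : Poly f) (hg : Poly g) :
    Poly (fun a => bif c a then f a else g a) := by
  obtain ⟨p, h1, h2⟩ := hc
  obtain ⟨q, h3, h4⟩ := hf
  obtain ⟨r, h5, h6⟩ := hg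
  refine .of (h1.cond h3 h5) (p + q + r + 1) (q + r) (fun a => ?_) fun a => ?_
  · simp
  · have := h4 a; have := h6 a
    rw [eval_add]; cases c a <;> simp only [cond_true, cond_false] <;> omega

@[fun_prop]
theorem Poly.decide_eq_zero {f : α → ℕ} (hf : Poly f) : Poly (fun a => decide (f a = 0)) := by
  have h : Comp (fun n : ℕ => decide (n = 0)) fun _ => 2 :=
    .of_setReg (fun d => .cond d (.const (d + 1) 0) (.const (d + 1) 1)) fun d _ σ n ha => by
      rcases Nat.eq_zero_or_pos n with rfl | hn
      · exact ⟨1, _, Run.cond_false ha (Run.const σ (by omega) le_rfl), le_rfl, rfl⟩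
      · exact ⟨0, _, Run.cond_true (by rw [show σ.reg d = n from ha]; omega)
          (Run.const σ (by omega) (by omega)), le_rfl, by simp [rep, hn.ne']⟩
  exact Poly.comp (.of_const h 1 fun a => by simp [len]) hf

@[fun_prop]
theorem Poly.decide_le {f g : α → ℕ} (hf : Poly f) (hg : Poly g) :
    Poly (fun a => decide (f a ≤ g a)) := by
  simp only [← Nat.sub_eq_zero_iff_le]; fun_prop

@[fun_prop]
theorem Poly.decide_lt {f g : α → ℕ} (hf : Poly f) (hg : Poly g) :
    Poly (fun a => decide (f a < g a)) := by
  simp only [Nat.lt_iff_add_one_le]; fun_prop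

@[fun_prop]
theorem Poly.beq {f g : α → ℕ} (hf : Poly f) (hg : Poly g) : Poly (fun a => f a == g a) := by
  have : ∀ x y : ℕ, (x == y) = decide ((x - y) + (y - x) = 0) := fun x y => by
    rw [Bool.eq_iff_iff]; simp; omega
  simp only [this]; fun_prop

@[fun_prop]
theorem Poly.and {f g : α → Bool} (hf : Poly f) (hg : Poly g) : Poly (fun a => f a && g a) := by
  have : ∀ x y : Bool, (x && y) = bif x then y else false := by decide
  simp only [this]; fun_prop

@[fun_prop]
theorem Poly.or {f g : α → Bool} (hf : Poly f) (hg : Poly g) : Poly (fun a => f a || g a) := by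
  have : ∀ x y : Bool, (x || y) = bif x then true else y := by decide
  simp only [this]; fun_prop

@[fun_prop]
theorem Poly.not {f : α → Bool} (hf : Poly f) : Poly (fun a => !f a) := by
  have : ∀ x : Bool, (!x) = bif x then false else true := by decide
  simp only [this]; fun_prop

@[fun_prop]
theorem Poly.min {f g : α → ℕ} (hf : Poly f) (hg : Poly g) : Poly (fun a => min (f a) (g a)) := by
  have : ∀ x y : ℕ, Min.min x y = x - (x - y) := fun x y => by omega
  simp only [this]; fun_prop

theorem Poly.listCase {l : α → List β} {g : α → δ} {h : α → β → List β → δ} (hl : Poly l)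
    (hg : Poly g) (hh : Poly fun p : α × β × List β => h p.1 p.2.1 p.2.2) :
    Poly (fun a => match l a with | [] => g a | b :: l' => h a b l') := by
  obtain ⟨p, h1, h2⟩ := hl
  obtain ⟨q, h3, h4⟩ := hg
  obtain ⟨r, h5, h6⟩ := hh
  have key : ∀ a b l', l a = b :: l' → len (a, b, l') ≤ (X + p).eval (len a) := fun a b l' e => by
    have := h2 a
    rw [e, len_cons] at this
    simp only [eval_add, eval_X]
    change len a + (len b + len l') ≤ _
    omega
  refine .of (h1.listCase h3 h5 (T₂' := fun a => (r.comp (X + p)).eval (len a)) fun a b l' e => ?_)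
    (p + q + r.comp (X + p) + 9) (q + r.comp (X + p)) (fun a => ?_) fun a => ?_
  · rw [eval_comp]; exact eval_mono r (key a b l' e)
  · simp
  · rw [eval_add, eval_comp]
    cases e : l a with
    | nil => exact (h4 a).trans (Nat.le_add_right _ _)
    | cons b l' =>
      exact ((h6 (a, b, l')).trans (eval_mono r (key a b l' e))).trans (Nat.le_add_left _ _)

@[fun_prop]
theorem Poly.headD {f : α → List β} {g : α → β} (hf : Poly f) (hg : Poly g) :
    Poly (fun a => (f a).headD (g a)) := by
  have h := hf.listCase hg (h := fun _ b _ => b) (by fun_prop)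
  convert h using 2 with a
  cases f a <;> rfl

theorem len_le_of_mem {l : List α} {a : α} (h : a ∈ l) : len a ≤ len l := by
  induction l with
  | nil => cases h
  | cons b l ih =>
    rw [len_cons]
    rcases List.mem_cons.1 h with rfl | h
    · omega
    · have := ih h; omega

theorem length_le_len (l : List α) : l.length ≤ len l := by
  induction l with
  | nil => simp
  | cons b l ih => rw [len_cons, List.length_cons]; omega

theorem len_append (l l' : List α) : len (l ++ l') + 1 = len l + len l' := by
  simp [len]; omega

theorem len_drop_le (l : List α) (i : ℕ) : len (l.drop i) ≤ len l := by
  conv_rhs => rw [← List.take_append_drop i l]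
  have := len_append (l.take i) (l.drop i)
  have : 1 ≤ len (l.take i) := by simp [len]
  omega

theorem len_le_mul {l : List α} {B : ℕ} (h : ∀ a ∈ l, len a ≤ B) :
    len l ≤ l.length * (B + 1) + 1 := by
  induction l with
  | nil => simp [len]
  | cons b l ih =>
    have h1 := h b (by simp)
    have h2 := ih fun a ha => h a (by simp [ha])
    rw [len_cons, List.length_cons, add_mul (l.length) 1]; omega

/-- A loop with a polynomial number of iterations in which the state stays polynomially long. -/
theorem Poly.iterate {init : α → β} {c : β → Bool} {f : β → β} (hi : Poly init) (hc : Poly c)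
    (hf : Poly f) (k : β → ℕ) (hk : ∀ b, ∀ i < k b, c (f^[i] b) = true)
    (hk' : ∀ b, c (f^[k b] b) = false) (q : ℕ[X]) (hq : ∀ a, k (init a) ≤ q.eval (len a))
    (hlen : ∀ a, ∀ i ≤ k (init a), len (f^[i] (init a)) ≤ q.eval (len a)) :
    Poly (fun a => f^[k (init a)] (init a)) := by
  obtain ⟨p, h1, h2⟩ := hi
  obtain ⟨r, h3, h4⟩ := hc
  obtain ⟨t, h5, h6⟩ := hf
  have hM : ∀ b, ∀ i ≤ k b, r.eval (len (f^[i] b)) + t.eval (len (f^[i] b)) + 3 ≤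
      (Finset.range (k b + 1)).sup fun i => r.eval (len (f^[i] b)) + t.eval (len (f^[i] b)) + 3 :=
    fun b i hi => Finset.le_sup (f := fun i => r.eval (len (f^[i] b)) + t.eval (len (f^[i] b)) + 3)
      (Finset.mem_range.2 (Nat.lt_succ_of_le hi))
  refine .of ((h3.while h5 k _ hk hk' hM).comp h1) (p + (q + 1) * (r.comp q + t.comp q + 3) + 2) q
    (fun a => ?_) fun a => hlen a _ le_rfl
  simp only [eval_add, eval_mul, eval_comp, eval_one, eval_ofNat]
  gcongr
  · exact hq a
  · refine Finset.sup_le fun i hi => ?_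
    have := hlen a i (Nat.lt_succ_iff.1 (Finset.mem_range.1 hi))
    have := eval_mono r this
    have := eval_mono t ‹len (f^[i] (init a)) ≤ _›
    omega

/-- A fold whose accumulator stays polynomially long; the argument `a` may serve as a parameter of
the step. The prefixes of the list describe the states in the middle of the loop. -/
theorem Poly.foldl {step : α → β → γ → β} {init : α → β} {l : α → List γ}
    (hs : Poly fun p : α × β × γ => step p.1 p.2.1 p.2.2) (hi : Poly init) (hl : Poly l) (q : ℕ[X])
    (hq : ∀ a l', l' <+: l a → len (l'.foldl (step a) (init a)) ≤ q.eval (len a)) :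
    Poly (fun a => (l a).foldl (step a) (init a)) := by
  -- the state of the loop: parameter, accumulator, and the rest of the list
  let f : (α × β) × List γ → (α × β) × List γ := fun s =>
    match s.2 with
    | [] => s
    | b :: l' => ((s.1.1, step s.1.1 s.1.2 b), l')
  have hf : Poly f := by
    refine Poly.listCase (l := fun s : (α × β) × List γ => s.2) (g := fun s => s)
      (h := fun s b l' => ((s.1.1, step s.1.1 s.1.2 b), l')) (by fun_prop) (by fun_prop) ?_
    have : Poly (fun p : ((α × β) × List γ) × γ × List γ =>
        (p.1.1.1, p.1.1.2, p.2.1)) := by fun_prop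
    have h := hs.comp this
    exact .prodMk (.prodMk (by fun_prop) h) (by fun_prop)
  have it : ∀ (l : List γ) (a : α) (b : β) (i : ℕ),
      f^[i] ((a, b), l) = ((a, (l.take i).foldl (step a) b), l.drop i) := by
    intro l a b i
    induction i generalizing l b with
    | zero => simp
    | succ i ih =>
      rw [Function.iterate_succ_apply]
      cases l with
      | nil => change f^[i] ((a, b), []) = _; rw [ih]; simp
      | cons c l => change f^[i] ((a, step a b c), l) = _; rw [ih]; simp
  obtain ⟨r, hr⟩ := hl.len_le
  have h := Poly.iterate (init := fun a => ((a, init a), l a)) (c := fun s => !s.2.isEmpty) (f := f)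
    (by fun_prop) (by fun_prop) hf (fun s => s.2.length) (fun ⟨⟨a, b⟩, l⟩ i hi => by
      rw [it]; simpa using hi) (fun ⟨⟨a, b⟩, l⟩ => by rw [it]; simp) (X + q + r)
    (fun a => by
      have := hr a; have := length_le_len (l a); simp only [eval_add]; omega)
    (fun a i _ => by
      rw [it]
      have h1 := hq a _ (List.take_prefix i (l a))
      have h2 := len_drop_le (l a) i
      have h3 := hr a
      change len a + len _ + len _ ≤ _
      simp only [eval_add, eval_X]
      omega)
  have h' := h.fst.snd
  convert h' using 2 with a
  rw [it]; simp

/-- Folds whose accumulator has bounded length. -/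
theorem Poly.foldl_const {step : α → β → γ → β} {init : α → β} {l : α → List γ}
    (hs : Poly fun p : α × β × γ => step p.1 p.2.1 p.2.2) (hi : Poly init) (hl : Poly l) (B : ℕ)
    (hB : ∀ b : β, len b ≤ B) : Poly (fun a => (l a).foldl (step a) (init a)) :=
  hs.foldl hi hl (C B) fun a l' _ => by simpa using hB _

@[fun_prop]
theorem Poly.foldl_nat {step : α → ℕ → γ → ℕ} {init : α → ℕ} {l : α → List γ}
    (hs : Poly fun p : α × ℕ × γ => step p.1 p.2.1 p.2.2) (hi : Poly init) (hl : Poly l) :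
    Poly (fun a => (l a).foldl (step a) (init a)) :=
  hs.foldl_const hi hl 1 fun _ => le_rfl

@[fun_prop]
theorem Poly.reverse {l : α → List β} (hl : Poly l) : Poly (fun a => (l a).reverse) := by
  obtain ⟨r, hr⟩ := hl.len_le
  have key : ∀ l : List β, l.foldl (fun acc b => b :: acc) [] = l.reverse := by simp
  have h := Poly.foldl (step := fun (_ : α) (acc : List β) (b : β) => b :: acc)
    (init := fun _ => []) (by fun_prop) (by fun_prop) hl r fun a l' h => by
      rw [key]
      refine le_trans ?_ (hr a)
      obtain ⟨t, ht⟩ := h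
      rw [← ht]
      have := len_append l' t
      have : 1 ≤ len t := by simp [len]
      have : len l'.reverse = len l' := by simp [len]
      omega
  simpa only [key] using h

@[fun_prop]
theorem Poly.append {l l' : α → List β} (hl : Poly l) (hl' : Poly l') :
    Poly (fun a => l a ++ l' a) := by
  obtain ⟨r, hr⟩ := hl.len_le
  obtain ⟨r', hr'⟩ := hl'.len_le
  have key : ∀ l l' : List β, l.foldl (fun acc b => b :: acc) l' = l.reverse ++ l' := by simp
  have h := Poly.foldl (step := fun (_ : α) (acc : List β) (b : β) => b :: acc)
    (init := l') (by fun_prop) hl' hl.reverse (r + r') fun a m h => by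
      rw [key]
      have h1 := hr a
      have h2 := hr' a
      obtain ⟨t, ht⟩ := h
      have h3 := len_append m t
      have h4 : 1 ≤ len t := by simp [len]
      have h5 : len m.reverse = len m := by simp [len]
      have h6 : len (l a).reverse = len (l a) := by simp [len]
      have h7 := len_append m.reverse (l' a)
      rw [ht] at h3
      rw [eval_add]
      omega
  simpa only [key, List.reverse_reverse] using h

@[fun_prop]
theorem Poly.flatMap {l : α → List β} {f : α → β → List γ} (hl : Poly l)
    (hf : Poly fun p : α × β => f p.1 p.2) : Poly (fun a => (l a).flatMap (f a)) := by
  obtain ⟨r, hr⟩ := hl.len_le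
  obtain ⟨t, ht⟩ := hf.len_le
  have key : ∀ (l : List β) (g : β → List γ) (m : List γ),
      l.foldl (fun acc b => acc ++ g b) m = m ++ l.flatMap g := by
    intro l g
    induction l with
    | nil => simp
    | cons b l ih => intro m; rw [List.foldl_cons, ih]; simp
  have bd : ∀ (l : List β) (g : β → List γ) (B : ℕ), (∀ b ∈ l, len (g b) ≤ B) →
      len (l.flatMap g) ≤ l.length * B + 1 := by
    intro l g B
    induction l with
    | nil => intro _; simp [len]
    | cons b l ih =>
      intro h
      have h1 := h b (by simp)
      have h2 := ih fun b hb => h b (by simp [hb])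
      have h3 := len_append (g b) (l.flatMap g)
      rw [List.flatMap_cons, List.length_cons, add_mul l.length 1]
      omega
  have hs : Poly fun p : α × List γ × β => p.2.1 ++ f p.1 p.2.2 := by
    have h : Poly fun p : α × List γ × β => (p.1, p.2.2) := by fun_prop
    exact .append (by fun_prop) (hf.comp h)
  have h := Poly.foldl (step := fun a acc b => acc ++ f a b) (init := fun _ => []) hs (by fun_prop)
    hl (r * t.comp (X + r) + 1) fun a m h => by
      rw [key, List.nil_append]
      refine (bd m (f a) (t.eval (len a + r.eval (len a))) fun b hb => ?_).trans ?_
      · refine (ht (a, b)).trans (eval_mono t ?_)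
        have := len_le_of_mem (h.subset hb)
        have := hr a
        change len a + len b ≤ _
        omega
      · simp only [eval_add, eval_mul, eval_comp, eval_one, eval_X]
        gcongr
        exact h.length_le.trans ((length_le_len _).trans (hr a))
  simpa only [key, List.nil_append] using h

@[fun_prop]
theorem Poly.map {l : α → List β} {f : α → β → γ} (hl : Poly l)
    (hf : Poly fun p : α × β => f p.1 p.2) : Poly (fun a => (l a).map (f a)) := by
  have h := hl.flatMap (f := fun a b => [f a b]) (by fun_prop)
  convert h using 2 with a
  induction l a with
  | nil => rfl
  | cons b l ih => simp [ih]

@[fun_prop]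
theorem Poly.filter {l : α → List β} {f : α → β → Bool} (hl : Poly l)
    (hf : Poly fun p : α × β => f p.1 p.2) : Poly (fun a => (l a).filter (f a)) := by
  have h := hl.flatMap (f := fun a b => bif f a b then [b] else []) (by fun_prop)
  convert h using 2 with a
  induction l a with
  | nil => rfl
  | cons b l ih => rw [List.filter_cons, List.flatMap_cons, ← ih]; cases f a b <;> simp

@[fun_prop]
theorem Poly.any {l : α → List β} {f : α → β → Bool} (hl : Poly l)
    (hf : Poly fun p : α × β => f p.1 p.2) : Poly (fun a => (l a).any (f a)) := by
  have h := (hl.filter hf).isEmpty.not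
  convert h using 2 with a
  rw [Bool.eq_iff_iff]; simp

@[fun_prop]
theorem Poly.all {l : α → List β} {f : α → β → Bool} (hl : Poly l)
    (hf : Poly fun p : α × β => f p.1 p.2) : Poly (fun a => (l a).all (f a)) := by
  have h := (hl.any (f := fun a b => !f a b) hf.not).not
  convert h using 2 with a
  rw [Bool.eq_iff_iff]; simp

@[fun_prop]
theorem Poly.length {l : α → List β} (hl : Poly l) : Poly (fun a => (l a).length) := by
  have h := Poly.foldl_const (step := fun (_ : α) (n : ℕ) (_ : β) => n + 1) (init := fun _ => 0)
    (by fun_prop) (by fun_prop) hl 1 fun _ => le_rfl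
  convert h using 2 with a
  rw [List.foldl_add_const]; simp

theorem len_filter_le (p : α → Bool) (l : List α) : len (l.filter p) ≤ len l := by
  induction l with
  | nil => simp
  | cons a l ih =>
    rw [List.filter_cons]
    split
    · rw [len_cons, len_cons]; omega
    · rw [len_cons]; omega

/-- The list of the numbers below a number that is polynomially bounded. -/
theorem Poly.range {f : α → ℕ} (hf : Poly f) (q : ℕ[X]) (hq : ∀ a, f a ≤ q.eval (len a)) :
    Poly (fun a => List.range (f a)) := by
  -- count down and push the counter
  let g : ℕ × List ℕ → ℕ × List ℕ := fun s => (s.1 - 1, (s.1 - 1) :: s.2)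
  have it : ∀ i n, i ≤ n → ∀ l, g^[i] (n, l) =
      (n - i, ((List.range i).map fun j => n - i + j) ++ l) := by
    intro i
    induction i with
    | zero => simp
    | succ i ih =>
      intro n hn l
      rw [Function.iterate_succ_apply', ih n (by omega), List.range_succ_eq_map]
      simp only [g, List.map_cons, List.map_map, List.cons_append, Nat.add_zero, Prod.mk.injEq]
      refine ⟨rfl, congrArg (_ :: ·) (congrArg (· ++ l) ?_)⟩
      refine List.map_congr_left fun j _ => ?_
      simp only [Function.comp]; omega
  have h := Poly.iterate (init := fun a => (f a, ([] : List ℕ))) (c := fun s => !decide (s.1 = 0))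
    (f := g) (by fun_prop) (by fun_prop) (by fun_prop) (fun s => s.1)
    (fun ⟨n, l⟩ i hi => by
      have : i < n := hi
      rw [it i n this.le]; simp; omega)
    (fun ⟨n, l⟩ => by rw [it n n le_rfl]; simp) (2 * q + 3)
    (fun a => by have := hq a; simp only [eval_add, eval_mul, eval_ofNat]; omega)
    (fun a i hi => by
      have hi' : i ≤ f a := hi
      rw [it i _ hi']
      have := hq a
      have e : ∀ i n, len ((List.range i).map fun j => n - i + j) = 2 * i + 1 := fun i n => by
        simp [len, mul_comm, Function.comp_def]
      change 1 + len _ ≤ _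
      rw [List.append_nil, e]
      simp only [eval_add, eval_mul, eval_ofNat]; omega)
  have h' := h.snd
  convert h' using 2 with a
  rw [it _ _ le_rfl]; simp

end RAM

/-! ### From functions of the input word to complete programs -/

namespace RAM
open HeapRep (rep len)
open Polynomial

/-- The sum of the entries of the input word of an instance with `w.get 1` edges. It becomes the
value of the guard register: it is at least every entry, and can be formed without products. -/
def rawSum (w : RawWord) : ℕ :=
  let m := w.get 1
  (List.range (m + m + m + m + m + m + 8)).foldl (fun s i => s + w.get i) 0

theorem Poly.rawSum : Poly rawSum := by
  have h : Poly fun w : RawWord => List.range (w.get 1 + w.get 1 + w.get 1 + w.get 1 + w.get 1 +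
      w.get 1 + 8) := .range (by fun_prop) (6 * X + 8) fun w => by
    have : w.get 1 ≤ len w := by
      simp only [len, inputLen, RawWord.get]
      generalize w.val.getD 7 0 / w.val.getD 6 0 = k
      omega
    simp only [eval_add, eval_mul, eval_ofNat, eval_X]; omega
  exact .foldl_const (step := fun w s i => s + w.get i) (init := fun _ => 0) (by fun_prop)
    (by fun_prop) h 1 fun _ => le_rfl

theorem le_foldl_add (f : ℕ → ℕ) (l : List ℕ) (s : ℕ) :
    s ≤ l.foldl (fun s i => s + f i) s ∧ ∀ i ∈ l, f i ≤ l.foldl (fun s i => s + f i) s := by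
  induction l generalizing s with
  | nil => simp
  | cons a l ih =>
    obtain ⟨h1, h2⟩ := ih (s + f a)
    refine ⟨by rw [List.foldl_cons]; omega, fun i hi => ?_⟩
    rcases List.mem_cons.1 hi with rfl | hi
    · rw [List.foldl_cons]; omega
    · exact h2 i hi

theorem getD_le_rawSum (w : RawWord) (hw : w.val.length = 8 + 6 * w.val.getD 1 0) (i : ℕ) :
    w.val.getD i 0 ≤ rawSum w := by
  by_cases hi : i < w.val.length
  · exact (le_foldl_add w.get _ 0).2 i (by simp only [RawWord.get, List.mem_range]; omega)
  · rw [List.getD_eq_default _ _ (by omega)]; exact Nat.zero_le _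

/-- Store `1` in array `1` at the positions listed in register `3`. -/
def writeOut : Prog :=
  (Prog.const 4 1).seq (.loop 3 (((Prog.load 5 2 3).seq (.store 1 5 4)).seq (.load 3 3 3)))

theorem run_writeOut (σ : State) (l : List ℕ) (hl : rep σ (σ.reg 3) l) (h1 : σ.arr 1 = fun _ => 0) :
    ∃ σ' τ, Run writeOut σ σ' τ ∧ τ ≤ 4 * l.length + 2 ∧ ∀ i, σ'.arr 1 i ≠ 0 ↔ i ∈ l := by
  have main : ∀ (l : List ℕ) (σ : State), repList σ (σ.reg 3) l → σ.reg 4 = 1 →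
      ∃ σ' τ, Run (.loop 3 (((Prog.load 5 2 3).seq (.store 1 5 4)).seq (.load 3 3 3))) σ σ' τ ∧
        τ ≤ 4 * l.length + 1 ∧ ∀ i, σ'.arr 1 i ≠ 0 ↔ i ∈ l ∨ σ.arr 1 i ≠ 0 := by
    intro l
    induction l with
    | nil => intro σ hl _; exact ⟨σ, 1, Run.loop_done hl, by omega, by simp⟩
    | cons a l ih =>
      intro σ hl h4
      have r1 := Run.load σ (x := 5) 2 3 (by omega)
      have r2 := Run.store (σ.setReg 5 (σ.arr 2 (σ.reg 3))) 1 5 4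
      have r3 := Run.load ((σ.setReg 5 (σ.arr 2 (σ.reg 3))).setArr 1
        ((σ.setReg 5 (σ.arr 2 (σ.reg 3))).reg 5) ((σ.setReg 5 (σ.arr 2 (σ.reg 3))).reg 4))
        (x := 3) 3 3 (by omega)
      have r := (r1.seq r2).seq r3
      set σ₁ := (((σ.setReg 5 (σ.arr 2 (σ.reg 3))).setArr 1
        ((σ.setReg 5 (σ.arr 2 (σ.reg 3))).reg 5) ((σ.setReg 5 (σ.arr 2 (σ.reg 3))).reg 4)).setReg 3
          (State.arr _ 3 (State.reg _ 3))) with hσ₁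
      have ha : σ.arr 2 (σ.reg 3) = a := hl.2.2.1
      have e3 : σ₁.reg 3 = σ.arr 3 (σ.reg 3) := by
        simp [hσ₁, State.reg_setReg, State.arr_setArr]
      have e4 : σ₁.reg 4 = 1 := by simp [hσ₁, State.reg_setReg, h4]
      have e1 : ∀ i, σ₁.arr 1 i ≠ 0 ↔ i = a ∨ σ.arr 1 i ≠ 0 := fun i => by
        by_cases hi : i = a <;> simp [hσ₁, State.reg_setReg, State.arr_setArr, h4, ha, hi]
      have hlist : ∀ (m : List ℕ) (v : ℕ), repList σ v m → repList σ₁ v m := by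
        intro m
        induction m with
        | nil => exact fun _ h => h
        | cons b m ih =>
          intro v h
          refine ⟨h.1, ?_, ?_, ?_⟩
          · have : σ₁.reg 0 = σ.reg 0 := by simp [hσ₁, State.reg_setReg]
            rw [this]; exact h.2.1
          · have : σ₁.arr 2 v = σ.arr 2 v := by simp [hσ₁, State.arr_setArr]
            rw [this]; exact h.2.2.1
          · have : σ₁.arr 3 v = σ.arr 3 v := by simp [hσ₁, State.arr_setArr]
            rw [this]; exact ih _ h.2.2.2
      obtain ⟨σ₂, τ, r', ht, h⟩ := ih σ₁ (e3 ▸ hlist _ _ hl.2.2.2) e4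
      refine ⟨σ₂, _, Run.loop_step hl.1 r r', by rw [List.length_cons]; omega, fun i => ?_⟩
      rw [h, e1, List.mem_cons]; tauto
  have e : Ext σ (σ.setReg 4 1) := Ext.setReg _ _ (by omega)
  obtain ⟨σ₂, τ, r, ht, h⟩ := main l (σ.setReg 4 1) (by
    rw [State.reg_setReg_ne _ _ (by omega)]; exact HeapRep.mono (α := List ℕ) e hl) (by simp)
  refine ⟨σ₂, _, (Run.const σ (by omega) le_rfl).seq r, by omega, fun i => ?_⟩
  rw [h, State.arr_setReg, h1]; simp

theorem size_le_wordSize (w : List ℕ) (i : ℕ) : (w.getD i 0).size ≤ wordSize w := by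
  induction w generalizing i with
  | nil => simp
  | cons a w ih =>
    have : wordSize (a :: w) = 1 + a.size + wordSize w := by simp [wordSize]
    cases i with
    | zero => simp [this]; omega
    | succ i => have := ih i; simp only [List.getD_cons_succ]; omega

/-- A computable function from words to lists of positions yields a program that marks these
positions in array `1`. Its number of steps exceeds that of the function by a polynomial in the
length of the input; its logarithmic cost is polynomial in the number of steps and the size of the
input. -/
theorem exists_prog {p : Word → Prop} (hp : ∀ w, p w → w.val.length = 8 + 6 * w.val.getD 1 0)
    {main : Subtype p → List ℕ} {T : Subtype p → ℕ} (hm : Comp main T) :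
    ∃ (P : Prog) (q : ℕ[X]), ∀ w : Subtype p, ∃ σ τ β, Exec P (start w.1.val) σ τ β ∧
      (∀ i, σ.arr 1 i ≠ 0 ↔ i ∈ main w) ∧
      τ ≤ q.eval (inputLen w.1.val) + T w + 4 * (main w).length ∧
      β ≤ τ * (1 + 3 * (wordSize w.1.val + τ + τ * (1 + (wordSize w.1.val + τ)))) := by
  obtain ⟨q, hq, -⟩ := Poly.rawSum
  obtain ⟨P, hP⟩ := hq 2 le_rfl
  obtain ⟨Q, hQ⟩ := hm 2 le_rfl
  refine ⟨((((Prog.const 0 1).seq P).seq (.arith .add 1 1 3)).seq (Q.seq writeOut)), q + 4,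
    fun w => ?_⟩
  set W := w.1.val with hW
  set S := wordSize W with hS
  have b0 : (start W).Bd S := ⟨fun r => by simp [start], fun a i => by
    by_cases ha : a = 0
    · simpa [start, ha] using size_le_wordSize W i
    · simp [start, ha]⟩
  -- the heap starts at `1`, since `0` is the null pointer
  have r1 : Run (.const 0 1) (start W) ((start W).setReg 0 1) 1 := Run.const _ (by omega) le_rfl
  obtain ⟨σ₁, τ₁, r₁, t₁, e₁, p₁, v₁⟩ := hP ((start W).setReg 0 1) ⟨W⟩ (by simp)
    (fun i => by simp [start])
  have r₁ := r1.seq r₁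
  obtain ⟨g₁, β₁, x₁, c₁⟩ := r₁
  obtain ⟨bd₁, cost₁⟩ := c₁ S b0
  have g0 : σ₁.reg 1 = 0 := g₁
  have hz : ((start W).reg 1).size = 0 := by simp [start]
  rw [hz] at bd₁ cost₁
  have v₁ : σ₁.reg 3 = rawSum ⟨W⟩ := v₁
  set G := rawSum ⟨W⟩ with hG
  -- the guard register is set once, outside of the discipline of `Run`
  have x₂ := Exec.arith σ₁ .add 1 1 3
  have hv : Op.add.apply (σ₁.reg 1) (σ₁.reg 3) = G := by rw [g0, v₁]; simp [Op.apply]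
  rw [hv, g0, v₁] at x₂
  set σ₂ := σ₁.setReg 1 G with hσ₂
  have g2 : σ₂.reg 1 = G := by simp [hσ₂]
  have e1 := e₁.hp
  have h2 : σ₂.reg 0 ≠ 0 := by
    rw [hσ₂, State.reg_setReg_ne _ _ (by omega)]
    rw [State.reg_setReg_self] at e1
    omega
  have hGs : G.size ≤ S + (1 + τ₁) := by
    have := bd₁.1 3
    rw [v₁] at this; omega
  have bd₂ : σ₂.Bd (S + (1 + τ₁)) := State.Bd.setReg (by simpa using bd₁) hGs
  obtain ⟨σ₃, τ₃, r₃, t₃, e₃, p₃, v₃⟩ := hQ σ₂ w h2 (by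
    refine ⟨fun i => ?_, fun i => ?_⟩
    · rw [hσ₂, State.arr_setReg, e₁.inp]; simp [start, hW]
    · rw [g2]; exact getD_le_rawSum ⟨W⟩ (hp w.1 w.2) i)
  obtain ⟨σ₄, τ₄, r₄, t₄, h₄⟩ := run_writeOut σ₃ (main w) v₃ (by
    rw [e₃.out, hσ₂, State.arr_setReg, e₁.out]; funext i; simp [start])
  obtain ⟨-, β₃, x₃, c₃⟩ := r₃.seq r₄
  obtain ⟨-, cost₃⟩ := c₃ _ bd₂
  rw [g2] at cost₃
  refine ⟨σ₄, _, _, (x₁.seq x₂).seq x₃, h₄, ?_, ?_⟩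
  · have : τ₁ ≤ q.eval (inputLen W) := t₁
    simp only [eval_add, eval_ofNat]; omega
  · set τ := 1 + τ₁ + 1 + (τ₃ + τ₄) with hτ
    simp only [Nat.size_zero, add_zero, mul_one] at cost₁ ⊢
    have k1 : β₁ ≤ (1 + τ₁) * (1 + 3 * (S + τ + τ * (1 + (S + τ)))) := by
      refine cost₁.trans (Nat.mul_le_mul_left _ ?_)
      have : 0 ≤ τ * (1 + (S + τ)) := Nat.zero_le _
      omega
    have k2 : 1 + G.size + G.size ≤ 1 * (1 + 3 * (S + τ + τ * (1 + (S + τ)))) := by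
      have : 0 ≤ τ * (1 + (S + τ)) := Nat.zero_le _
      omega
    have k3 : β₃ ≤ (τ₃ + τ₄) * (1 + 3 * (S + τ + τ * (1 + (S + τ)))) := by
      refine cost₃.trans ?_
      gcongr <;> omega
    calc _ ≤ (1 + τ₁) * (1 + 3 * (S + τ + τ * (1 + (S + τ)))) +
          1 * (1 + 3 * (S + τ + τ * (1 + (S + τ)))) +
          (τ₃ + τ₄) * (1 + 3 * (S + τ + τ * (1 + (S + τ)))) := by omega
      _ = _ := by rw [hτ]; ring

end RAM

/-! ### The algorithm -/

namespace SPFlow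

/-- A function of two bits, as the table of its values at `00`, `01`, `10`, `11`. -/
abbrev Profile := ℕ × ℕ × ℕ × ℕ

/-- The two vertices on which a factor depends. -/
abbrev Scope := ℕ × ℕ

/-- A profile with the cost of a choice of edges that has it, and this choice as a bit mask. -/
abbrev Entry := Profile × ℕ × ℕ

/-- Like `Entry`, for functions of three bits; the first bit selects a component of the pair. -/
abbrev Entry₂ := (Profile × Profile) × ℕ × ℕ

/-- A piece of the graph that is attached to the rest in the two vertices of the scope, with the
cheapest choices of edges in it. The profile of a choice gives the least capacity of a cut of the
piece for each placement of the two vertices on the source side (`1`) or the sink side (`0`). -/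
abbrev Factor := Scope × List Entry

/-- The source, the sink, and a list whose length is the number `N` of units into which the current
scale is divided. -/
abbrev Config := ℕ × ℕ × List ℕ

/-- Elimination of a vertex and its two neighbours. -/
abbrev Elim := ℕ × ℕ × ℕ

/-- The value of a profile at two bits. -/
def look (p : Profile) (α β : Bool) : ℕ :=
  bif α then (bif β then p.2.2.2 else p.2.2.1) else (bif β then p.2.1 else p.1)

/-- The profile of a function of two bits. -/
def tabulate (f : Bool → Bool → ℕ) : Profile :=
  (f false false, f false true, f true false, f true true)

/-- The bit of the vertex `u` if `v` has the bit `γ`, `x` has `α` and all other vertices `β`. -/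
def bitOf (v x u : ℕ) (γ α β : Bool) : Bool := bif u == v then γ else bif u == x then α else β

/-- Cut values are capped at twice the number of units. -/
def capOf (cfg : Config) : ℕ := cfg.2.2.length + cfg.2.2.length

/-- Add the profile `p`, of scope `sc`, to the profile `q` for the bit `γ` of `v`. -/
def joinProfile (L v x : ℕ) (sc : Scope) (q p : Profile) (γ : Bool) : Profile :=
  tabulate fun α β => min (look q α β + look p (bitOf v x sc.1 γ α β) (bitOf v x sc.2 γ α β)) L

/-- Combine an entry of a product with an entry of a further factor: add costs, masks and cut
values, the latter up to the cap `L`. -/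
def join (L v x : ℕ) (sc : Scope) (e : Entry₂) (e' : Entry) : Entry₂ :=
  ((joinProfile L v x sc e.1.1 e'.1 false, joinProfile L v x sc e.1.2 e'.1 true),
    e.2.1 + e'.2.1, e.2.2 + e'.2.2)

/-- Equality of profiles, spelled out in comparisons of numbers. -/
def eqProfile (p q : Profile) : Bool :=
  p.1 == q.1 && (p.2.1 == q.2.1 && (p.2.2.1 == q.2.2.1 && p.2.2.2 == q.2.2.2))

def sameProfile (e e' : Entry₂) : Bool := eqProfile e.1.1 e'.1.1 && eqProfile e.1.2 e'.1.2

/-- Keep only a cheapest entry for each profile. -/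
def insertEntry (T : List Entry₂) (e : Entry₂) : List Entry₂ :=
  bif T.any (fun e' => sameProfile e e' && decide (e'.2.1 ≤ e.2.1)) then T
  else e :: T.filter fun e' => !sameProfile e e'

def prune (l : List Entry₂) : List Entry₂ := l.foldl insertEntry []

/-- All combinations of an entry of `T` with an entry of `f`, pruned. -/
def product (L v x : ℕ) (T : List Entry₂) (f : Factor) : List Entry₂ :=
  prune (T.flatMap fun e => f.2.map fun e' => join L v x f.1 e e')

/-- `v` belongs to the scope. -/
def touches (v : ℕ) (sc : Scope) : Bool := sc.1 == v || sc.2 == v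

/-- The capped penalty for placing `v` on the side `γ`: it forces the source and the sink to their
sides. -/
def penalty (cfg : Config) (v : ℕ) (γ : Bool) : Profile :=
  bif (bif γ then v == cfg.2.1 else v == cfg.1) then (capOf cfg, capOf cfg, capOf cfg, capOf cfg)
  else (0, 0, 0, 0)

/-- Multiply the factors at `v`, over the bits of `v`, `x` and the other neighbour. -/
def joined (cfg : Config) (v x : ℕ) (FS : List Factor) : List Entry₂ :=
  (FS.filter fun f => touches v f.1).foldl (product (capOf cfg) v x)
    [((penalty cfg v false, penalty cfg v true), 0, 0)]

/-- Minimize over the bit of the eliminated vertex. -/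
def project (e : Entry₂) : Entry :=
  (tabulate fun α β => min (look e.1.1 α β) (look e.1.2 α β), e.2)

/-- Replace the factors at a vertex by one factor on its two neighbours. -/
def eliminate (cfg : Config) (FS : List Factor) (o : Elim) : List Factor :=
  (o.2, (joined cfg o.1 o.2.1 FS).map project) :: FS.filter fun f => !touches o.1 f.1

/-- An edge: a bit for the masks, its two ends, its cost and its capacity. -/
abbrev Edge := (ℕ × Scope) × ℕ × ℕ

/-- The configuration, the edges, the budget and an elimination order. -/
abbrev Data := Config × List Edge × ℕ × List Elim

/-- `x` times the number of units. This is repeated addition, because a machine product needs a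
factor that is below the guard register. -/
def timesUnits (x : ℕ) (S : List ℕ) : ℕ := S.foldl (fun a _ => a + x) 0

/-- The capacity `c` in units of `V / N`, rounded down and capped. -/
def roundCap (cfg : Config) (V c : ℕ) : ℕ := min (timesUnits c cfg.2.2 / V) (capOf cfg)

/-- The factor of a single edge, to be bought or not. -/
def edgeFactor (cfg : Config) (V : ℕ) (e : Edge) : Factor :=
  (e.1.2, [((0, 0, 0, 0), 0, 0),
    ((0, roundCap cfg V e.2.2, roundCap cfg V e.2.2, 0), e.2.1, e.1.1)])

/-- The value and the mask of a best entry within the budget. -/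
def best (B : ℕ) (T : List Entry) : ℕ × ℕ :=
  T.foldl (fun b e => bif decide (e.2.1 ≤ B) && decide (b.1 < min e.1.1 e.1.2.2.2) then
    (min e.1.1 e.1.2.2.2, e.2.2) else b) (0, 0)

/-- The dynamic program at the scale `V`. -/
def solve (D : Data) (V : ℕ) : ℕ × ℕ :=
  best D.2.2.1 ((D.2.2.2.foldl (eliminate D.1) (D.2.1.map (edgeFactor D.1 V))).headD ((0, 0), [])).2

/-- Data, current scale, value and mask of the current solution. -/
abbrev Search := Data × ℕ × ℕ × ℕ

/-- The scale is too small as long as the value exceeds half of the cap. -/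
def tooSmall (s : Search) : Bool := decide (s.1.1.2.2.length < s.2.2.1)

/-- Double the scale and solve again. -/
def double (s : Search) : Search := (s.1, s.2.1 + s.2.1, solve s.1 (s.2.1 + s.2.1))

/-- The search starts at the scale `1`. -/
def initial (D : Data) : Search := (D, 1, solve D 1)

/-- The vertex `v` has exactly the two neighbours `x` and `y`, and is none of the terminals. -/
def removable (a b : ℕ) (E : List Scope) (o : Elim) : Bool :=
  !(o.1 == a) && !(o.1 == b) && !(o.1 == o.2.1) && !(o.1 == o.2.2) && !(o.2.1 == o.2.2) &&
  E.any (fun e => touches o.1 e && touches o.2.1 e) &&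
  E.any (fun e => touches o.1 e && touches o.2.2 e) &&
  E.all (fun e => !touches o.1 e || (touches o.2.1 e || touches o.2.2 e))

/-- The graph after the elimination of a vertex. -/
def shrink (E : List Scope) (o : Elim) : List Scope := o.2 :: E.filter fun e => !touches o.1 e

/-- Eliminate one vertex, if possible. -/
def greedyStep (a b : ℕ) (cands : List Elim) (st : List Scope × List Elim) :
    List Scope × List Elim :=
  bif (cands.filter (removable a b st.1)).isEmpty then st
  else (shrink st.1 ((cands.filter (removable a b st.1)).headD (0, 0, 0)),
    st.2 ++ [(cands.filter (removable a b st.1)).headD (0, 0, 0)])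

/-- Greedy elimination; `R` is the list of the vertices. -/
def greedy (R : List ℕ) (E : List Scope) (a b : ℕ) : List Scope × List Elim :=
  R.foldl (fun st _ => greedyStep a b
    (R.flatMap fun v => R.flatMap fun x => R.map fun y => (v, x, y)) st) (E, [])

/-- Only edges between the terminals are left. -/
def isTerminalGraph (a b : ℕ) (E : List Scope) : Bool :=
  E.all fun e => (e.1 == a || e.1 == b) && (e.2 == a || e.2 == b)

/-- A pair of terminals for which the greedy elimination succeeds. -/
def terminals (R : List ℕ) (E : List Scope) : Scope :=
  ((R.flatMap fun a => R.map fun b => (a, b)).filter fun p =>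
    !(p.1 == p.2) && isTerminalGraph p.1 p.2 (greedy R E p.1 p.2).1).headD (0, 0)

/-- An order in which all vertices can be eliminated; `n` is a vertex outside the graph. -/
def elimOrder (n : ℕ) (R : List ℕ) (E : List Scope) : List Elim :=
  (greedy R E (terminals R E).1 (terminals R E).2).2 ++
    [((terminals R E).1, (terminals R E).2, (terminals R E).2), ((terminals R E).2, n, n)]

open RAM (Word)

/-- The number at position `k` of the record of edge `i`. -/
def field (w : Word) (i k : ℕ) : RAM.Small := w.get (i + i + i + i + i + i + (8 + k))

/-- The numbers of the edges. -/
def edgeIds (w : Word) : List ℕ := List.range (w.get 1).val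

/-- `2 ^ i`, for an edge number `i`. -/
def pow2 (w : Word) (i : ℕ) : ℕ :=
  ((edgeIds w).filter fun j => decide (j < i)).foldl (fun a _ => a + a) 1

/-- A common denominator of the costs and the budget. -/
def costDen (w : Word) : ℕ := (edgeIds w).foldl (fun a i => a * (field w i 3).val) (w.get 5).val

/-- A common denominator of the capacities. -/
def capDen (w : Word) : ℕ := (edgeIds w).foldl (fun a i => a * (field w i 5).val) 1

/-- The ends of edge `i`. -/
def scope (w : Word) (i : ℕ) : Scope := ((field w i 0).val, (field w i 1).val)

/-- Edge `i`, with cost and capacity multiplied by the common denominators. -/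
def edge (w : Word) (i : ℕ) : Edge :=
  ((pow2 w i, scope w i), costDen w / (field w i 3).val * (field w i 2).val,
    capDen w / (field w i 5).val * (field w i 4).val)

/-- A list of length `8 m k`, where `k = ⌊1/ε⌋ + 1` is larger than `1/ε`. -/
def units (w : Word) : List ℕ :=
  (edgeIds w).flatMap fun _ => (List.range ((w.get 7).val / (w.get 6).val + 1)).flatMap
    fun _ => [0, 0, 0, 0, 0, 0, 0, 0]

/-- The instance in natural numbers, with an elimination order. -/
def toData (w : Word) : Data :=
  (((w.get 2).val, (w.get 3).val, units w), (edgeIds w).map (edge w),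
    costDen w / (w.get 5).val * (w.get 4).val,
    elimOrder (w.get 0).val (List.range (w.get 0).val) ((edgeIds w).map (scope w)))

/-- The edges of a mask: those `i` for which `mask / 2 ^ i` is odd. -/
def decode (w : Word) (mask : ℕ) : List ℕ :=
  (edgeIds w).filter fun i => !(mask / pow2 w i - (mask / pow2 w i / 2 + mask / pow2 w i / 2) == 0)

end SPFlow

/-! ### Running times -/

namespace SPFlow

open RAM RAM.HeapRep Polynomial

variable {α : Type} [HeapRep α]

@[fun_prop]
theorem poly_look {p : α → Profile} {a b : α → Bool} (hp : Poly p) (ha : Poly a) (hb : Poly b) :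
    Poly fun c => look (p c) (a c) (b c) := by unfold SPFlow.look; fun_prop

@[fun_prop]
theorem poly_bitOf {v x u : α → ℕ} {c a b : α → Bool} (hv : Poly v) (hx : Poly x) (hu : Poly u)
    (hc : Poly c) (ha : Poly a) (hb : Poly b) :
    Poly fun i => bitOf (v i) (x i) (u i) (c i) (a i) (b i) := by unfold SPFlow.bitOf; fun_prop

@[fun_prop]
theorem poly_capOf {c : α → Config} (hc : Poly c) : Poly fun i => capOf (c i) := by
  unfold SPFlow.capOf; fun_prop

@[fun_prop]
theorem poly_joinProfile {L v x : α → ℕ} {s : α → Scope} {q p : α → Profile} {c : α → Bool}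
    (hL : Poly L) (hv : Poly v) (hx : Poly x) (hs : Poly s) (hq : Poly q) (hp : Poly p)
    (hc : Poly c) : Poly fun i => joinProfile (L i) (v i) (x i) (s i) (q i) (p i) (c i) := by
  unfold SPFlow.joinProfile tabulate; fun_prop

@[fun_prop]
theorem poly_join {L v x : α → ℕ} {s : α → Scope} {e : α → Entry₂} {e' : α → Entry}
    (hL : Poly L) (hv : Poly v) (hx : Poly x) (hs : Poly s) (he : Poly e) (he' : Poly e') :
    Poly fun i => join (L i) (v i) (x i) (s i) (e i) (e' i) := by
  unfold SPFlow.join; fun_prop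

@[fun_prop]
theorem poly_eqProfile {p q : α → Profile} (hp : Poly p) (hq : Poly q) :
    Poly fun i => eqProfile (p i) (q i) := by unfold SPFlow.eqProfile; fun_prop

@[fun_prop]
theorem poly_sameProfile {p q : α → Entry₂} (hp : Poly p) (hq : Poly q) :
    Poly fun i => sameProfile (p i) (q i) := by unfold SPFlow.sameProfile; fun_prop

@[fun_prop]
theorem poly_insertEntry {T : α → List Entry₂} {e : α → Entry₂} (hT : Poly T) (he : Poly e) :
    Poly fun i => insertEntry (T i) (e i) := by unfold SPFlow.insertEntry; fun_prop

theorem length_insertEntry_le (T : List Entry₂) (e : Entry₂) :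
    (insertEntry T e).length ≤ T.length + 1 := by
  unfold insertEntry
  cases T.any _
  · simpa using List.length_filter_le _ T
  · simp

theorem length_foldl_insertEntry_le (l T : List Entry₂) :
    (l.foldl insertEntry T).length ≤ T.length + l.length := by
  induction l generalizing T with
  | nil => simp
  | cons e l ih =>
    have := ih (insertEntry T e)
    have := length_insertEntry_le T e
    rw [List.foldl_cons, List.length_cons]; omega

theorem len_entries₂ (l : List Entry₂) : len l ≤ 11 * l.length + 1 := by
  have := len_le_mul (l := l) (B := 10) fun _ _ => le_rfl
  omega

theorem len_entries (l : List Entry) : len l ≤ 7 * l.length + 1 := by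
  have := len_le_mul (l := l) (B := 6) fun _ _ => le_rfl
  omega

@[fun_prop]
theorem poly_prune {l : α → List Entry₂} (hl : Poly l) : Poly fun i => prune (l i) := by
  obtain ⟨r, hr⟩ := hl.len_le
  refine Poly.foldl (step := fun _ => SPFlow.insertEntry) (init := fun _ => []) (by fun_prop)
    (by fun_prop) hl (11 * r + 1) fun a l' h => (len_entries₂ _).trans ?_
  have h1 := length_foldl_insertEntry_le l' []
  have h2 := h.length_le.trans ((length_le_len _).trans (hr a))
  simp only [eval_add, eval_mul, eval_ofNat, eval_one, List.length_nil] at *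
  omega

@[fun_prop]
theorem poly_product {L v x : α → ℕ} {T : α → List Entry₂} {f : α → Factor} (hL : Poly L)
    (hv : Poly v) (hx : Poly x) (hT : Poly T) (hf : Poly f) :
    Poly fun i => product (L i) (v i) (x i) (T i) (f i) := by
  unfold SPFlow.product; fun_prop

@[fun_prop]
theorem poly_touches {v : α → ℕ} {s : α → Scope} (hv : Poly v) (hs : Poly s) :
    Poly fun i => touches (v i) (s i) := by unfold SPFlow.touches; fun_prop

@[fun_prop]
theorem poly_penalty {c : α → Config} {v : α → ℕ} {b : α → Bool} (hc : Poly c) (hv : Poly v)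
    (hb : Poly b) : Poly fun i => penalty (c i) (v i) (b i) := by
  unfold SPFlow.penalty; fun_prop

/-- Both profiles of the entry have values up to `L`. -/
def Bounded (L : ℕ) (e : Entry₂) : Prop :=
  ((e.1.1.1 ≤ L ∧ e.1.1.2.1 ≤ L) ∧ e.1.1.2.2.1 ≤ L ∧ e.1.1.2.2.2 ≤ L) ∧
    (e.1.2.1 ≤ L ∧ e.1.2.2.1 ≤ L) ∧ e.1.2.2.2.1 ≤ L ∧ e.1.2.2.2.2 ≤ L

theorem sameProfile_iff {e e' : Entry₂} : sameProfile e e' = true ↔ e.1 = e'.1 := by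
  obtain ⟨⟨⟨a, b, c, d⟩, a', b', c', d'⟩, m⟩ := e
  obtain ⟨⟨⟨a₁, b₁, c₁, d₁⟩, a₁', b₁', c₁', d₁'⟩, m₁⟩ := e'
  simp only [sameProfile, eqProfile, Bool.and_eq_true, beq_iff_eq, Prod.mk.injEq]

theorem mem_insertEntry {T : List Entry₂} {e e' : Entry₂} (h : e' ∈ insertEntry T e) :
    e' ∈ T ∨ e' = e := by
  unfold insertEntry at h
  cases hb : T.any _ <;> rw [hb] at h
  · rcases List.mem_cons.1 h with h | h
    · exact .inr h
    · exact .inl (List.mem_of_mem_filter h)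
  · exact .inl h

theorem mem_foldl_insertEntry {l T : List Entry₂} {e : Entry₂} (h : e ∈ l.foldl insertEntry T) :
    e ∈ T ∨ e ∈ l := by
  induction l generalizing T with
  | nil => exact .inl h
  | cons a l ih =>
    rcases ih h with h | h
    · rcases mem_insertEntry h with h | h
      · exact .inl h
      · exact .inr (by simp [h])
    · exact .inr (by simp [h])

theorem mem_of_mem_prune {l : List Entry₂} {e : Entry₂} (h : e ∈ prune l) : e ∈ l :=
  (mem_foldl_insertEntry h).resolve_left (by simp)

theorem nodup_insertEntry {T : List Entry₂} (e : Entry₂) (h : (T.map Prod.fst).Nodup) :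
    ((insertEntry T e).map Prod.fst).Nodup := by
  unfold insertEntry
  cases hb : T.any _
  · simp only [cond_false, List.map_cons, List.nodup_cons]
    refine ⟨fun hm => ?_, h.sublist (List.Sublist.map _ List.filter_sublist)⟩
    obtain ⟨e', he', h'⟩ := List.mem_map.1 hm
    have := (List.mem_filter.1 he').2
    rw [sameProfile_iff.2 h'.symm] at this
    cases this
  · exact h

theorem nodup_foldl_insertEntry (l : List Entry₂) {T : List Entry₂} (h : (T.map Prod.fst).Nodup) :
    ((l.foldl insertEntry T).map Prod.fst).Nodup := by
  induction l generalizing T with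
  | nil => exact h
  | cons a l ih => exact ih (nodup_insertEntry a h)

/-- There are `(L + 1) ^ 8` profiles with values up to `L`. -/
theorem length_prune_le {l : List Entry₂} {L : ℕ} (h : ∀ e ∈ l, Bounded L e) :
    (prune l).length ≤ (L + 1) ^ 8 := by
  have hn : ((prune l).map Prod.fst).Nodup := nodup_foldl_insertEntry l (by simp)
  let s := Finset.range (L + 1)
  have hsub : ((prune l).map Prod.fst).toFinset ⊆
      (s ×ˢ (s ×ˢ (s ×ˢ s))) ×ˢ (s ×ˢ (s ×ˢ (s ×ˢ s))) := by
    intro p hp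
    obtain ⟨e, he, rfl⟩ := List.mem_map.1 (List.mem_toFinset.1 hp)
    have := h e (mem_of_mem_prune he)
    simp only [Bounded] at this
    simp only [Finset.mem_product, s, Finset.mem_range, Nat.lt_succ_iff]
    tauto
  have := Finset.card_le_card hsub
  rw [List.toFinset_card_of_nodup hn, List.length_map] at this
  refine this.trans (le_of_eq ?_)
  simp only [Finset.card_product, s, Finset.card_range]
  ring

theorem bounded_join (L v x : ℕ) (sc : Scope) (e : Entry₂) (e' : Entry) :
    Bounded L (join L v x sc e e') := by
  simp [Bounded, join, joinProfile, tabulate]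

theorem length_product_le (L v x : ℕ) (T : List Entry₂) (f : Factor) :
    (product L v x T f).length ≤ (L + 1) ^ 8 := by
  refine length_prune_le fun e he => ?_
  obtain ⟨a, -, b, -, rfl⟩ : ∃ a ∈ T, ∃ b ∈ f.2, join L v x f.1 a b = e := by simpa using he
  exact bounded_join ..

/-- Pruning keeps the tables polynomially small, whatever the number of factors. -/
theorem length_foldl_product_le (L v x : ℕ) (FS : List Factor) (T : List Entry₂)
    (hT : T.length ≤ (L + 1) ^ 8) : (FS.foldl (product L v x) T).length ≤ (L + 1) ^ 8 := by
  induction FS generalizing T with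
  | nil => exact hT
  | cons f FS ih => exact ih _ (length_product_le ..)

@[fun_prop]
theorem poly_joined {c : α → Config} {v x : α → ℕ} {FS : α → List Factor} (hc : Poly c)
    (hv : Poly v) (hx : Poly x) (hF : Poly FS) : Poly fun i => joined (c i) (v i) (x i) (FS i) := by
  obtain ⟨r, hr⟩ := hc.len_le
  refine Poly.foldl (step := fun i => product (SPFlow.capOf (c i)) (v i) (x i)) (by fun_prop)
    (by fun_prop) (by fun_prop) (11 * (2 * r + 1) ^ 8 + 1) fun a l _ =>
      (len_entries₂ _).trans ?_
  have h1 := length_foldl_product_le (capOf (c a)) (v a) (x a) l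
    [((penalty (c a) (v a) false, penalty (c a) (v a) true), 0, 0)] (Nat.one_le_pow _ _ (by simp))
  have h2 : capOf (c a) ≤ 2 * r.eval (len (c a) - len (c a) + len a) := by
    have h3 := length_le_len (c a).2.2
    have h4 : len (c a) = 1 + (1 + len (c a).2.2) := rfl
    have h5 := hr a
    simp only [capOf, Nat.sub_self, zero_add]
    omega
  simp only [Nat.sub_self, zero_add] at h2
  simp only [eval_add, eval_mul, eval_ofNat, eval_one, eval_pow]
  have h6 : (capOf (c a) + 1) ^ 8 ≤ (2 * r.eval (len a) + 1) ^ 8 :=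
    Nat.pow_le_pow_left (by omega) _
  omega

@[fun_prop]
theorem poly_project {e : α → Entry₂} (he : Poly e) : Poly fun i => project (e i) := by
  unfold project tabulate; fun_prop

@[fun_prop]
theorem poly_eliminate {c : α → Config} {FS : α → List Factor} {o : α → Elim} (hc : Poly c)
    (hF : Poly FS) (ho : Poly o) : Poly fun i => eliminate (c i) (FS i) (o i) := by
  unfold eliminate; fun_prop

theorem len_eliminate_le (c : Config) (FS : List Factor) (o : Elim) :
    len (eliminate c FS o) ≤ len FS + (7 * (capOf c + 1) ^ 8 + 4) := by
  have h1 := len_filter_le (fun f => !touches o.1 f.1) FS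
  have h2 := len_entries ((joined c o.1 o.2.1 FS).map project)
  have h3 : (joined c o.1 o.2.1 FS).length ≤ (capOf c + 1) ^ 8 := by
    refine length_foldl_product_le _ _ _ _ _ ?_
    rw [List.length_singleton]
    exact Nat.one_le_pow _ _ (Nat.succ_pos _)
  generalize (capOf c + 1) ^ 8 = B at *
  rw [List.length_map] at h2
  rw [eliminate, len_cons]
  change (2 + len ((joined c o.1 o.2.1 FS).map project)) + 1 + _ ≤ _
  omega

theorem len_foldl_eliminate_le (c : Config) (l : List Elim) (FS : List Factor) :
    len (l.foldl (eliminate c) FS) ≤ len FS + l.length * (7 * (capOf c + 1) ^ 8 + 4) := by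
  induction l generalizing FS with
  | nil => simp
  | cons o l ih =>
    have h1 := ih (eliminate c FS o)
    have h2 := len_eliminate_le c FS o
    rw [List.foldl_cons, List.length_cons, add_mul l.length 1]; omega

theorem capOf_le (c : Config) : capOf c ≤ 2 * len c := by
  have h3 := length_le_len c.2.2
  have h4 : len c = 1 + (1 + len c.2.2) := rfl
  simp only [capOf]; omega

theorem poly_foldl_eliminate : Poly fun p : Config × List Factor × List Elim =>
    p.2.2.foldl (eliminate p.1) p.2.1 := by
  refine Poly.foldl (α := Config × List Factor × List Elim) (step := fun p => eliminate p.1)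
    (init := fun p => p.2.1) (l := fun p => p.2.2) (by fun_prop) (by fun_prop) (by fun_prop)
    (X + X * (7 * (2 * X + 1) ^ 8 + 4)) ?_
  intro p l h
  refine (len_foldl_eliminate_le p.1 l p.2.1).trans ?_
  have h1 := h.length_le.trans (length_le_len _)
  have h2 := capOf_le p.1
  have h3 : len p = len p.1 + (len p.2.1 + len p.2.2) := rfl
  simp only [eval_add, eval_mul, eval_ofNat, eval_one, eval_pow, eval_X]
  gcongr <;> omega

@[fun_prop]
theorem poly_roundCap {c : α → Config} {V x : α → ℕ} (hc : Poly c) (hV : Poly V) (hx : Poly x) :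
    Poly fun i => roundCap (c i) (V i) (x i) := by
  unfold roundCap timesUnits; fun_prop

@[fun_prop]
theorem poly_edgeFactor {c : α → Config} {V : α → ℕ} {e : α → Edge} (hc : Poly c) (hV : Poly V)
    (he : Poly e) : Poly fun i => edgeFactor (c i) (V i) (e i) := by
  unfold edgeFactor; fun_prop

@[fun_prop]
theorem poly_best {B : α → ℕ} {T : α → List Entry} (hB : Poly B) (hT : Poly T) :
    Poly fun i => best (B i) (T i) := by
  exact Poly.foldl_const (step := fun i (b : ℕ × ℕ) (e : Entry) =>
    bif decide (e.2.1 ≤ B i) && decide (b.1 < min e.1.1 e.1.2.2.2) then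
    (min e.1.1 e.1.2.2.2, e.2.2) else b) (init := fun _ => (0, 0)) (by fun_prop) (by fun_prop) hT
    2 fun _ => le_rfl

@[fun_prop]
theorem poly_solve {D : α → Data} {V : α → ℕ} (hD : Poly D) (hV : Poly V) :
    Poly fun i => solve (D i) (V i) := by
  have h : Poly fun i => ((D i).1, (D i).2.1.map (edgeFactor (D i).1 (V i)), (D i).2.2.2) := by
    fun_prop
  have h' := poly_foldl_eliminate.comp h
  unfold solve
  fun_prop

theorem poly_tooSmall : Poly tooSmall := by unfold tooSmall; fun_prop

theorem poly_double : Poly double := by unfold double; fun_prop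

@[fun_prop]
theorem poly_removable {a b : α → ℕ} {E : α → List Scope} {o : α → Elim} (ha : Poly a)
    (hb : Poly b) (hE : Poly E) (ho : Poly o) :
    Poly fun i => removable (a i) (b i) (E i) (o i) := by
  unfold removable; fun_prop

@[fun_prop]
theorem poly_shrink {E : α → List Scope} {o : α → Elim} (hE : Poly E) (ho : Poly o) :
    Poly fun i => shrink (E i) (o i) := by
  unfold shrink; fun_prop

@[fun_prop]
theorem poly_greedyStep {a b : α → ℕ} {c : α → List Elim} {st : α → List Scope × List Elim}
    (ha : Poly a) (hb : Poly b) (hc : Poly c) (hs : Poly st) :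
    Poly fun i => greedyStep (a i) (b i) (c i) (st i) := by
  unfold greedyStep; fun_prop

theorem len_greedyStep_le (a b : ℕ) (cands : List Elim) (st : List Scope × List Elim) :
    len (greedyStep a b cands st) ≤ len st + 7 := by
  have e : len st = len st.1 + len st.2 := rfl
  unfold greedyStep
  cases (cands.filter (removable a b st.1)).isEmpty
  · set o := (cands.filter (removable a b st.1)).headD (0, 0, 0)
    have h1 : len (shrink st.1 o) ≤ len st.1 + 3 := by
      have := len_filter_le (fun e => !touches o.1 e) st.1
      rw [shrink, len_cons]
      change 2 + 1 + _ ≤ _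
      omega
    have h2 := len_append st.2 [o]
    have h3 : len [o] = 5 := rfl
    change len (shrink st.1 o) + len (st.2 ++ [o]) ≤ _
    omega
  · exact Nat.le_add_right _ _

theorem len_foldl_greedyStep_le (a b : ℕ) (cands : List Elim) (l : List ℕ)
    (st : List Scope × List Elim) :
    len (l.foldl (fun st _ => greedyStep a b cands st) st) ≤ len st + 7 * l.length := by
  induction l generalizing st with
  | nil => exact le_rfl
  | cons i l ih =>
    have h1 := ih (greedyStep a b cands st)
    have h2 := len_greedyStep_le a b cands st
    rw [List.foldl_cons, List.length_cons]; omega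

@[fun_prop]
theorem poly_greedy {R : α → List ℕ} {E : α → List Scope} {a b : α → ℕ} (hR : Poly R) (hE : Poly E)
    (ha : Poly a) (hb : Poly b) : Poly fun i => greedy (R i) (E i) (a i) (b i) := by
  obtain ⟨r, hr⟩ := hR.len_le
  obtain ⟨t, ht⟩ := hE.len_le
  refine Poly.foldl (step := fun i st _ => greedyStep (a i) (b i)
    ((R i).flatMap fun v => (R i).flatMap fun x => (R i).map fun y => (v, x, y)) st)
    (init := fun i => (E i, [])) ?_ (by fun_prop) hR (t + 1 + 7 * r) fun i l h =>
      (len_foldl_greedyStep_le ..).trans ?_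
  · fun_prop
  · have h2 := h.length_le.trans ((length_le_len _).trans (hr i))
    have h3 := ht i
    simp only [eval_add, eval_mul, eval_ofNat, eval_one]
    change len (E i) + 1 + _ ≤ _
    omega

@[fun_prop]
theorem poly_terminals {R : α → List ℕ} {E : α → List Scope} (hR : Poly R) (hE : Poly E) :
    Poly fun i => terminals (R i) (E i) := by
  unfold terminals isTerminalGraph; fun_prop

@[fun_prop]
theorem poly_elimOrder {n : α → ℕ} {R : α → List ℕ} {E : α → List Scope} (hn : Poly n)
    (hR : Poly R) (hE : Poly E) : Poly fun i => elimOrder (n i) (R i) (E i) := by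
  unfold elimOrder; fun_prop

@[fun_prop]
theorem poly_field {w : α → Word} {i k : α → ℕ} (hw : Poly w) (hi : Poly i) (hk : Poly k) :
    Poly fun a => field (w a) (i a) (k a) := by unfold field; fun_prop

@[fun_prop]
theorem poly_edgeIds {w : α → Word} (hw : Poly w) : Poly fun a => edgeIds (w a) := by
  have h : Poly fun w : Word => edgeIds w := .range (by fun_prop) X fun w => by
    simp only [len, inputLen, Word.get_val, eval_X]
    generalize w.val.getD 7 0 / w.val.getD 6 0 = k
    omega
  exact h.comp hw

@[fun_prop]
theorem poly_vertices {w : α → Word} (hw : Poly w) :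
    Poly fun a => List.range ((w a).get 0).val := by
  have h : Poly fun w : Word => List.range (w.get 0).val := .range (by fun_prop) X fun w => by
    simp only [len, inputLen, Word.get_val, eval_X]
    generalize w.val.getD 7 0 / w.val.getD 6 0 = k
    omega
  exact h.comp hw

@[fun_prop]
theorem poly_units {w : α → Word} (hw : Poly w) : Poly fun a => units (w a) := by
  have h : Poly fun w : Word => List.range ((w.get 7).val / (w.get 6).val + 1) :=
    .range (by fun_prop) X fun w => by
      simp only [len, inputLen, Word.get_val, eval_X]
      generalize w.val.getD 7 0 / w.val.getD 6 0 = k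
      omega
  have h' : Poly fun w : Word => units w := by
    unfold units
    refine .flatMap (f := fun (w : Word) _ => (List.range ((w.get 7).val / (w.get 6).val + 1)).flatMap
      fun _ => [0, 0, 0, 0, 0, 0, 0, 0]) (by fun_prop) (.flatMap (h.comp (by fun_prop)) (by fun_prop))
  exact h'.comp hw

@[fun_prop]
theorem poly_pow2 {w : α → Word} {i : α → ℕ} (hw : Poly w) (hi : Poly i) :
    Poly fun a => pow2 (w a) (i a) := by unfold pow2; fun_prop

@[fun_prop]
theorem poly_costDen {w : α → Word} (hw : Poly w) : Poly fun a => costDen (w a) := by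
  unfold costDen; fun_prop

@[fun_prop]
theorem poly_capDen {w : α → Word} (hw : Poly w) : Poly fun a => capDen (w a) := by
  unfold capDen; fun_prop

@[fun_prop]
theorem poly_edge {w : α → Word} {i : α → ℕ} (hw : Poly w) (hi : Poly i) :
    Poly fun a => edge (w a) (i a) := by unfold edge scope; fun_prop

theorem poly_toData : Poly toData := by unfold toData scope; fun_prop

theorem poly_decode : Poly fun p : Word × ℕ => decode p.1 p.2 := by unfold decode; fun_prop

end SPFlow

/-! ### Series-parallel graphs and elimination orders -/

namespace SPFlow

/-- The simple graph with adjacency `H` on the vertex set `S` is series-parallel with terminals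
`a`, `b`; parallel parts may share the edge between the terminals. -/
inductive SPG : (ℕ → ℕ → Prop) → Finset ℕ → ℕ → ℕ → Prop
  | edge {H : ℕ → ℕ → Prop} {S : Finset ℕ} {a b : ℕ} (hab : a ≠ b)
      (hH : ∀ u v, H u v ↔ u = a ∧ v = b ∨ u = b ∧ v = a) (hS : ∀ u, u ∈ S ↔ u = a ∨ u = b) :
      SPG H S a b
  | series {H₁ H₂ H : ℕ → ℕ → Prop} {S₁ S₂ S : Finset ℕ} {a c b : ℕ} :
      SPG H₁ S₁ a c → SPG H₂ S₂ c b → (∀ u, u ∈ S₁ → u ∈ S₂ → u = c) →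
      (∀ u v, H u v ↔ H₁ u v ∨ H₂ u v) → (∀ u, u ∈ S ↔ u ∈ S₁ ∨ u ∈ S₂) → SPG H S a b
  | parallel {H₁ H₂ H : ℕ → ℕ → Prop} {S₁ S₂ S : Finset ℕ} {a b : ℕ} :
      SPG H₁ S₁ a b → SPG H₂ S₂ a b → (∀ u, u ∈ S₁ → u ∈ S₂ → u = a ∨ u = b) →
      (∀ u v, H u v ↔ H₁ u v ∨ H₂ u v) → (∀ u, u ∈ S ↔ u ∈ S₁ ∨ u ∈ S₂) → SPG H S a b

namespace SPG

variable {H : ℕ → ℕ → Prop} {S : Finset ℕ} {a b : ℕ}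

theorem mem (h : SPG H S a b) : a ∈ S ∧ b ∈ S := by
  induction h with
  | edge _ _ hS => simp [hS]
  | series _ _ _ _ hS ih₁ ih₂ => simp [hS, ih₁, ih₂]
  | parallel _ _ _ _ hS ih₁ ih₂ => simp [hS, ih₁]

theorem ne (h : SPG H S a b) : a ≠ b := by
  induction h with
  | edge hab => exact hab
  | series h₁ h₂ hi _ _ ih₁ ih₂ =>
    rintro rfl
    exact ih₁ (hi _ h₁.mem.1 h₂.mem.2)
  | parallel _ _ _ _ _ ih₁ => exact ih₁

theorem adj (h : SPG H S a b) {u v : ℕ} (huv : H u v) : H v u ∧ u ∈ S ∧ v ∈ S ∧ u ≠ v := by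
  induction h generalizing u v <;> grind

theorem exists_adj (h : SPG H S a b) : (∃ u, H a u) ∧ ∃ u, H b u := by
  induction h with
  | edge _ hH _ => exact ⟨⟨_, (hH _ _).2 (.inl ⟨rfl, rfl⟩)⟩, ⟨_, (hH _ _).2 (.inr ⟨rfl, rfl⟩)⟩⟩
  | series => grind
  | parallel => grind

theorem symm (h : SPG H S a b) : SPG H S b a := by
  induction h with
  | edge hab hH hS => exact .edge hab.symm (by grind) (by grind)
  | series _ _ hi hH hS ih₁ ih₂ => exact .series ih₂ ih₁ (by grind) (by grind) (by grind)
  | parallel _ _ hi hH hS ih₁ ih₂ => exact .parallel ih₁ ih₂ (by grind) (by grind) (by grind)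

theorem congr (h : SPG H S a b) {H' : ℕ → ℕ → Prop} {S' : Finset ℕ}
    (hH : ∀ u v, H' u v ↔ H u v) (hS : ∀ u, u ∈ S' ↔ u ∈ S) : SPG H' S' a b := by
  have h1 : H' = H := by funext u v; exact propext (hH u v)
  have h2 : S' = S := Finset.ext hS
  rwa [h1, h2]

/-- A vertex that is no terminal and has exactly two neighbours. -/
theorem exists_removable (h : SPG H S a b) (hv : ∃ v ∈ S, v ≠ a ∧ v ≠ b) :
    ∃ v x y, v ≠ a ∧ v ≠ b ∧ x ≠ y ∧ H v x ∧ H v y ∧ ∀ u, H v u → u = x ∨ u = y := by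
  induction h with
  | edge _ _ hS => obtain ⟨v, h, ha, hb⟩ := hv; simp [hS, ha, hb] at h
  | @series H₁ H₂ H S₁ S₂ S a c b h₁ h₂ hi hH hS ih₁ ih₂ =>
    by_cases h1 : ∃ v ∈ S₁, v ≠ a ∧ v ≠ c
    · obtain ⟨v, x, y, hv⟩ := ih₁ h1
      refine ⟨v, x, y, ?_⟩
      have := h₂.mem
      have := h₁.adj (u := v) (v := x)
      have : v ∉ S₂ := by grind
      have := fun u => h₂.adj (u := v) (v := u)
      grind
    · by_cases h2 : ∃ v ∈ S₂, v ≠ c ∧ v ≠ b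
      · obtain ⟨v, x, y, hv⟩ := ih₂ h2
        refine ⟨v, x, y, ?_⟩
        have := h₁.mem
        have := h₂.adj (u := v) (v := x)
        have : v ∉ S₁ := by grind
        have := fun u => h₁.adj (u := v) (v := u)
        grind
      · push Not at h1 h2
        obtain ⟨u₁, hu₁⟩ := h₁.exists_adj.2
        obtain ⟨u₂, hu₂⟩ := h₂.exists_adj.1
        refine ⟨c, a, b, h₁.ne.symm, h₂.ne, ?_, ?_, ?_, ?_⟩
        · have := h₁.mem; have := h₂.mem; have := h₁.ne; grind
        · have := h₁.adj hu₁; grind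
        · have := h₂.adj hu₂; grind
        · intro u hu
          rcases (hH _ _).1 hu with h | h
          · have := h₁.adj h; grind
          · have := h₂.adj h; grind
  | @parallel H₁ H₂ H S₁ S₂ S a b h₁ h₂ hi hH hS ih₁ ih₂ =>
    obtain ⟨v, hv, hva, hvb⟩ := hv
    rcases (hS v).1 hv with h | h
    · obtain ⟨v, x, y, hv⟩ := ih₁ ⟨v, h, hva, hvb⟩
      refine ⟨v, x, y, ?_⟩
      have := h₁.adj (u := v) (v := x)
      have := fun u => h₂.adj (u := v) (v := u)
      grind
    · obtain ⟨v, x, y, hv⟩ := ih₂ ⟨v, h, hva, hvb⟩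
      refine ⟨v, x, y, ?_⟩
      have := h₂.adj (u := v) (v := x)
      have := fun u => h₁.adj (u := v) (v := u)
      grind

/-- If the terminal `b` has the single neighbour `x`, then the graph is an edge or arises from a
graph with terminals `a`, `x` by attaching the edge `xb`. -/
theorem pendant (h : SPG H S a b) {x : ℕ} (hx : ∀ u, H b u ↔ u = x) :
    (x = a ∧ (∀ u v, H u v ↔ u = a ∧ v = b ∨ u = b ∧ v = a) ∧ ∀ u, u ∈ S ↔ u = a ∨ u = b) ∨
      SPG (fun u v => H u v ∧ u ≠ b ∧ v ≠ b) (S.erase b) a x := by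
  induction h generalizing x with
  | edge hab hH hS => exact .inl ⟨((hx _).1 ((hH _ _).2 (.inr ⟨rfl, rfl⟩))).symm, hH, hS⟩
  | @series H₁ H₂ H S₁ S₂ S a c b h₁ h₂ hi hH hS ih₁ ih₂ =>
    right
    have hb₁ : b ∉ S₁ := fun h => h₂.ne (hi b h h₂.mem.2).symm
    have hN : ∀ u, ¬ H₁ b u := fun u hu => hb₁ (h₁.adj hu).2.1
    have hN' : ∀ u, ¬ H₁ u b := fun u hu => hb₁ (h₁.adj hu).2.2.1
    rcases ih₂ (x := x) (by grind) with ⟨rfl, hE, hS'⟩ | h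
    · refine h₁.congr (by grind) fun u => ?_
      have := h₁.mem
      grind
    · exact .series h₁ h (by grind) (by grind) (by grind)
  | @parallel H₁ H₂ H S₁ S₂ S a b h₁ h₂ hi hH hS ih₁ ih₂ =>
    left
    obtain ⟨u₁, hu₁⟩ := h₁.exists_adj.2
    obtain ⟨u₂, hu₂⟩ := h₂.exists_adj.2
    obtain rfl : u₁ = x := by grind
    obtain rfl : u₂ = u₁ := by grind
    have m₁ := h₁.adj hu₁
    have m₂ := h₂.adj hu₂
    obtain rfl : u₂ = a := by grind
    have i₁ := ih₁ (x := u₂) (by grind)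
    have i₂ := ih₂ (x := u₂) (by grind)
    rcases i₁ with ⟨-, i₁⟩ | i₁
    · rcases i₂ with ⟨-, i₂⟩ | i₂
      · grind
      · exact absurd rfl i₂.ne
    · exact absurd rfl i₁.ne

/-- Removing a vertex with exactly two neighbours and joining these. -/
theorem eliminate (h : SPG H S a b) {v x y : ℕ} (hva : v ≠ a) (hvb : v ≠ b) (hxy : x ≠ y)
    (hx : ∀ u, H v u ↔ u = x ∨ u = y) :
    SPG (fun u w => (H u w ∧ u ≠ v ∧ w ≠ v) ∨ u = x ∧ w = y ∨ u = y ∧ w = x) (S.erase v) a b := by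
  induction h generalizing x y with
  | edge hab hH hS =>
    have := (hH _ _).1 ((hx x).2 (.inl rfl))
    grind
  | @series H₁ H₂ H S₁ S₂ S a c b h₁ h₂ hi hH hS ih₁ ih₂ =>
    by_cases hvc : v = c
    · subst hvc
      -- one neighbour lies in each part
      have key : ∀ x y, x ≠ y → (∀ u, H v u ↔ u = x ∨ u = y) → H₁ v x → H₂ v y →
          SPG (fun u w => (H u w ∧ u ≠ v ∧ w ≠ v) ∨ u = x ∧ w = y ∨ u = y ∧ w = x)
            (S.erase v) a b := by
        intro x y hxy hx h1 h2
        have m₁ := h₁.adj h1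
        have m₂ := h₂.adj h2
        have n₁ : ∀ u, H₁ v u ↔ u = x := fun u =>
          ⟨fun hu => by have := h₁.adj hu; grind, by grind⟩
        have n₂ : ∀ u, H₂ v u ↔ u = y := fun u =>
          ⟨fun hu => by have := h₂.adj hu; grind, by grind⟩
        have t₁ := h₁.mem
        have t₂ := h₂.mem
        have hxy' : SPG (fun u w => u = x ∧ w = y ∨ u = y ∧ w = x) {x, y} x y :=
          .edge hxy (by grind) (by grind)
        have left : SPG (fun u w => (H₁ u w ∧ u ≠ v ∧ w ≠ v) ∨ u = x ∧ w = y ∨ u = y ∧ w = x)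
            (insert y (S₁.erase v)) a y := by
          rcases h₁.pendant n₁ with ⟨rfl, hE, hS'⟩ | h
          · exact .edge hxy (by grind) (by grind)
          · exact .series h hxy' (by grind) (by grind) (by have := h.mem; grind)
        rcases h₂.symm.pendant n₂ with ⟨rfl, hE, hS'⟩ | h
        · exact left.congr (by grind) (by grind)
        · have := h.mem
          exact .series left h.symm (by grind) (by grind) (by grind)
      obtain ⟨u₁, hu₁⟩ := h₁.exists_adj.2
      obtain ⟨u₂, hu₂⟩ := h₂.exists_adj.1
      have m₁ := h₁.adj hu₁
      have m₂ := h₂.adj hu₂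
      have hne : u₁ ≠ u₂ := by grind
      have e₁ : u₁ = x ∨ u₁ = y := by grind
      have e₂ : u₂ = x ∨ u₂ = y := by grind
      by_cases hu : u₁ = x
      · exact key x y hxy hx (by grind) (by grind)
      · exact (key y x hxy.symm (by grind) (by grind) (by grind)).congr (by grind) (by grind)
    · have hv : H v x := (hx x).2 (.inl rfl)
      have t₁ := h₁.mem
      have t₂ := h₂.mem
      rcases (hH _ _).1 hv with h | h
      · have m := h₁.adj h
        have hv₂ : v ∉ S₂ := by grind
        have n₂ : ∀ u, ¬ H₂ v u := fun u hu => hv₂ (h₂.adj hu).2.1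
        have n₂' : ∀ u, ¬ H₂ u v := fun u hu => hv₂ (h₂.adj hu).2.2.1
        exact .series (ih₁ hva hvc hxy (by grind)) h₂ (by grind) (by grind) (by grind)
      · have m := h₂.adj h
        have hv₁ : v ∉ S₁ := by grind
        have n₁ : ∀ u, ¬ H₁ v u := fun u hu => hv₁ (h₁.adj hu).2.1
        have n₁' : ∀ u, ¬ H₁ u v := fun u hu => hv₁ (h₁.adj hu).2.2.1
        exact .series h₁ (ih₂ hvc hvb hxy (by grind)) (by grind) (by grind) (by grind)
  | @parallel H₁ H₂ H S₁ S₂ S a b h₁ h₂ hi hH hS ih₁ ih₂ =>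
    have hv : H v x := (hx x).2 (.inl rfl)
    rcases (hH _ _).1 hv with h | h
    · have m := h₁.adj h
      have hv₂ : v ∉ S₂ := by grind
      have n₂ : ∀ u, ¬ H₂ v u := fun u hu => hv₂ (h₂.adj hu).2.1
      have n₂' : ∀ u, ¬ H₂ u v := fun u hu => hv₂ (h₂.adj hu).2.2.1
      exact .parallel (ih₁ hva hvb hxy (by grind)) h₂ (by grind) (by grind) (by grind)
    · have m := h₂.adj h
      have hv₁ : v ∉ S₁ := by grind
      have n₁ : ∀ u, ¬ H₁ v u := fun u hu => hv₁ (h₁.adj hu).2.1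
      have n₁' : ∀ u, ¬ H₁ u v := fun u hu => hv₁ (h₁.adj hu).2.2.1
      exact .parallel h₁ (ih₂ hva hvb hxy (by grind)) (by grind) (by grind) (by grind)

end SPG

/-- The adjacency of a list of edges. -/
def adjOf (E : List Scope) (u v : ℕ) : Prop := (u, v) ∈ E ∨ (v, u) ∈ E

/-- The edges at the vertex of `o` stay within the vertex and the two neighbours given in `o`. -/
def Legal (E : List Scope) (o : Elim) : Prop :=
  o.1 ≠ o.2.1 ∧ o.1 ≠ o.2.2 ∧ ∀ e ∈ E, touches o.1 e = true →
    (e.1 = o.1 ∨ e.1 = o.2.1 ∨ e.1 = o.2.2) ∧ (e.2 = o.1 ∨ e.2 = o.2.1 ∨ e.2 = o.2.2)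

/-- The eliminations in a list are legal one after the other. -/
def LegalOrder : List Scope → List Elim → Prop
  | _, [] => True
  | E, o :: l => Legal E o ∧ LegalOrder (shrink E o) l

theorem LegalOrder.append {E : List Scope} {l l' : List Elim} (h : LegalOrder E l)
    (h' : LegalOrder (l.foldl shrink E) l') : LegalOrder E (l ++ l') := by
  induction l generalizing E with
  | nil => exact h'
  | cons o l ih => exact ⟨h.1, ih h.2 h'⟩

theorem touches_iff {v : ℕ} {e : Scope} : touches v e = true ↔ e.1 = v ∨ e.2 = v := by
  simp [touches]

theorem removable_iff {a b : ℕ} {E : List Scope} {v x y : ℕ} :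
    removable a b E (v, x, y) = true ↔ v ≠ a ∧ v ≠ b ∧ v ≠ x ∧ v ≠ y ∧ x ≠ y ∧
      ∀ u, adjOf E v u ↔ u = x ∨ u = y := by
  simp only [removable, Bool.and_eq_true, beq_iff_eq, List.any_eq_true,
    List.all_eq_true, Bool.or_eq_true, Bool.not_eq_eq_eq_not, touches_iff, Bool.not_true,
    ← Bool.not_eq_true, adjOf, Prod.exists, Prod.forall]
  constructor
  · rintro ⟨⟨⟨⟨⟨⟨⟨h1, h2⟩, h3⟩, h4⟩, h5⟩, ⟨p, q, hp, h6⟩⟩, ⟨p', q', hp', h7⟩⟩, h8⟩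
    refine ⟨h1, h2, h3, h4, h5, fun u => ⟨?_, ?_⟩⟩
    · rintro (h | h)
      · have := h8 _ _ h; grind
      · have := h8 _ _ h; grind
    · rintro (rfl | rfl) <;> grind
  · rintro ⟨h1, h2, h3, h4, h5, h⟩
    refine ⟨⟨⟨⟨⟨⟨⟨h1, h2⟩, h3⟩, h4⟩, h5⟩, ?_⟩, ?_⟩, ?_⟩
    · rcases (h x).2 (.inl rfl) with h | h
      · exact ⟨_, _, h, by simp⟩
      · exact ⟨_, _, h, by simp⟩
    · rcases (h y).2 (.inr rfl) with h | h
      · exact ⟨_, _, h, by simp⟩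
      · exact ⟨_, _, h, by simp⟩
    · intro p q hpq
      by_cases hv : p = v ∨ q = v
      · right
        rcases hv with rfl | rfl
        · have := (h q).1 (.inl hpq); grind
        · have := (h p).1 (.inr hpq); grind
      · exact .inl hv

theorem removable_legal {a b : ℕ} {E : List Scope} {o : Elim} (h : removable a b E o = true) :
    Legal E o := by
  obtain ⟨v, x, y⟩ := o
  obtain ⟨-, -, h3, h4, -, h⟩ := removable_iff.1 h
  refine ⟨h3, h4, fun ⟨p, q⟩ he ht => ?_⟩
  rcases touches_iff.1 ht with rfl | rfl
  · have := (h q).1 (.inl he); grind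
  · have := (h p).1 (.inr he); grind

theorem adjOf_shrink {E : List Scope} {v x y : ℕ} (u w : ℕ) :
    adjOf (shrink E (v, x, y)) u w ↔
      (adjOf E u w ∧ u ≠ v ∧ w ≠ v) ∨ u = x ∧ w = y ∨ u = y ∧ w = x := by
  simp only [adjOf, shrink, List.mem_cons, List.mem_filter, Bool.not_eq_true', ← Bool.not_eq_true,
    touches_iff, Prod.mk.injEq]
  grind

/-- Either a removable candidate is eliminated, or there is none. -/
theorem greedyStep_cases (a b : ℕ) (cands : List Elim) (st : List Scope × List Elim) :
    (greedyStep a b cands st = st ∧ ∀ o ∈ cands, removable a b st.1 o = false) ∨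
      ∃ o ∈ cands, removable a b st.1 o = true ∧
        greedyStep a b cands st = (shrink st.1 o, st.2 ++ [o]) := by
  unfold greedyStep
  cases h : cands.filter (removable a b st.1) with
  | nil => left; simpa using h
  | cons o l =>
    right
    have : o ∈ cands.filter (removable a b st.1) := by rw [h]; simp
    rw [List.mem_filter] at this
    exact ⟨o, this.1, this.2, rfl⟩

theorem foldl_greedyStep_legal (a b : ℕ) (cands : List Elim) (E₀ : List Scope) (l : List ℕ)
    (st : List Scope × List Elim) (h : LegalOrder E₀ st.2 ∧ st.2.foldl shrink E₀ = st.1) :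
    LegalOrder E₀ (l.foldl (fun st _ => greedyStep a b cands st) st).2 ∧
      (l.foldl (fun st _ => greedyStep a b cands st) st).2.foldl shrink E₀ =
        (l.foldl (fun st _ => greedyStep a b cands st) st).1 := by
  induction l generalizing st with
  | nil => exact h
  | cons i l ih =>
    refine ih _ ?_
    dsimp only
    rcases greedyStep_cases a b cands st with ⟨e, -⟩ | ⟨o, -, ho, e⟩
    · rw [e]; exact h
    · rw [e]
      refine ⟨h.1.append ?_, by simp [h.2]⟩
      rw [h.2]
      exact ⟨removable_legal ho, trivial⟩

theorem foldl_greedyStep_SPG {a b : ℕ} {cands : List Elim} {V : Finset ℕ}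
    (hV : ∀ v ∈ V, ∀ x ∈ V, ∀ y ∈ V, (v, x, y) ∈ cands) (l : List ℕ)
    (st : List Scope × List Elim) (S : Finset ℕ) (hS : S ⊆ V) (h : SPG (adjOf st.1) S a b) :
    ∃ S', SPG (adjOf (l.foldl (fun st _ => greedyStep a b cands st) st).1) S' a b ∧
      (S'.card ≤ 2 ∨ S'.card + l.length ≤ S.card) := by
  induction l generalizing st S with
  | nil => exact ⟨S, h, .inr le_rfl⟩
  | cons i l ih =>
    rcases greedyStep_cases a b cands st with ⟨e, hn⟩ | ⟨⟨v, x, y⟩, -, ho, e⟩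
    · have hcard : S.card ≤ 2 := by
        have hsub : S ⊆ {a, b} := by
          intro u hu
          by_contra hu'
          obtain ⟨v, x, y, h1, h2, h3, h4, h5, h6⟩ :=
            h.exists_removable ⟨u, hu, by grind, by grind⟩
          have m₁ := h.adj h4
          have m₂ := h.adj h5
          have := hn _ (hV v (hS m₁.2.1) x (hS m₁.2.2.1) y (hS m₂.2.2.1))
          rw [← Bool.not_eq_true, removable_iff] at this
          exact this ⟨h1, h2, m₁.2.2.2, m₂.2.2.2, h3, fun u => ⟨h6 u, by grind⟩⟩
        exact (Finset.card_le_card hsub).trans Finset.card_le_two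
      obtain ⟨S', h1, h2⟩ := ih st S hS h
      rw [List.foldl_cons, e]
      refine ⟨S', h1, .inl ?_⟩
      omega
    · obtain ⟨h1, h2, h3, h4, h5, h6⟩ := removable_iff.1 ho
      have hv : v ∈ S := (h.adj ((h6 x).2 (.inl rfl))).2.1
      have h' := (h.eliminate h1 h2 h5 h6).congr (adjOf_shrink (E := st.1)) fun _ => Iff.rfl
      obtain ⟨S', h7, h8⟩ := ih (shrink st.1 (v, x, y), st.2 ++ [(v, x, y)]) (S.erase v)
        ((Finset.erase_subset _ _).trans hS) h'
      rw [List.foldl_cons, e]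
      refine ⟨S', h7, h8.imp id fun h8 => ?_⟩
      have := Finset.card_pos.2 ⟨v, hv⟩
      rw [Finset.card_erase_of_mem hv] at h8
      rw [List.length_cons]; omega

theorem isTerminalGraph_iff {a b : ℕ} {E : List Scope} : isTerminalGraph a b E = true ↔
    ∀ e ∈ E, (e.1 = a ∨ e.1 = b) ∧ (e.2 = a ∨ e.2 = b) := by
  simp [isTerminalGraph]

theorem isTerminalGraph_greedy {n : ℕ} {E : List Scope} {S : Finset ℕ} {a b : ℕ}
    (h : SPG (adjOf E) S a b) (hS : S ⊆ Finset.range n) :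
    isTerminalGraph a b (greedy (List.range n) E a b).1 = true := by
  obtain ⟨S', h1, h2⟩ := foldl_greedyStep_SPG (cands := (List.range n).flatMap fun v =>
    (List.range n).flatMap fun x => (List.range n).map fun y => (v, x, y)) (V := Finset.range n)
    (by simp; tauto) (List.range n) (E, []) S hS h
  have h3 := Finset.card_le_card hS
  rw [Finset.card_range] at h3
  rw [List.length_range] at h2
  have h4 : ({a, b} : Finset ℕ) = S' := by
    refine Finset.eq_of_subset_of_card_le ?_ ?_
    · intro u hu; have := h1.mem; grind
    · rw [Finset.card_pair h1.ne]; omega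
  subst h4
  rw [isTerminalGraph_iff]
  intro e he
  have := h1.adj (u := e.1) (v := e.2) (.inl he)
  grind

/-- The computed order eliminates all vertices. -/
theorem elimOrder_legal {n : ℕ} {E : List Scope} {S : Finset ℕ} {a b : ℕ}
    (h : SPG (adjOf E) S a b) (hS : S ⊆ Finset.range n) :
    LegalOrder E (elimOrder n (List.range n) E) ∧
      (elimOrder n (List.range n) E).foldl shrink E = [(n, n)] := by
  set p := terminals (List.range n) E with hp
  have hmem : p ∈ ((List.range n).flatMap fun a => (List.range n).map fun b => (a, b)).filter
      fun p => !(p.1 == p.2) && isTerminalGraph p.1 p.2 (greedy (List.range n) E p.1 p.2).1 := by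
    have : (a, b) ∈ ((List.range n).flatMap fun a => (List.range n).map fun b => (a, b)).filter
        fun p => !(p.1 == p.2) && isTerminalGraph p.1 p.2 (greedy (List.range n) E p.1 p.2).1 := by
      have m := h.mem
      have m₁ := Finset.mem_range.1 (hS m.1)
      have m₂ := Finset.mem_range.1 (hS m.2)
      simp [m₁, m₂, h.ne, isTerminalGraph_greedy h hS]
    rw [hp, terminals]
    generalize List.filter _ _ = l at *
    cases l with
    | nil => cases this
    | cons c l => simp
  obtain ⟨p₁, p₂⟩ := p
  obtain ⟨h1, h2⟩ := List.mem_filter.1 hmem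
  have h3 : p₂ < n := by simp at h1; exact h1.2
  simp only [Bool.and_eq_true, Bool.not_eq_true', beq_eq_false_iff_ne] at h2
  obtain ⟨h4, h5⟩ := h2
  rw [isTerminalGraph_iff] at h5
  obtain ⟨h6, h7⟩ := foldl_greedyStep_legal p₁ p₂ ((List.range n).flatMap fun v =>
    (List.range n).flatMap fun x => (List.range n).map fun y => (v, x, y)) E (List.range n)
    (E, []) ⟨trivial, rfl⟩
  change LegalOrder E (greedy (List.range n) E p₁ p₂).2 at h6
  change (greedy (List.range n) E p₁ p₂).2.foldl shrink E = (greedy (List.range n) E p₁ p₂).1 at h7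
  unfold elimOrder
  rw [← hp]
  generalize greedy (List.range n) E p₁ p₂ = g at *
  have hfil : ((p₂, p₂) :: g.1.filter fun e => !touches p₁ e).filter
      (fun e => !touches p₂ e) = [] := by
    rw [List.filter_eq_nil_iff]
    intro e he
    simp only [List.mem_cons, List.mem_filter, Bool.not_eq_true', ← Bool.not_eq_true, touches_iff]
      at he ⊢
    rcases he with rfl | ⟨he, hne⟩
    · simp
    · have := h5 e he; grind
  refine ⟨h6.append ?_, ?_⟩
  · rw [h7]
    refine ⟨⟨h4, h4, fun e he _ => ?_⟩, ⟨h3.ne, h3.ne, fun e he _ => ?_⟩, trivial⟩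
    · have := h5 e he; grind
    · simp only [shrink, List.mem_cons, List.mem_filter, Bool.not_eq_true', ← Bool.not_eq_true,
        touches_iff] at he
      rcases he with rfl | ⟨he, hne⟩
      · simp
      · have := h5 e he; grind
  · rw [List.foldl_append, h7]
    simp only [List.foldl_cons, List.foldl_nil, shrink, hfil]

end SPFlow

/-! ### Correctness of the dynamic program -/

namespace SPFlow

open scoped Pointwise

/-- Cost, mask and cut function of a choice of edges. -/
abbrev Choice := ℕ × ℕ × ((ℕ → Bool) → ℕ)

/-- The choices that a factor represents. -/
def semFactor (f : Factor) : Set Choice :=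
  {w | ∃ e ∈ f.2, w = (e.2.1, e.2.2, fun z => look e.1 (z f.1.1) (z f.1.2))}

/-- The choices that a list of factors represents: one from each factor, added up. -/
def sem (FS : List Factor) : Set Choice := (FS.map semFactor).sum

theorem sem_cons (f : Factor) (FS : List Factor) : sem (f :: FS) = semFactor f + sem FS := by
  simp [sem]

theorem sem_nil : sem [] = {0} := by simp [sem, Set.singleton_zero]

theorem sem_filter (p : Factor → Bool) (FS : List Factor) :
    sem FS = sem (FS.filter p) + sem (FS.filter fun f => !p f) := by
  rw [sem, sem, sem, ← List.sum_append, ← List.map_append]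
  exact ((List.filter_append_perm p FS).map _).sum_eq.symm

/-- `r` is a lower bound for the cut function `φ` over all `s`-`t`-cuts. -/
def CutBound (cfg : Config) (φ : (ℕ → Bool) → ℕ) (r : ℕ) : Prop :=
  ∀ z : ℕ → Bool, z cfg.1 = true → z cfg.2.1 = false → r ≤ φ z

/-- The value of a three-bit entry. -/
def look₂ (v x y : ℕ) (e : Entry₂) (z : ℕ → Bool) : ℕ :=
  look (bif z v then e.1.2 else e.1.1) (z x) (z y)

/-- The scope lies within the three vertices of an elimination. -/
def Within (v x y : ℕ) (sc : Scope) : Prop :=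
  (sc.1 = v ∨ sc.1 = x ∨ sc.1 = y) ∧ (sc.2 = v ∨ sc.2 = x ∨ sc.2 = y)

theorem look_tabulate (f : Bool → Bool → ℕ) (α β : Bool) : look (tabulate f) α β = f α β := by
  cases α <;> cases β <;> rfl

theorem bitOf_eq {v x y u : ℕ} (h : u = v ∨ u = x ∨ u = y) (z : ℕ → Bool) :
    bitOf v x u (z v) (z x) (z y) = z u := by
  unfold bitOf
  by_cases h1 : u = v
  · simp [h1]
  · rw [beq_false_of_ne h1, cond_false]
    by_cases h2 : u = x
    · simp [h2]
    · rw [beq_false_of_ne h2, cond_false]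
      obtain rfl : u = y := by tauto
      rfl

theorem look₂_join {L v x y : ℕ} {sc : Scope} (h : Within v x y sc) (e : Entry₂) (e' : Entry)
    (z : ℕ → Bool) :
    look₂ v x y (join L v x sc e e') z = min (look₂ v x y e z + look e'.1 (z sc.1) (z sc.2)) L := by
  have h1 := bitOf_eq h.1 z
  have h2 := bitOf_eq h.2 z
  unfold look₂ join joinProfile
  cases hz : z v <;> rw [hz] at h1 h2 <;> simp only [cond_true, cond_false, look_tabulate, h1, h2]

/-- Pruning keeps for every entry one with the same profile that is not more expensive. -/
theorem exists_mem_foldl_insertEntry (l T : List Entry₂) (e : Entry₂) (h : e ∈ T ∨ e ∈ l) :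
    ∃ e' ∈ l.foldl insertEntry T, e'.1 = e.1 ∧ e'.2.1 ≤ e.2.1 := by
  have step : ∀ (T : List Entry₂) (a e : Entry₂), e ∈ T ∨ e = a →
      ∃ e' ∈ insertEntry T a, e'.1 = e.1 ∧ e'.2.1 ≤ e.2.1 := by
    intro T a e h
    unfold insertEntry
    cases hb : T.any fun e' => sameProfile a e' && decide (e'.2.1 ≤ a.2.1) with
    | true =>
      rcases h with h | rfl
      · exact ⟨e, h, rfl, le_rfl⟩
      · obtain ⟨e', he', h'⟩ := List.any_eq_true.1 hb
        rw [Bool.and_eq_true, sameProfile_iff, decide_eq_true_iff] at h'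
        exact ⟨e', he', h'.1.symm, h'.2⟩
    | false =>
      rcases h with h | rfl
      · by_cases hs : sameProfile a e = true
        · refine ⟨a, by simp, sameProfile_iff.1 hs, ?_⟩
          have := (List.any_eq_false.1 hb) e h
          rw [hs, Bool.true_and, decide_eq_true_iff] at this
          omega
        · exact ⟨e, List.mem_cons_of_mem _ (List.mem_filter.2 ⟨h, by simpa using hs⟩), rfl, le_rfl⟩
      · exact ⟨e, by simp, rfl, le_rfl⟩
  induction l generalizing T e with
  | nil => exact ⟨e, h.resolve_right (by simp), rfl, le_rfl⟩
  | cons a l ih =>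
    have h' : (e ∈ T ∨ e = a) ∨ e ∈ l := by
      rcases h with h | h
      · exact .inl (.inl h)
      · rcases List.mem_cons.1 h with h | h
        · exact .inl (.inr h)
        · exact .inr h
    rcases h' with h' | h'
    · obtain ⟨e₁, he₁, h1, h2⟩ := step T a e h'
      obtain ⟨e₂, he₂, h3, h4⟩ := ih (insertEntry T a) e₁ (.inl he₁)
      exact ⟨e₂, he₂, h3.trans h1, h4.trans h2⟩
    · exact ih _ e (.inr h')

theorem mem_product {L v x : ℕ} {T : List Entry₂} {f : Factor} {e : Entry₂}
    (h : e ∈ product L v x T f) : ∃ e₁ ∈ T, ∃ e₂ ∈ f.2, e = join L v x f.1 e₁ e₂ := by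
  have := mem_of_mem_prune h
  simp only [List.mem_flatMap, List.mem_map] at this
  obtain ⟨e₁, h1, e₂, h2, h3⟩ := this
  exact ⟨e₁, h1, e₂, h2, h3.symm⟩

theorem exists_mem_product (L v x : ℕ) {T : List Entry₂} {f : Factor} {e₁ : Entry₂} {e₂ : Entry}
    (h₁ : e₁ ∈ T) (h₂ : e₂ ∈ f.2) : ∃ e ∈ product L v x T f,
      e.1 = (join L v x f.1 e₁ e₂).1 ∧ e.2.1 ≤ e₁.2.1 + e₂.2.1 :=
  exists_mem_foldl_insertEntry _ _ (join L v x f.1 e₁ e₂) (.inr (by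
    simp only [List.mem_flatMap, List.mem_map]; exact ⟨e₁, h₁, e₂, h₂, rfl⟩))

/-- Every entry of a product comes from an entry of `T` and a choice from the factors. -/
theorem foldl_product_sound {L v x y : ℕ} (FS : List Factor) (hw : ∀ f ∈ FS, Within v x y f.1)
    (T : List Entry₂) {e : Entry₂} (he : e ∈ FS.foldl (product L v x) T) :
    ∃ e₀ ∈ T, ∃ w ∈ sem FS, e.2.1 = e₀.2.1 + w.1 ∧ e.2.2 = e₀.2.2 + w.2.1 ∧
      ∀ z, look₂ v x y e z ≤ look₂ v x y e₀ z + w.2.2 z := by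
  induction FS generalizing T with
  | nil => exact ⟨e, he, 0, by simp [sem_nil], by simp, by simp, by simp⟩
  | cons f FS ih =>
    obtain ⟨e₁, he₁, w, hw', h1, h2, h3⟩ := ih (fun f hf => hw f (by simp [hf])) _ he
    obtain ⟨a, ha, b, hb, rfl⟩ := mem_product he₁
    refine ⟨a, ha, (b.2.1, b.2.2, fun z => look b.1 (z f.1.1) (z f.1.2)) + w, ?_, ?_, ?_,
      fun z => ?_⟩
    · rw [sem_cons]; exact Set.add_mem_add ⟨b, hb, rfl⟩ hw'
    · rw [h1]; simp [join, add_assoc]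
    · rw [h2]; simp [join, add_assoc]
    · have h4 := h3 z
      rw [look₂_join (hw f (by simp))] at h4
      have : (((b.2.1, b.2.2, fun z => look b.1 (z f.1.1) (z f.1.2)) + w : Choice)).2.2 z =
        look b.1 (z f.1.1) (z f.1.2) + w.2.2 z := rfl
      rw [this]; omega

/-- Every choice from the factors is matched in the product, up to the cap. -/
theorem foldl_product_complete {L v x y : ℕ} (FS : List Factor)
    (hw : ∀ f ∈ FS, Within v x y f.1) (T : List Entry₂) {e₀ : Entry₂} (he₀ : e₀ ∈ T) {w : Choice}
    (h : w ∈ sem FS) : ∃ e ∈ FS.foldl (product L v x) T, e.2.1 ≤ e₀.2.1 + w.1 ∧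
      ∀ z, min (look₂ v x y e₀ z + w.2.2 z) L ≤ look₂ v x y e z := by
  induction FS generalizing T e₀ w with
  | nil =>
    rw [sem_nil] at h
    obtain rfl : w = 0 := h
    exact ⟨e₀, he₀, by simp, by simp⟩
  | cons f FS ih =>
    rw [sem_cons] at h
    obtain ⟨_, ⟨b, hb, rfl⟩, w', hw', rfl⟩ := Set.mem_add.1 h
    obtain ⟨e₁, he₁, h1, h2⟩ := exists_mem_product L v x he₀ hb
    obtain ⟨e, he, h3, h4⟩ := ih (fun f hf => hw f (by simp [hf])) _ he₁ hw'
    refine ⟨e, he, ?_, fun z => ?_⟩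
    · have : (((b.2.1, b.2.2, fun z => look b.1 (z f.1.1) (z f.1.2)) + w' : Choice)).1 =
        b.2.1 + w'.1 := rfl
      rw [this]; omega
    · have h5 := h4 z
      have h6 : look₂ v x y e₁ z = look₂ v x y (join L v x f.1 e₀ b) z := by
        unfold look₂; rw [h1]
      rw [h6, look₂_join (hw f (by simp))] at h5
      have : (((b.2.1, b.2.2, fun z => look b.1 (z f.1.1) (z f.1.2)) + w' : Choice)).2.2 z =
        look b.1 (z f.1.1) (z f.1.2) + w'.2.2 z := rfl
      rw [this]; omega

theorem look_project (e : Entry₂) (α β : Bool) :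
    look (project e).1 α β = min (look e.1.1 α β) (look e.1.2 α β) := look_tabulate _ _ _

/-- Cuts in factors that do not touch `v` do not depend on the side of `v`. -/
theorem sem_update {v : ℕ} {FS : List Factor} (h : ∀ f ∈ FS, touches v f.1 = false) {w : Choice}
    (hw : w ∈ sem FS) (z : ℕ → Bool) (γ : Bool) : w.2.2 (Function.update z v γ) = w.2.2 z := by
  induction FS generalizing w with
  | nil =>
    rw [sem_nil] at hw
    obtain rfl : w = 0 := hw
    rfl
  | cons f FS ih =>
    rw [sem_cons] at hw
    obtain ⟨_, ⟨b, hb, rfl⟩, w', hw', rfl⟩ := Set.mem_add.1 hw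
    have h1 := ih (fun f hf => h f (by simp [hf])) hw'
    have h2 := h f (by simp)
    rw [← Bool.not_eq_true, touches_iff, not_or] at h2
    change look b.1 _ _ + w'.2.2 _ = look b.1 _ _ + w'.2.2 z
    rw [h1, Function.update_of_ne h2.1, Function.update_of_ne h2.2]

theorem legal_within {FS : List Factor} {o : Elim} (ho : Legal (FS.map Prod.fst) o) :
    ∀ f ∈ FS.filter fun f => touches o.1 f.1, Within o.1 o.2.1 o.2.2 f.1 := fun f hf => by
  obtain ⟨h1, h2⟩ := List.mem_filter.1 hf
  exact ho.2.2 f.1 (List.mem_map_of_mem h1) h2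

theorem look_penalty_eq_zero (cfg : Config) (v : ℕ) {γ : Bool} (α β : Bool)
    (h1 : γ = true → v ≠ cfg.2.1) (h2 : γ = false → v ≠ cfg.1) :
    look (penalty cfg v γ) α β = 0 := by
  cases γ
  · have : (v == cfg.1) = false := by simpa using h2 rfl
    cases α <;> cases β <;> simp [penalty, look, this]
  · have : (v == cfg.2.1) = false := by simpa using h1 rfl
    cases α <;> cases β <;> simp [penalty, look, this]

theorem look_penalty_eq_cap (cfg : Config) (v : ℕ) {γ : Bool} (α β : Bool)
    (h : (γ = true ∧ v = cfg.2.1) ∨ (γ = false ∧ v = cfg.1)) :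
    look (penalty cfg v γ) α β = capOf cfg := by
  rcases h with ⟨rfl, rfl⟩ | ⟨rfl, rfl⟩ <;> cases α <;> cases β <;> simp [penalty, look]

/-- Every choice after an elimination comes from a choice before it that has at least the same
cuts. -/
theorem eliminate_sound {cfg : Config} {FS : List Factor} {o : Elim}
    (ho : Legal (FS.map Prod.fst) o) {w : Choice} (hw : w ∈ sem (eliminate cfg FS o)) :
    ∃ w' ∈ sem FS, w'.1 = w.1 ∧ w'.2.1 = w.2.1 ∧
      ∀ r, CutBound cfg w.2.2 r → CutBound cfg w'.2.2 r := by
  rw [eliminate, sem_cons] at hw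
  obtain ⟨_, ⟨b, hb, rfl⟩, w₂, hw₂, rfl⟩ := Set.mem_add.1 hw
  obtain ⟨e, he, rfl⟩ := List.mem_map.1 hb
  obtain ⟨e₀, he₀, w₁, hw₁, h1, h2, h3⟩ := foldl_product_sound _ (legal_within ho) _ he
  obtain rfl := List.mem_singleton.1 he₀
  refine ⟨w₁ + w₂, (sem_filter (fun f => touches o.1 f.1) FS) ▸ Set.add_mem_add hw₁ hw₂, ?_, ?_,
    fun r hr z hs ht => (hr z hs ht).trans ?_⟩
  · change w₁.1 + w₂.1 = e.2.1 + w₂.1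
    rw [h1]; simp
  · change w₁.2.1 + w₂.2.1 = e.2.2 + w₂.2.1
    rw [h2]; simp
  · change look (project e).1 (z o.2.1) (z o.2.2) + w₂.2.2 z ≤ w₁.2.2 z + w₂.2.2 z
    have h4 := h3 z
    have h5 : look₂ o.1 o.2.1 o.2.2 ((penalty cfg o.1 false, penalty cfg o.1 true), 0, 0) z = 0 := by
      have := look_penalty_eq_zero cfg o.1 (γ := z o.1) (z o.2.1) (z o.2.2)
        (fun h => by rintro e; rw [e] at h; simp [h] at ht)
        (fun h => by rintro e; rw [e] at h; simp [h] at hs)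
      unfold look₂
      cases hz : z o.1 <;> rw [hz] at this <;> exact this
    have h6 : look (project e).1 (z o.2.1) (z o.2.2) ≤ look₂ o.1 o.2.1 o.2.2 e z := by
      rw [look_project]; unfold look₂
      cases z o.1
      · exact min_le_left _ _
      · exact min_le_right _ _
    omega

/-- Every choice before an elimination is matched by a choice after it that is not more expensive
and has at least the same cuts, up to the cap. -/
theorem eliminate_complete {cfg : Config} {FS : List Factor} {o : Elim}
    (ho : Legal (FS.map Prod.fst) o) {w : Choice} (hw : w ∈ sem FS) :
    ∃ w' ∈ sem (eliminate cfg FS o), w'.1 ≤ w.1 ∧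
      ∀ r ≤ capOf cfg, CutBound cfg w.2.2 r → CutBound cfg w'.2.2 r := by
  rw [sem_filter (fun f => touches o.1 f.1) FS] at hw
  obtain ⟨w₁, hw₁, w₂, hw₂, rfl⟩ := Set.mem_add.1 hw
  obtain ⟨e, he, h1, h2⟩ := foldl_product_complete (L := capOf cfg) _ (legal_within ho)
    [((penalty cfg o.1 false, penalty cfg o.1 true), 0, 0)] (List.mem_singleton.2 rfl) hw₁
  refine ⟨((project e).2.1, (project e).2.2,
    fun z => look (project e).1 (z o.2.1) (z o.2.2)) + w₂, ?_, ?_, fun r hL hr z hs ht => ?_⟩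
  · rw [eliminate, sem_cons]
    exact Set.add_mem_add ⟨project e, List.mem_map_of_mem he, rfl⟩ hw₂
  · change e.2.1 + w₂.1 ≤ w₁.1 + w₂.1
    simp only [zero_add] at h1
    omega
  · change r ≤ look (project e).1 (z o.2.1) (z o.2.2) + w₂.2.2 z
    have key : ∀ γ, r ≤ look (bif γ then e.1.2 else e.1.1) (z o.2.1) (z o.2.2) + w₂.2.2 z := by
      intro γ
      have h3 := h2 (Function.update z o.1 γ)
      have h4 := sem_update (v := o.1) (fun f hf => by
        simpa using (List.mem_filter.1 hf).2) hw₂ z γ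
      have hx : Function.update z o.1 γ o.2.1 = z o.2.1 := Function.update_of_ne ho.1.symm _ _
      have hy : Function.update z o.1 γ o.2.2 = z o.2.2 := Function.update_of_ne ho.2.1.symm _ _
      have hv : Function.update z o.1 γ o.1 = γ := Function.update_self _ _ _
      simp only [look₂, hx, hy, hv] at h3
      by_cases hc : (γ = true ∧ o.1 = cfg.2.1) ∨ (γ = false ∧ o.1 = cfg.1)
      · have h5 := look_penalty_eq_cap cfg o.1 (z o.2.1) (z o.2.2) hc
        have h6 : look (bif γ then penalty cfg o.1 true else penalty cfg o.1 false) (z o.2.1)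
            (z o.2.2) = capOf cfg := by cases γ <;> exact h5
        rw [h6] at h3
        omega
      · have h7 := hr (Function.update z o.1 γ) (by
          by_cases h : cfg.1 = o.1
          · rw [h, hv]
            cases γ
            · exact absurd (.inr ⟨rfl, h.symm⟩) hc
            · rfl
          · rw [Function.update_of_ne h]; exact hs) (by
          by_cases h : cfg.2.1 = o.1
          · rw [h, hv]
            cases γ
            · rfl
            · exact absurd (.inl ⟨rfl, h.symm⟩) hc
          · rw [Function.update_of_ne h]; exact ht)
        change r ≤ w₁.2.2 _ + w₂.2.2 _ at h7
        rw [h4] at h7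
        omega
    rw [look_project]
    have k1 := key false
    have k2 := key true
    simp only [cond_true, cond_false] at k1 k2
    omega

theorem map_fst_eliminate (cfg : Config) (FS : List Factor) (o : Elim) :
    (eliminate cfg FS o).map Prod.fst = shrink (FS.map Prod.fst) o := by
  simp [eliminate, shrink, List.filter_map, Function.comp_def]

theorem map_fst_foldl_eliminate (cfg : Config) (FS : List Factor) (l : List Elim) :
    (l.foldl (eliminate cfg) FS).map Prod.fst = l.foldl shrink (FS.map Prod.fst) := by
  induction l generalizing FS with
  | nil => rfl
  | cons o l ih => rw [List.foldl_cons, ih, map_fst_eliminate]; rfl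

theorem foldl_eliminate_sound {cfg : Config} {l : List Elim} {FS : List Factor}
    (hl : LegalOrder (FS.map Prod.fst) l) {w : Choice} (hw : w ∈ sem (l.foldl (eliminate cfg) FS)) :
    ∃ w' ∈ sem FS, w'.1 = w.1 ∧ w'.2.1 = w.2.1 ∧
      ∀ r, CutBound cfg w.2.2 r → CutBound cfg w'.2.2 r := by
  induction l generalizing FS with
  | nil => exact ⟨w, hw, rfl, rfl, fun _ => id⟩
  | cons o l ih =>
    obtain ⟨w₁, h1, h2, h3, h4⟩ := ih (FS := eliminate cfg FS o)
      (by rw [map_fst_eliminate]; exact hl.2) hw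
    obtain ⟨w₂, h5, h6, h7, h8⟩ := eliminate_sound hl.1 h1
    exact ⟨w₂, h5, h6.trans h2, h7.trans h3, fun r hr => h8 r (h4 r hr)⟩

theorem foldl_eliminate_complete {cfg : Config} {l : List Elim} {FS : List Factor}
    (hl : LegalOrder (FS.map Prod.fst) l) {w : Choice} (hw : w ∈ sem FS) :
    ∃ w' ∈ sem (l.foldl (eliminate cfg) FS), w'.1 ≤ w.1 ∧
      ∀ r ≤ capOf cfg, CutBound cfg w.2.2 r → CutBound cfg w'.2.2 r := by
  induction l generalizing FS w with
  | nil => exact ⟨w, hw, le_rfl, fun _ _ => id⟩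
  | cons o l ih =>
    obtain ⟨w₁, h1, h2, h3⟩ := eliminate_complete (cfg := cfg) hl.1 hw
    obtain ⟨w₂, h4, h5, h6⟩ := ih (FS := eliminate cfg FS o)
      (by rw [map_fst_eliminate]; exact hl.2) h1
    exact ⟨w₂, h4, h5.trans h2, fun r hL hr => h6 r hL (h3 r hL hr)⟩

/-- The rounded capacity of the cut `z` in a list of edges. -/
def cutVal (cfg : Config) (V : ℕ) (l : List Edge) (z : ℕ → Bool) : ℕ :=
  (l.map fun e => if z e.1.2.1 = z e.1.2.2 then 0 else roundCap cfg V e.2.2).sum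

/-- The choice that buys the edges of a list. -/
def choiceOf (cfg : Config) (V : ℕ) (l : List Edge) : Choice :=
  ((l.map fun e => e.2.1).sum, (l.map fun e => e.1.1).sum, cutVal cfg V l)

theorem choiceOf_cons (cfg : Config) (V : ℕ) (e : Edge) (l : List Edge) :
    choiceOf cfg V (e :: l) = (e.2.1, e.1.1, fun z => look (0, roundCap cfg V e.2.2,
      roundCap cfg V e.2.2, 0) (z e.1.2.1) (z e.1.2.2)) + choiceOf cfg V l := by
  refine Prod.ext (by simp [choiceOf]) (Prod.ext (by simp [choiceOf]) ?_)
  funext z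
  simp only [choiceOf, cutVal, List.map_cons, List.sum_cons, Prod.snd_add, Pi.add_apply, look]
  cases z e.1.2.1 <;> cases z e.1.2.2 <;> rfl

theorem mem_sem_edges (cfg : Config) (V : ℕ) (l : List Edge) (w : Choice) :
    w ∈ sem (l.map (edgeFactor cfg V)) ↔ ∃ l', l'.Sublist l ∧ w = choiceOf cfg V l' := by
  induction l generalizing w with
  | nil =>
    rw [List.map_nil, sem_nil]
    constructor
    · rintro rfl
      exact ⟨[], List.Sublist.slnil, rfl⟩
    · rintro ⟨l', h, rfl⟩
      rw [List.sublist_nil.1 h]; rfl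
  | cons e l ih =>
    rw [List.map_cons, sem_cons, Set.mem_add]
    have h0 : ∀ w : Choice, ((0, 0, fun z => look (0, 0, 0, 0) (z e.1.2.1) (z e.1.2.2)) : Choice) + w
        = w := fun w => by
      have : (fun z : ℕ → Bool => look (0, 0, 0, 0) (z e.1.2.1) (z e.1.2.2)) = 0 := by
        funext z; unfold look; cases z e.1.2.1 <;> cases z e.1.2.2 <;> rfl
      rw [this]; exact zero_add w
    constructor
    · rintro ⟨_, ⟨b, hb, rfl⟩, w₂, hw₂, rfl⟩
      obtain ⟨l', h, rfl⟩ := (ih _).1 hw₂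
      simp only [edgeFactor, List.mem_cons, List.not_mem_nil, or_false] at hb
      rcases hb with rfl | rfl
      · exact ⟨l', h.cons _, h0 _⟩
      · exact ⟨e :: l', h.cons_cons _, (choiceOf_cons ..).symm⟩
    · rintro ⟨l', h, rfl⟩
      cases h with
      | cons _ h =>
        exact ⟨_, ⟨((0, 0, 0, 0), 0, 0), by simp [edgeFactor], rfl⟩, _, (ih _).2 ⟨_, h, rfl⟩, h0 _⟩
      | cons_cons _ h =>
        exact ⟨_, ⟨((0, roundCap cfg V e.2.2, roundCap cfg V e.2.2, 0), e.2.1, e.1.1),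
          by simp [edgeFactor], rfl⟩, _, (ih _).2 ⟨_, h, rfl⟩, (choiceOf_cons ..).symm⟩

theorem best_spec (B : ℕ) (T : List Entry) :
    (best B T = (0, 0) ∨ ∃ e ∈ T, e.2.1 ≤ B ∧ best B T = (min e.1.1 e.1.2.2.2, e.2.2)) ∧
      ∀ e ∈ T, e.2.1 ≤ B → min e.1.1 e.1.2.2.2 ≤ (best B T).1 := by
  suffices h : ∀ (T : List Entry) (b : ℕ × ℕ),
      let b' := T.foldl (fun b e => bif decide (e.2.1 ≤ B) && decide (b.1 < min e.1.1 e.1.2.2.2)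
        then (min e.1.1 e.1.2.2.2, e.2.2) else b) b
      (b' = b ∨ ∃ e ∈ T, e.2.1 ≤ B ∧ b' = (min e.1.1 e.1.2.2.2, e.2.2)) ∧ b.1 ≤ b'.1 ∧
        ∀ e ∈ T, e.2.1 ≤ B → min e.1.1 e.1.2.2.2 ≤ b'.1 from
    ⟨(h T (0, 0)).1, (h T (0, 0)).2.2⟩
  intro T
  induction T with
  | nil => intro b; simp
  | cons e T ih =>
    intro b
    rw [List.foldl_cons]
    by_cases hc : e.2.1 ≤ B ∧ b.1 < min e.1.1 e.1.2.2.2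
    · have : (decide (e.2.1 ≤ B) && decide (b.1 < min e.1.1 e.1.2.2.2)) = true := by simp [hc]
      rw [this, cond_true]
      obtain ⟨h1, h2, h3⟩ := ih (min e.1.1 e.1.2.2.2, e.2.2)
      refine ⟨.inr ?_, (hc.2.trans_le h2).le, fun e' he' hB => ?_⟩
      · rcases h1 with h1 | ⟨e', he', h⟩
        · exact ⟨e, by simp, hc.1, h1⟩
        · exact ⟨e', by simp [he'], h⟩
      · rcases List.mem_cons.1 he' with rfl | he'
        · exact h2
        · exact h3 e' he' hB
    · have : (decide (e.2.1 ≤ B) && decide (b.1 < min e.1.1 e.1.2.2.2)) = false := by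
        rw [← Bool.not_eq_true]; simpa using hc
      rw [this, cond_false]
      obtain ⟨h1, h2, h3⟩ := ih b
      refine ⟨h1.imp_right ?_, h2, fun e' he' hB => ?_⟩
      · rintro ⟨e', he', h⟩
        exact ⟨e', by simp [he'], h⟩
      · rcases List.mem_cons.1 he' with rfl | he'
        · have : ¬ b.1 < min e'.1.1 e'.1.2.2.2 := fun h => hc ⟨hB, h⟩
          omega
        · exact h3 e' he' hB

/-- The elimination order of the data is legal and eliminates all vertices of the graph; `n` is a
vertex different from the source and the sink. -/
structure Valid (D : Data) (n : ℕ) : Prop where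
  legal : LegalOrder (D.2.1.map fun e => e.1.2) D.2.2.2
  final : D.2.2.2.foldl shrink (D.2.1.map fun e => e.1.2) = [(n, n)]
  source_ne_sink : D.1.1 ≠ D.1.2.1
  source_ne : n ≠ D.1.1
  sink_ne : n ≠ D.1.2.1

theorem cutBound_look {cfg : Config} {n : ℕ} (h : cfg.1 ≠ cfg.2.1) (h1 : n ≠ cfg.1)
    (h2 : n ≠ cfg.2.1) (p : Profile) (r : ℕ) :
    CutBound cfg (fun z => look p (z n) (z n)) r ↔ r ≤ min p.1 p.2.2.2 := by
  constructor
  · intro hr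
    have key : ∀ γ, r ≤ look p γ γ := fun γ => by
      have := hr (Function.update (fun u => u == cfg.1) n γ)
        (by rw [Function.update_of_ne h1.symm]; simp)
        (by rw [Function.update_of_ne h2.symm]; simpa using h.symm)
      simpa using this
    exact le_min (key false) (key true)
  · intro hr z _ _
    rw [le_min_iff] at hr
    change r ≤ look p (z n) (z n)
    cases z n
    · exact hr.1
    · exact hr.2

theorem Valid.exists_table {D : Data} {n : ℕ} (hD : Valid D n) (V : ℕ) :
    ∃ T, D.2.2.2.foldl (eliminate D.1) (D.2.1.map (edgeFactor D.1 V)) = [((n, n), T)] ∧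
      solve D V = best D.2.2.1 T ∧ sem [((n, n), T)] = semFactor ((n, n), T) := by
  have h := map_fst_foldl_eliminate D.1 (D.2.1.map (edgeFactor D.1 V)) D.2.2.2
  have e : (D.2.1.map (edgeFactor D.1 V)).map Prod.fst = D.2.1.map fun e => e.1.2 := by
    simp [edgeFactor, Function.comp_def]
  rw [e, hD.final] at h
  unfold solve
  generalize D.2.2.2.foldl (eliminate D.1) (D.2.1.map (edgeFactor D.1 V)) = FS at *
  obtain ⟨f, rfl, hf⟩ := List.map_eq_singleton_iff.1 h
  obtain ⟨sc, T⟩ := f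
  obtain rfl : sc = (n, n) := hf
  exact ⟨T, rfl, rfl, by simp [sem]⟩

theorem Valid.legal' {D : Data} {n : ℕ} (hD : Valid D n) (V : ℕ) :
    LegalOrder ((D.2.1.map (edgeFactor D.1 V)).map Prod.fst) D.2.2.2 := by
  have e : (D.2.1.map (edgeFactor D.1 V)).map Prod.fst = D.2.1.map fun e => e.1.2 := by
    simp [edgeFactor, Function.comp_def]
  rw [e]; exact hD.legal

/-- The mask computed at the scale `V` is that of an affordable set of edges all of whose cuts have
rounded capacity at least the computed value. -/
theorem solve_sound {D : Data} {n : ℕ} (hD : Valid D n) (V : ℕ) :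
    ∃ l, l.Sublist D.2.1 ∧ (solve D V).2 = (l.map fun e => e.1.1).sum ∧
      (l.map fun e => e.2.1).sum ≤ D.2.2.1 ∧ CutBound D.1 (cutVal D.1 V l) (solve D V).1 := by
  obtain ⟨T, h1, h2, h3⟩ := hD.exists_table V
  rw [h2]
  rcases (best_spec D.2.2.1 T).1 with h | ⟨e, he, hB, h⟩
  · rw [h]
    exact ⟨[], List.nil_sublist _, by simp, by simp, fun _ _ _ => Nat.zero_le _⟩
  · obtain ⟨w, hw, h4, h5, h6⟩ := foldl_eliminate_sound (cfg := D.1) (hD.legal' V)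
      (w := (e.2.1, e.2.2, fun z => look e.1 (z n) (z n)))
      (by rw [h1, h3]; exact ⟨e, he, rfl⟩)
    obtain ⟨l, hl, rfl⟩ := (mem_sem_edges ..).1 hw
    refine ⟨l, hl, ?_, ?_, ?_⟩
    · rw [h]; exact h5.symm
    · rw [show (l.map fun e => e.2.1).sum = e.2.1 from h4]; exact hB
    · rw [h]
      exact h6 _ ((cutBound_look hD.source_ne_sink hD.source_ne hD.sink_ne _ _).2 le_rfl)

/-- No affordable set of edges has larger cuts, up to the cap. -/
theorem solve_complete {D : Data} {n : ℕ} (hD : Valid D n) (V : ℕ) {l : List Edge}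
    (hl : l.Sublist D.2.1) (hB : (l.map fun e => e.2.1).sum ≤ D.2.2.1) {r : ℕ}
    (hr : r ≤ capOf D.1) (hc : CutBound D.1 (cutVal D.1 V l) r) : r ≤ (solve D V).1 := by
  obtain ⟨T, h1, h2, h3⟩ := hD.exists_table V
  obtain ⟨w, hw, h4, h5⟩ := foldl_eliminate_complete (cfg := D.1) (hD.legal' V)
    ((mem_sem_edges D.1 V D.2.1 (choiceOf D.1 V l)).2 ⟨l, hl, rfl⟩)
  rw [h1, h3] at hw
  obtain ⟨e, he, rfl⟩ := hw
  rw [h2]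
  refine ((cutBound_look hD.source_ne_sink hD.source_ne hD.sink_ne _ _).1 (h5 r hr hc)).trans
    ((best_spec D.2.2.1 T).2 e he (le_trans ?_ hB))
  exact h4

end SPFlow

/-! ### Maximum flows and minimum cuts -/

namespace BCMFP

variable (I : BCMFP)

/-- The capacity of the edges of `A` across the cut `z`. -/
def cutCap (A : Finset (Fin I.m)) (z : Fin I.n → Bool) : ℝ :=
  ∑ e ∈ A, if z (I.fst e) = z (I.snd e) then 0 else (I.cap e : ℝ)

/-- The net flow out of a vertex. -/
def netOut (f : Fin I.m → ℝ) (v : Fin I.n) : ℝ :=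
  ∑ e with I.fst e = v, f e - ∑ e with I.snd e = v, f e

theorem netOut_add (f g : Fin I.m → ℝ) (v : Fin I.n) :
    I.netOut (f + g) v = I.netOut f v + I.netOut g v := by
  simp only [netOut, Pi.add_apply, Finset.sum_add_distrib]; ring

theorem netOut_smul (c : ℝ) (f : Fin I.m → ℝ) (v : Fin I.n) :
    I.netOut (c • f) v = c * I.netOut f v := by
  simp only [netOut, Pi.smul_apply, smul_eq_mul, ← Finset.mul_sum]; ring

theorem netOut_single (e : Fin I.m) (v : Fin I.n) :
    I.netOut (Pi.single e 1) v = (if v = I.fst e then 1 else 0) - if v = I.snd e then 1 else 0 := by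
  simp only [netOut, Finset.sum_filter, Pi.single_apply]
  congr 1
  · rw [Finset.sum_eq_single e]
    · simp [eq_comm]
    · intro b _ hb; simp [hb]
    · simp
  · rw [Finset.sum_eq_single e]
    · simp [eq_comm]
    · intro b _ hb; simp [hb]
    · simp

theorem sum_mul_netOut (f : Fin I.m → ℝ) (c : Fin I.n → ℝ) :
    ∑ v, c v * I.netOut f v = ∑ e, f e * (c (I.fst e) - c (I.snd e)) := by
  simp only [netOut, mul_sub, Finset.sum_sub_distrib, Finset.sum_filter, Finset.mul_sum]
  rw [Finset.sum_comm, Finset.sum_comm (γ := Fin I.n)]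
  simp [mul_comm]

/-- The value of a flow is the net flow across any cut. -/
theorem flowValue_eq {A : Finset (Fin I.m)} {f : Fin I.m → ℝ} (hf : I.IsFlow A f)
    {z : Fin I.n → Bool} (hs : z I.s = true) (ht : z I.t = false) :
    I.flowValue f =
      ∑ e, f e * ((if z (I.fst e) then 1 else 0) - if z (I.snd e) then 1 else 0) := by
  rw [← I.sum_mul_netOut f fun v => if z v then 1 else 0, Finset.sum_eq_single I.s]
  · simp [hs, flowValue, netOut]
  · intro v _ hv
    by_cases hvt : v = I.t
    · subst hvt; simp [ht]
    · have := hf.2.2 v hv hvt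
      simp only [netOut, this, sub_self, mul_zero]
  · simp

theorem flowValue_le_cutCap {A : Finset (Fin I.m)} {f : Fin I.m → ℝ} (hf : I.IsFlow A f)
    {z : Fin I.n → Bool} (hs : z I.s = true) (ht : z I.t = false) :
    I.flowValue f ≤ I.cutCap A z := by
  rw [I.flowValue_eq hf hs ht, cutCap, ← Finset.sum_subset (Finset.subset_univ A)]
  · refine Finset.sum_le_sum fun e he => ?_
    have := abs_le.1 (hf.1 e he)
    cases z (I.fst e) <;> cases z (I.snd e) <;> simp <;> linarith
  · intro e _ he
    rw [hf.2.1 e he, zero_mul]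

theorem maxFlow_le_cutCap (A : Finset (Fin I.m)) {z : Fin I.n → Bool} (hs : z I.s = true)
    (ht : z I.t = false) : I.maxFlow A ≤ I.cutCap A z := by
  obtain ⟨f, hf, hv⟩ := (I.isGreatest_maxFlow A).1
  rw [← hv]
  exact I.flowValue_le_cutCap hf hs ht

/-- A direction in which the flow `f` can be changed a little. -/
def IsFeasibleDir (A : Finset (Fin I.m)) (f d : Fin I.m → ℝ) : Prop :=
  ∀ e, (f e = I.cap e → d e ≤ 0) ∧ (f e = -I.cap e → 0 ≤ d e) ∧ (e ∉ A → d e = 0)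

/-- A unit of flow can be sent from the source to `v` in a feasible direction. -/
def Reachable (A : Finset (Fin I.m)) (f : Fin I.m → ℝ) (v : Fin I.n) : Prop :=
  ∃ d, I.IsFeasibleDir A f d ∧
    ∀ w, I.netOut d w = (if w = I.s then 1 else 0) - if w = v then 1 else 0

theorem reachable_source (A : Finset (Fin I.m)) (f : Fin I.m → ℝ) : I.Reachable A f I.s :=
  ⟨0, fun e => by simp, fun w => by simp [netOut]⟩

theorem Reachable.forward {I : BCMFP} {A : Finset (Fin I.m)} {f : Fin I.m → ℝ} {e : Fin I.m}
    (he : e ∈ A) (h : I.Reachable A f (I.fst e)) (hc : f e < I.cap e) :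
    I.Reachable A f (I.snd e) := by
  obtain ⟨d, h1, h2⟩ := h
  refine ⟨d + Pi.single e 1, fun e' => ?_, fun w => by
    rw [netOut_add, netOut_single, h2]; ring⟩
  by_cases h' : e' = e
  · subst h'
    refine ⟨fun h => absurd h hc.ne, fun h => ?_, fun h => absurd he h⟩
    have := (h1 e').2.1 h
    simp only [Pi.add_apply, Pi.single_eq_same]; linarith
  · simpa [h'] using h1 e'

theorem Reachable.backward {I : BCMFP} {A : Finset (Fin I.m)} {f : Fin I.m → ℝ} {e : Fin I.m}
    (he : e ∈ A) (h : I.Reachable A f (I.snd e)) (hc : -I.cap e < f e) :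
    I.Reachable A f (I.fst e) := by
  obtain ⟨d, h1, h2⟩ := h
  refine ⟨d + (-1 : ℝ) • Pi.single e 1, fun e' => ?_, fun w => by
    rw [netOut_add, netOut_smul, netOut_single, h2]; ring⟩
  by_cases h' : e' = e
  · subst h'
    refine ⟨fun h => ?_, fun h => absurd h hc.ne', fun h => absurd he h⟩
    have := (h1 e').1 h
    simp only [Pi.add_apply, Pi.smul_apply, Pi.single_eq_same, smul_eq_mul]; linarith
  · simpa [h'] using h1 e'

open Filter Topology in
/-- A maximum flow cannot be augmented. -/
theorem not_reachable_sink {A : Finset (Fin I.m)} {f : Fin I.m → ℝ} (hf : I.IsFlow A f)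
    (hmax : I.flowValue f = I.maxFlow A) : ¬ I.Reachable A f I.t := by
  rintro ⟨d, h1, h2⟩
  have hcap : ∀ e, |f e| ≤ (I.cap e : ℝ) := fun e => by
    by_cases he : e ∈ A
    · exact hf.1 e he
    · rw [hf.2.1 e he, abs_zero]; positivity
  have hev : ∀ e, ∀ᶠ δ : ℝ in 𝓝[>] 0, |f e + δ * d e| ≤ I.cap e := by
    intro e
    have hcont : Tendsto (fun δ : ℝ => f e + δ * d e) (𝓝[>] 0) (𝓝 (f e)) := by
      have : Tendsto (fun δ : ℝ => f e + δ * d e) (𝓝 0) (𝓝 (f e + 0 * d e)) :=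
        (by fun_prop : Continuous fun δ : ℝ => f e + δ * d e).tendsto 0
      rw [zero_mul, add_zero] at this
      exact this.mono_left nhdsWithin_le_nhds
    have hpos : ∀ᶠ δ : ℝ in 𝓝[>] 0, 0 < δ := self_mem_nhdsWithin
    obtain ⟨hl, hu⟩ := abs_le.1 (hcap e)
    have hU : ∀ᶠ δ : ℝ in 𝓝[>] 0, f e + δ * d e ≤ I.cap e := by
      rcases hu.lt_or_eq with h | h
      · exact (hcont.eventually_lt_const h).mono fun _ => le_of_lt
      · filter_upwards [hpos] with δ hδ
        nlinarith [(h1 e).1 h]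
    have hL : ∀ᶠ δ : ℝ in 𝓝[>] 0, -(I.cap e : ℝ) ≤ f e + δ * d e := by
      rcases hl.lt_or_eq with h | h
      · exact (hcont.eventually_const_lt h).mono fun _ => le_of_lt
      · filter_upwards [hpos] with δ hδ
        nlinarith [(h1 e).2.1 h.symm]
    filter_upwards [hU, hL] with δ h3 h4 using abs_le.2 ⟨h4, h3⟩
  obtain ⟨δ, h3, h4⟩ := ((eventually_all.2 hev).and
    (self_mem_nhdsWithin : ∀ᶠ δ : ℝ in 𝓝[>] 0, 0 < δ)).exists
  have hflow : I.IsFlow A (f + δ • d) := by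
    refine ⟨fun e _ => h3 e, fun e he => by simp [hf.2.1 e he, (h1 e).2.2 he], fun v hs ht => ?_⟩
    have h5 : I.netOut f v = 0 := by rw [netOut, hf.2.2 v hs ht, sub_self]
    have h6 : I.netOut (f + δ • d) v = 0 := by
      rw [netOut_add, netOut_smul, h5, h2]; simp [hs, ht]
    exact (sub_eq_zero.1 h6).symm
  have hle := (I.isGreatest_maxFlow A).2 ⟨_, hflow, rfl⟩
  have hval : I.flowValue (f + δ • d) = I.flowValue f + δ := by
    change I.netOut _ _ = I.netOut _ _ + δ
    rw [netOut_add, netOut_smul, h2]; simp [I.s_ne_t]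
  rw [hval, hmax] at hle
  linarith

/-- The vertices reachable from the source in feasible directions of a maximum flow form a cut
whose capacity is the value of the flow. -/
theorem le_maxFlow {A : Finset (Fin I.m)} {r : ℝ} (h : ∀ z : Fin I.n → Bool, z I.s = true →
    z I.t = false → r ≤ I.cutCap A z) : r ≤ I.maxFlow A := by
  classical
  obtain ⟨f, hf, hv⟩ := (I.isGreatest_maxFlow A).1
  have ht := I.not_reachable_sink hf hv
  have hs' : decide (I.Reachable A f I.s) = true := decide_eq_true (I.reachable_source A f)
  have ht' : decide (I.Reachable A f I.t) = false := decide_eq_false ht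
  refine (h (fun v => decide (I.Reachable A f v)) hs' ht').trans ?_
  rw [← hv, I.flowValue_eq hf (z := fun v => decide (I.Reachable A f v)) hs' ht', cutCap,
    ← Finset.sum_subset (Finset.subset_univ A)]
  · refine Finset.sum_le_sum fun e he => ?_
    obtain ⟨hl, hu⟩ := abs_le.1 (hf.1 e he)
    by_cases h1 : I.Reachable A f (I.fst e) <;> by_cases h2 : I.Reachable A f (I.snd e)
    · simp [h1, h2]
    · have : ¬ f e < I.cap e := fun hc => h2 (h1.forward he hc)
      simp only [h1, h2]; simp; linarith
    · have : ¬ -(I.cap e : ℝ) < f e := fun hc => h1 (h2.backward he hc)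
      simp only [h1, h2]; simp; linarith
    · simp [h1, h2]
  · intro e _ he
    rw [hf.2.1 e he, zero_mul]

end BCMFP

/-! ### Reading the input word -/

theorem List.getD_flatten {α : Type*} {L : List (List α)} {c : ℕ} (h : ∀ l ∈ L, l.length = c)
    (i : ℕ) {k : ℕ} (hk : k < c) (d : α) :
    L.flatten.getD (c * i + k) d = (L.getD i []).getD k d := by
  induction L generalizing i with
  | nil => simp
  | cons l L ih =>
    have hl : l.length = c := h l (by simp)
    cases i with
    | zero => simp [List.getElem?_append_left (hl ▸ hk)]
    | succ i =>
      have h1 := ih (fun l hl => h l (by simp [hl])) i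
      have h2 : l.length ≤ c * (i + 1) + k := by rw [hl]; nlinarith
      have h3 : c * (i + 1) + k - l.length = c * i + k := by rw [hl, mul_add]; omega
      simpa [List.getElem?_append_right h2, h3] using h1

theorem List.Sublist.filter_mem {α : Type*} [DecidableEq α] {l l' : List α} (h : l'.Sublist l)
    (hl : l.Nodup) : l.filter (fun i => decide (i ∈ l')) = l' := by
  induction h with
  | slnil => rfl
  | @cons l₁ l₂ a h ih =>
    have h1 := List.nodup_cons.1 hl
    rw [List.filter_cons_of_neg (by simpa using fun h2 => h1.1 (h.subset h2)), ih h1.2]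
  | @cons_cons l₁ l₂ a h ih =>
    have h1 := List.nodup_cons.1 hl
    rw [List.filter_cons_of_pos (by simp)]
    conv_rhs => rw [← ih h1.2]
    congr 1
    refine List.filter_congr fun i hi => ?_
    have : i ≠ a := fun h => h1.1 (h ▸ hi)
    simp [this]

theorem List.foldl_mul_range (g : ℕ → ℕ) (a m : ℕ) :
    (List.range m).foldl (fun a i => a * g i) a = a * ∏ i ∈ Finset.range m, g i := by
  induction m with
  | zero => simp
  | succ m ih =>
    rw [List.range_succ, List.foldl_append, ih, Finset.prod_range_succ, List.foldl_cons,
      List.foldl_nil, mul_assoc]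

theorem List.foldl_double {α : Type*} (l : List α) (a : ℕ) :
    l.foldl (fun a _ => a + a) a = a * 2 ^ l.length := by
  induction l generalizing a with
  | nil => simp
  | cons x l ih => rw [List.foldl_cons, ih, List.length_cons, pow_succ]; ring

/-- Scaling a rational number by a multiple of its denominator, in natural numbers. -/
theorem NNRat.cast_mul_div_den (q : ℚ≥0) {D : ℕ} (h : q.den ∣ D) :
    ((D / q.den * q.num : ℕ) : ℝ) = D * (q : ℝ) := by
  obtain ⟨k, rfl⟩ := h
  rw [Nat.mul_div_cancel_left _ q.den_pos]
  have h1 : (q : ℝ) = q.num / q.den := by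
    conv_lhs => rw [← NNRat.num_div_den q]
    push_cast
    rfl
  have h2 : (q.den : ℝ) ≠ 0 := Nat.cast_ne_zero.2 q.den_ne_zero
  rw [h1]
  push_cast
  field_simp

namespace SPFlow

open RAM (Word)

theorem timesUnits_eq (x : ℕ) (S : List ℕ) : timesUnits x S = x * S.length := by
  have h : ∀ a, S.foldl (fun a _ => a + x) a = a + x * S.length := by
    induction S with
    | nil => simp
    | cons y S ih => intro a; rw [List.foldl_cons, ih, List.length_cons]; ring
  rw [timesUnits, h, zero_add]

variable {I : BCMFP} {ε : ℚ≥0} {w : Word}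

theorem get_header (hw : w.val = I.encode ε) :
    (w.get 0).val = I.n ∧ (w.get 1).val = I.m ∧ (w.get 2).val = I.s ∧ (w.get 3).val = I.t ∧
    (w.get 4).val = I.budget.num ∧ (w.get 5).val = I.budget.den ∧ (w.get 6).val = ε.num ∧
    (w.get 7).val = ε.den := by
  simp only [Word.get_val, hw, BCMFP.encode]
  exact ⟨rfl, rfl, rfl, rfl, rfl, rfl, rfl, rfl⟩

theorem length_encode (I : BCMFP) (ε : ℚ≥0) : (I.encode ε).length = 8 + 6 * I.m := by
  simp [BCMFP.encode, List.length_flatten, List.map_ofFn, Function.comp_def]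
  ring

theorem field_eq (hw : w.val = I.encode ε) (e : Fin I.m) {k : ℕ} (hk : k < 6) :
    (field w e k).val = [(I.fst e : ℕ), (I.snd e : ℕ), (I.cost e).num, (I.cost e).den,
      (I.cap e).num, (I.cap e).den].getD k 0 := by
  have h1 : (e : ℕ) + e + e + e + e + e + (8 + k) = 8 + (6 * e + k) := by ring
  rw [field, h1, Word.get_val, hw, BCMFP.encode, List.getD_append_right _ _ _ _ (by simp)]
  rw [show 8 + (6 * (e : ℕ) + k) - List.length _ = 6 * e + k from Nat.add_sub_cancel_left ..,
    List.getD_flatten (c := 6) ?_ _ hk]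
  · simp [List.getD_eq_getElem?_getD]
  · simp only [List.mem_ofFn]
    rintro l ⟨e, rfl⟩
    rfl

theorem field_fst (hw : w.val = I.encode ε) (e : Fin I.m) : (field w e 0).val = I.fst e :=
  field_eq hw e (by norm_num)

theorem field_snd (hw : w.val = I.encode ε) (e : Fin I.m) : (field w e 1).val = I.snd e :=
  field_eq hw e (by norm_num)

theorem field_cost (hw : w.val = I.encode ε) (e : Fin I.m) :
    (field w e 2).val = (I.cost e).num ∧ (field w e 3).val = (I.cost e).den :=
  ⟨field_eq hw e (by norm_num), field_eq hw e (by norm_num)⟩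

theorem field_cap (hw : w.val = I.encode ε) (e : Fin I.m) :
    (field w e 4).val = (I.cap e).num ∧ (field w e 5).val = (I.cap e).den :=
  ⟨field_eq hw e (by norm_num), field_eq hw e (by norm_num)⟩

theorem edgeIds_eq (hw : w.val = I.encode ε) : edgeIds w = List.range I.m := by
  rw [edgeIds, (get_header hw).2.1]

theorem pow2_eq (hw : w.val = I.encode ε) {i : ℕ} (hi : i < I.m) : pow2 w i = 2 ^ i := by
  have h : ((List.range I.m).filter fun j => decide (j < i)).length = i := by
    rw [← List.toFinset_card_of_nodup (List.nodup_range.filter _), List.toFinset_filter,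
      List.toFinset_range]
    have : (Finset.range I.m).filter (fun j => decide (j < i) = true) = Finset.range i := by
      ext j
      simp only [decide_eq_true_eq, Finset.mem_filter, Finset.mem_range]
      omega
    rw [this, Finset.card_range]
  rw [pow2, edgeIds_eq hw, List.foldl_double, h, one_mul]

theorem costDen_eq (hw : w.val = I.encode ε) :
    costDen w = I.budget.den * ∏ e, (I.cost e).den := by
  rw [costDen, edgeIds_eq hw, List.foldl_mul_range, (get_header hw).2.2.2.2.2.1,
    Finset.prod_range]
  congr 1
  exact Finset.prod_congr rfl fun e _ => (field_cost hw e).2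

theorem capDen_eq (hw : w.val = I.encode ε) : capDen w = ∏ e, (I.cap e).den := by
  rw [capDen, edgeIds_eq hw, List.foldl_mul_range, one_mul, Finset.prod_range]
  exact Finset.prod_congr rfl fun e _ => (field_cap hw e).2

theorem costDen_pos (hw : w.val = I.encode ε) : 0 < costDen w := by
  rw [costDen_eq hw]
  exact Nat.mul_pos I.budget.den_pos (Finset.prod_pos fun e _ => (I.cost e).den_pos)

theorem capDen_pos (hw : w.val = I.encode ε) : 0 < capDen w := by
  rw [capDen_eq hw]
  exact Finset.prod_pos fun e _ => (I.cap e).den_pos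

theorem edge_cost (hw : w.val = I.encode ε) (e : Fin I.m) :
    ((edge w e).2.1 : ℝ) = costDen w * (I.cost e : ℝ) := by
  rw [edge, (field_cost hw e).1, (field_cost hw e).2]
  refine NNRat.cast_mul_div_den _ ?_
  rw [costDen_eq hw]
  exact (Finset.dvd_prod_of_mem (fun e => (I.cost e).den) (Finset.mem_univ e)).mul_left _

theorem edge_cap (hw : w.val = I.encode ε) (e : Fin I.m) :
    ((edge w e).2.2 : ℝ) = capDen w * (I.cap e : ℝ) := by
  rw [edge, (field_cap hw e).1, (field_cap hw e).2]
  refine NNRat.cast_mul_div_den _ ?_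
  rw [capDen_eq hw]
  exact Finset.dvd_prod_of_mem (fun e => (I.cap e).den) (Finset.mem_univ e)

theorem edge_ends (hw : w.val = I.encode ε) (e : Fin I.m) :
    (edge w e).1.2 = ((I.fst e : ℕ), (I.snd e : ℕ)) := by
  rw [edge, scope, field_fst hw, field_snd hw]

theorem edge_mask (hw : w.val = I.encode ε) (e : Fin I.m) : (edge w e).1.1 = 2 ^ (e : ℕ) :=
  pow2_eq hw e.2

theorem toData_budget (hw : w.val = I.encode ε) :
    ((toData w).2.2.1 : ℝ) = costDen w * (I.budget : ℝ) := by
  obtain ⟨-, -, -, -, h4, h5, -⟩ := get_header hw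
  rw [toData, h4, h5]
  refine NNRat.cast_mul_div_den _ ?_
  rw [costDen_eq hw]
  exact dvd_mul_right _ _

theorem toData_edges (hw : w.val = I.encode ε) :
    (toData w).2.1 = (List.range I.m).map (edge w) := by
  rw [toData, edgeIds_eq hw]

theorem length_units (hw : w.val = I.encode ε) :
    (units w).length = 8 * I.m * (ε.den / ε.num + 1) := by
  obtain ⟨-, -, -, -, -, -, h6, h7⟩ := get_header hw
  rw [units, edgeIds_eq hw, h6, h7]
  simp only [List.length_flatMap, List.length_cons, List.length_nil, List.map_const',
    List.sum_replicate, List.length_range, smul_eq_mul]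
  ring

theorem one_div_lt (hε : 0 < ε) : 1 / (ε : ℝ) < (ε.den / ε.num + 1 : ℕ) := by
  have h1 : (ε : ℝ) = ε.num / ε.den := by
    conv_lhs => rw [← NNRat.num_div_den ε]
    push_cast
    rfl
  have h2 : 0 < ε.num := NNRat.num_pos.2 hε
  have h3 : (0 : ℝ) < ε.num := Nat.cast_pos.2 h2
  have h4 : ε.den < ε.num * (ε.den / ε.num + 1) := Nat.lt_mul_div_succ _ h2
  rw [h1, one_div_div, div_lt_iff₀ h3]
  exact_mod_cast h4.trans_eq (mul_comm _ _)

theorem den_div_num_le (hε : 0 < ε) : ε.den / ε.num ≤ ⌈1 / ε⌉₊ := by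
  have h2 : 0 < ε.num := NNRat.num_pos.2 hε
  have h1 : (1 / ε : ℚ≥0) = ε.den / ε.num := by
    conv_lhs => rw [← NNRat.num_div_den ε]
    rw [one_div_div]
  have h3 : ((ε.den / ε.num : ℕ) : ℚ≥0) ≤ ⌈1 / ε⌉₊ :=
    (Nat.cast_div_le.trans h1.ge).trans (Nat.le_ceil _)
  exact_mod_cast h3

/-! ### Edge sets as sublists and as bit masks -/

/-- The list of the edges of a set, as they occur in the data. -/
def edgeList (w : Word) (A : Finset (Fin I.m)) : List Edge :=
  (((List.range I.m).filter fun i => decide (i ∈ A.map Fin.valEmbedding)).map (edge w))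

theorem sum_edgeList (A : Finset (Fin I.m)) {M : Type*} [AddCommMonoid M] (f : Edge → M) :
    ((edgeList w A).map f).sum = ∑ e ∈ A, f (edge w e) := by
  have h : ((List.range I.m).filter fun i => decide (i ∈ A.map Fin.valEmbedding)).toFinset =
      A.map Fin.valEmbedding := by
    ext i
    simp only [List.mem_toFinset, List.mem_filter, List.mem_range, decide_eq_true_eq,
      and_iff_right_iff_imp, Finset.mem_map, Fin.valEmbedding_apply]
    rintro ⟨e, -, rfl⟩
    exact e.2
  rw [edgeList, List.map_map, ← List.sum_toFinset _ (List.nodup_range.filter _), h,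
    Finset.sum_map]
  rfl

theorem edgeList_sublist (hw : w.val = I.encode ε) (A : Finset (Fin I.m)) :
    (edgeList w A).Sublist (toData w).2.1 := by
  rw [toData_edges hw]
  exact List.Sublist.map _ List.filter_sublist

theorem exists_edgeList (hw : w.val = I.encode ε) {l : List Edge}
    (h : l.Sublist (toData w).2.1) : ∃ A : Finset (Fin I.m), l = edgeList w A := by
  rw [toData_edges hw, List.sublist_map_iff] at h
  obtain ⟨l', hl, rfl⟩ := h
  refine ⟨Finset.univ.filter fun e => (e : ℕ) ∈ l', ?_⟩
  rw [edgeList]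
  congr 1
  conv_lhs => rw [← hl.filter_mem List.nodup_range]
  refine List.filter_congr fun i hi => ?_
  have : i < I.m := List.mem_range.1 hi
  simp only [Finset.mem_map, Finset.mem_filter, Finset.mem_univ, true_and,
    Fin.valEmbedding_apply, decide_eq_decide]
  exact ⟨fun h => ⟨⟨i, this⟩, h, rfl⟩, fun ⟨e, h, h'⟩ => h' ▸ h⟩

theorem mem_decode (hw : w.val = I.encode ε) (A : Finset (Fin I.m)) (e : Fin I.m) :
    (e : ℕ) ∈ decode w ((edgeList w A).map fun e => e.1.1).sum ↔ e ∈ A := by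
  have h1 : ((edgeList w A).map fun e => e.1.1).sum = ∑ i ∈ A.map Fin.valEmbedding, 2 ^ i := by
    rw [sum_edgeList, Finset.sum_map]
    exact Finset.sum_congr rfl fun e _ => edge_mask hw e
  have h2 : (e : ℕ) ∈ A.map Fin.valEmbedding ↔ e ∈ A := by
    rw [← Fin.valEmbedding_apply, Finset.mem_map']
  rw [h1, decode, List.mem_filter, edgeIds_eq hw, pow2_eq hw e.2, ← h2]
  conv_rhs => rw [← Finset.toFinset_bitIndices_sum_two_pow (A.map Fin.valEmbedding)]
  rw [List.mem_toFinset, Nat.mem_bitIndices, Nat.testBit_eq_decide_div_mod_eq]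
  generalize (∑ i ∈ A.map Fin.valEmbedding, 2 ^ i) / 2 ^ (e : ℕ) = x
  have := e.2
  simp only [List.mem_range, Bool.not_eq_true', beq_eq_false_iff_ne, decide_eq_true_eq]
  omega

/-! ### The data of a series-parallel instance -/

/-- Forgetting the multiplicities of the edges turns a series-parallel multigraph into a
series-parallel simple graph. -/
theorem spg_of_isSPSub {A : Finset (Fin I.m)} {S : Finset (Fin I.n)} {a b : Fin I.n}
    (h : I.IsSPSub A S a b) :
    SPG (fun u v => ∃ e ∈ A, (I.fst e : ℕ) = u ∧ (I.snd e : ℕ) = v ∨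
      (I.fst e : ℕ) = v ∧ (I.snd e : ℕ) = u) (S.map Fin.valEmbedding) a b := by
  induction h with
  | edge e a b hab he =>
    refine .edge (fun h => hab (Fin.ext h)) (fun u v => ?_) fun u => ?_
    · rcases he with ⟨h1, h2⟩ | ⟨h1, h2⟩ <;> simp [h1, h2] <;> grind
    · simp
  | @series A₁ A₂ S₁ S₂ a c b _ _ _ hS ih₁ ih₂ =>
    refine .series ih₁ ih₂ (fun u h1 h2 => ?_) (fun u v => ?_) fun u => ?_
    · obtain ⟨x, hx, rfl⟩ := Finset.mem_map.1 h1
      rw [Finset.mem_map'] at h2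
      have h3 : x ∈ S₁ ∩ S₂ := Finset.mem_inter.2 ⟨hx, h2⟩
      rw [hS, Finset.mem_singleton] at h3
      rw [h3, Fin.valEmbedding_apply]
    · simp only [Finset.mem_union, or_and_right, exists_or]
    · rw [Finset.map_union, Finset.mem_union]
  | @parallel A₁ A₂ S₁ S₂ a b _ _ _ hS ih₁ ih₂ =>
    refine .parallel ih₁ ih₂ (fun u h1 h2 => ?_) (fun u v => ?_) fun u => ?_
    · obtain ⟨x, hx, rfl⟩ := Finset.mem_map.1 h1
      rw [Finset.mem_map'] at h2
      have h3 : x ∈ S₁ ∩ S₂ := Finset.mem_inter.2 ⟨hx, h2⟩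
      rw [hS, Finset.mem_insert, Finset.mem_singleton] at h3
      rcases h3 with rfl | rfl <;> simp
    · simp only [Finset.mem_union, or_and_right, exists_or]
    · rw [Finset.map_union, Finset.mem_union]

/-- A series-parallel graph has at most one vertex more than edges. -/
theorem card_le_of_isSPSub {A : Finset (Fin I.m)} {S : Finset (Fin I.n)} {a b : Fin I.n}
    (h : I.IsSPSub A S a b) : S.card ≤ A.card + 1 := by
  induction h with
  | edge e a b hab he => rw [Finset.card_pair hab, Finset.card_singleton]
  | @series A₁ A₂ S₁ S₂ a c b h₁ h₂ hA hS ih₁ ih₂ =>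
    have h3 := Finset.card_union_add_card_inter S₁ S₂
    rw [hS, Finset.card_singleton] at h3
    rw [Finset.card_union_of_disjoint hA]
    omega
  | @parallel A₁ A₂ S₁ S₂ a b h₁ h₂ hA hS ih₁ ih₂ =>
    have h3 := Finset.card_union_add_card_inter S₁ S₂
    rw [hS, Finset.card_pair fun h => (spg_of_isSPSub h₁).ne (congrArg _ h)] at h3
    rw [Finset.card_union_of_disjoint hA]
    omega

theorem n_le (h : I.IsSeriesParallel) : I.n ≤ I.m + 1 := by
  obtain ⟨a, b, h⟩ := h
  simpa using card_le_of_isSPSub h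

theorem m_pos (h : I.IsSeriesParallel) : 0 < I.m := by
  have h1 := n_le h
  have h2 : (I.s : ℕ) ≠ I.t := fun h => I.s_ne_t (Fin.ext h)
  have := I.s.2
  have := I.t.2
  omega

theorem toData_scopes (w : Word) :
    (toData w).2.1.map (fun e => e.1.2) = (edgeIds w).map (scope w) := by
  rw [toData, List.map_map]
  rfl

theorem toData_config (hw : w.val = I.encode ε) :
    (toData w).1.1 = I.s ∧ (toData w).1.2.1 = I.t := by
  obtain ⟨-, -, h2, h3, -⟩ := get_header hw
  exact ⟨h2, h3⟩

theorem adjOf_scopes (hw : w.val = I.encode ε) (u v : ℕ) :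
    adjOf ((edgeIds w).map (scope w)) u v ↔ ∃ e ∈ Finset.univ, (I.fst e : ℕ) = u ∧
      (I.snd e : ℕ) = v ∨ (I.fst e : ℕ) = v ∧ (I.snd e : ℕ) = u := by
  have key : ∀ u v, (u, v) ∈ (edgeIds w).map (scope w) ↔
      ∃ e, (I.fst e : ℕ) = u ∧ (I.snd e : ℕ) = v := fun u v => by
    rw [edgeIds_eq hw, List.mem_map]
    constructor
    · rintro ⟨i, hi, h⟩
      have h1 := edge_ends hw ⟨i, List.mem_range.1 hi⟩
      rw [edge, h, Prod.mk.injEq] at h1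
      exact ⟨_, h1.1.symm, h1.2.symm⟩
    · rintro ⟨e, rfl, rfl⟩
      exact ⟨e, List.mem_range.2 e.2, edge_ends hw e⟩
  simp only [adjOf, key, Finset.mem_univ, true_and, exists_or]

theorem valid_toData (hw : w.val = I.encode ε) (h : I.IsSeriesParallel) :
    Valid (toData w) I.n := by
  obtain ⟨a, b, h⟩ := h
  have h1 := (spg_of_isSPSub h).congr (adjOf_scopes hw) fun _ => Iff.rfl
  have h2 : (Finset.univ : Finset (Fin I.n)).map Fin.valEmbedding ⊆ Finset.range I.n := by
    intro i hi
    obtain ⟨x, -, rfl⟩ := Finset.mem_map.1 hi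
    exact Finset.mem_range.2 x.2
  have h3 := elimOrder_legal h1 h2
  obtain ⟨c1, c2⟩ := toData_config hw
  have hn := (get_header hw).1
  have h4 : (toData w).2.2.2 = elimOrder I.n (List.range I.n) ((edgeIds w).map (scope w)) := by
    rw [toData, hn]
  refine ⟨?_, ?_, ?_, ?_, ?_⟩
  · rw [toData_scopes w, h4]; exact h3.1
  · rw [toData_scopes w, h4]; exact h3.2
  · rw [c1, c2]; exact fun h => I.s_ne_t (Fin.ext h)
  · rw [c1]; exact I.s.2.ne'
  · rw [c2]; exact I.t.2.ne'

end SPFlow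

/-! ### The approximation guarantee -/

namespace BCMFP

variable (I : BCMFP)

theorem maxFlow_nonneg (A : Finset (Fin I.m)) : 0 ≤ I.maxFlow A := by
  refine I.le_maxFlow fun z _ _ => Finset.sum_nonneg fun e _ => ?_
  split_ifs <;> positivity

theorem maxFlow_mono {A A' : Finset (Fin I.m)} (h : A ⊆ A') : I.maxFlow A ≤ I.maxFlow A' := by
  refine I.le_maxFlow fun z hs ht => (I.maxFlow_le_cutCap A hs ht).trans ?_
  refine Finset.sum_le_sum_of_subset_of_nonneg h fun e _ _ => ?_
  split_ifs <;> positivity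

theorem maxFlow_le_sum_cap (A : Finset (Fin I.m)) : I.maxFlow A ≤ ∑ e, (I.cap e : ℝ) := by
  have h := I.maxFlow_le_cutCap Finset.univ (z := fun v => decide (v = I.s)) (by simp)
    (by simp [I.s_ne_t.symm])
  refine (I.maxFlow_mono (Finset.subset_univ A)).trans (h.trans (Finset.sum_le_sum fun e _ => ?_))
  split_ifs
  · positivity
  · exact le_rfl

theorem maxFlow_le_opt {A : Finset (Fin I.m)} (h : I.IsFeasible A) : I.maxFlow A ≤ I.opt := by
  classical
  exact Finset.le_sup' I.maxFlow (Finset.mem_filter.2 ⟨Finset.mem_univ A, h⟩)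

theorem exists_maxFlow_eq_opt : ∃ A, I.IsFeasible A ∧ I.maxFlow A = I.opt := by
  classical
  obtain ⟨A, hA, h⟩ := Finset.exists_mem_eq_sup' (s := Finset.univ.filter I.IsFeasible)
    ⟨∅, by simp [IsFeasible]⟩ I.maxFlow
  exact ⟨A, (Finset.mem_filter.1 hA).2, h.symm⟩

end BCMFP

namespace SPFlow

open RAM (Word)

variable {I : BCMFP} {ε : ℚ≥0} {w : Word}

/-- Feasibility in terms of the scaled costs. -/
theorem isFeasible_iff (hw : w.val = I.encode ε) (A : Finset (Fin I.m)) :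
    I.IsFeasible A ↔ ((edgeList w A).map fun e => e.2.1).sum ≤ (toData w).2.2.1 := by
  have h : (0 : ℝ) < costDen w := Nat.cast_pos.2 (costDen_pos hw)
  rw [sum_edgeList, ← Nat.cast_le (α := ℝ), toData_budget hw, Nat.cast_sum]
  simp only [edge_cost hw]
  rw [← Finset.mul_sum, mul_le_mul_iff_right₀ h, BCMFP.IsFeasible]
  norm_cast

theorem cutVal_edgeList (hw : w.val = I.encode ε) (cfg : Config) (V : ℕ) (A : Finset (Fin I.m))
    (z : ℕ → Bool) : cutVal cfg V (edgeList w A) z =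
      ∑ e ∈ A, if z (I.fst e) = z (I.snd e) then 0 else roundCap cfg V (edge w e).2.2 := by
  rw [cutVal, sum_edgeList]
  simp only [edge_ends hw]

/-- A set of edges bought by the dynamic program has the computed value. -/
theorem exists_solution (hw : w.val = I.encode ε) (hI : I.IsSeriesParallel) {V : ℕ}
    (hV : 0 < V) : ∃ A, I.IsFeasible A ∧
      (∀ e : Fin I.m, (e : ℕ) ∈ decode w (solve (toData w) V).2 ↔ e ∈ A) ∧
      ((solve (toData w) V).1 * V : ℝ) ≤ (units w).length * (capDen w * I.maxFlow A) := by
  obtain ⟨l, h1, h2, h3, h4⟩ := solve_sound (valid_toData hw hI) V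
  obtain ⟨A, rfl⟩ := exists_edgeList hw h1
  refine ⟨A, (isFeasible_iff hw A).2 h3, fun e => ?_, ?_⟩
  · rw [h2]; exact mem_decode hw A e
  have hV' : (0 : ℝ) < V := Nat.cast_pos.2 hV
  have hN : (0 : ℝ) < (units w).length := by
    rw [length_units hw]; have := m_pos hI; positivity
  have hD : (0 : ℝ) < capDen w := Nat.cast_pos.2 (capDen_pos hw)
  rw [← mul_assoc, ← div_le_iff₀' (mul_pos hN hD)]
  refine I.le_maxFlow fun z hs ht => ?_
  rw [div_le_iff₀' (mul_pos hN hD)]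
  obtain ⟨c1, c2⟩ := toData_config hw
  have h5 := h4 (fun i => if h : i < I.n then z ⟨i, h⟩ else false) (by simpa [c1] using hs)
    (by simpa [c2] using ht)
  rw [cutVal_edgeList hw] at h5
  simp only [Fin.is_lt, dite_true, Fin.eta] at h5
  have h6 := (mul_le_mul_iff_left₀ hV').2 (Nat.cast_le (α := ℝ).2 h5)
  refine h6.trans ?_
  rw [BCMFP.cutCap, Nat.cast_sum, Finset.sum_mul, Finset.mul_sum]
  refine Finset.sum_le_sum fun e _ => ?_
  split_ifs
  · simp
  · have h7 : roundCap (toData w).1 V (edge w e).2.2 * V ≤ (edge w e).2.2 * (units w).length := by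
      rw [roundCap, timesUnits_eq]
      exact (Nat.mul_le_mul_right _ (min_le_left _ _)).trans (Nat.div_mul_le_self _ _)
    have h8 := Nat.cast_le (α := ℝ).2 h7
    push_cast at h8
    rw [edge_cap hw] at h8
    linarith

/-- Rounding loses less than one unit for each edge. -/
theorem le_solve (hw : w.val = I.encode ε) (hI : I.IsSeriesParallel) {V r : ℕ} (hV : 0 < V)
    (hr : r ≤ 2 * (units w).length)
    (h : ((r + I.m) * V : ℝ) ≤ (units w).length * (capDen w * I.opt)) :
    r ≤ (solve (toData w) V).1 := by
  obtain ⟨A, hA, hopt⟩ := I.exists_maxFlow_eq_opt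
  have hcap : capOf (toData w).1 = 2 * (units w).length := (two_mul _).symm
  refine solve_complete (valid_toData hw hI) V (edgeList_sublist hw A)
    ((isFeasible_iff hw A).1 hA) (hr.trans hcap.ge) fun z hs ht => ?_
  obtain ⟨c1, c2⟩ := toData_config hw
  rw [c1] at hs
  rw [c2] at ht
  have hD : (0 : ℝ) < capDen w := Nat.cast_pos.2 (capDen_pos hw)
  rw [cutVal_edgeList hw]
  -- a capped edge alone suffices
  by_cases hbig : ∃ e ∈ A, z (I.fst e) ≠ z (I.snd e) ∧
      roundCap (toData w).1 V (edge w e).2.2 = capOf (toData w).1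
  · obtain ⟨e, he, hz, hc⟩ := hbig
    refine (hr.trans_eq hcap.symm).trans (le_trans ?_ (Finset.single_le_sum
      (f := fun e => if z (I.fst e) = z (I.snd e) then 0
        else roundCap (toData w).1 V (edge w e).2.2) (fun _ _ => Nat.zero_le _) he))
    simp only [if_neg hz, hc, le_refl]
  have h1 := hopt ▸ I.maxFlow_le_cutCap A (z := fun v => z v) hs ht
  have h2 : ((units w).length * (capDen w * I.cutCap A fun v => z v) : ℝ) ≤
      ∑ e ∈ A, (((if z (I.fst e) = z (I.snd e) then 0
        else roundCap (toData w).1 V (edge w e).2.2 : ℕ) : ℝ) * V + V) := by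
    rw [BCMFP.cutCap, Finset.mul_sum, Finset.mul_sum]
    refine Finset.sum_le_sum fun e he => ?_
    split_ifs with hz
    · simp
    · have h7 : (edge w e).2.2 * (units w).length ≤
          roundCap (toData w).1 V (edge w e).2.2 * V + V := by
        have h8 : roundCap (toData w).1 V (edge w e).2.2 = (edge w e).2.2 * (units w).length / V := by
          have h9 : roundCap (toData w).1 V (edge w e).2.2 ≠ capOf (toData w).1 :=
            fun h => hbig ⟨e, he, hz, h⟩
          unfold roundCap at h9 ⊢
          rw [timesUnits_eq] at h9 ⊢
          have : (toData w).1.2.2 = units w := rfl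
          rw [this] at h9 ⊢
          omega
        rw [h8]
        have := Nat.lt_div_mul_add (a := (edge w e).2.2 * (units w).length) hV
        omega
      have h8 := Nat.cast_le (α := ℝ).2 h7
      push_cast at h8
      rw [edge_cap hw] at h8
      linarith
  rw [Finset.sum_add_distrib, ← Finset.sum_mul, Finset.sum_const, nsmul_eq_mul,
    ← Nat.cast_sum] at h2
  set s := ∑ e ∈ A, if z (I.fst e) = z (I.snd e) then 0
    else roundCap (toData w).1 V (edge w e).2.2
  have h3 : (A.card : ℝ) ≤ I.m := by
    exact_mod_cast (Finset.card_le_univ A).trans_eq (Fintype.card_fin _)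
  have hV' : (0 : ℝ) < V := Nat.cast_pos.2 hV
  have h4 : ((r + I.m) * V : ℝ) ≤ (s + I.m) * V := by
    calc ((r + I.m) * V : ℝ) ≤ _ := h
      _ ≤ (units w).length * (capDen w * I.cutCap A fun v => z v) := by gcongr
      _ ≤ _ := h2
      _ ≤ _ := by rw [add_mul]; gcongr
  have h5 := le_of_mul_le_mul_right h4 hV'
  exact_mod_cast (add_le_add_iff_right _).1 h5

/-- All cuts have integral scaled capacities. -/
theorem one_le_opt (hw : w.val = I.encode ε) (h : 0 < I.opt) : 1 ≤ capDen w * I.opt := by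
  obtain ⟨A, -, hopt⟩ := I.exists_maxFlow_eq_opt
  have hD : (0 : ℝ) < capDen w := Nat.cast_pos.2 (capDen_pos hw)
  rw [← div_le_iff₀' hD, ← hopt]
  refine I.le_maxFlow fun z hs ht => ?_
  rw [div_le_iff₀' hD]
  have h1 : 0 < I.cutCap A z := (hopt ▸ h).trans_le (I.maxFlow_le_cutCap A hs ht)
  have h2 : (capDen w * I.cutCap A z : ℝ) =
      (∑ e ∈ A, if z (I.fst e) = z (I.snd e) then 0 else (edge w e).2.2 : ℕ) := by
    rw [BCMFP.cutCap, Finset.mul_sum, Nat.cast_sum]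
    refine Finset.sum_congr rfl fun e _ => ?_
    split_ifs
    · simp
    · rw [edge_cap hw]
  have h3 := mul_pos hD h1
  rw [h2] at h3 ⊢
  exact_mod_cast h3

/-- If the scale `V` is too small, then the scaled optimum exceeds it. -/
theorem lt_opt_of_length_lt (hw : w.val = I.encode ε) (hI : I.IsSeriesParallel) {V : ℕ}
    (hV : 0 < V) (h : (units w).length < (solve (toData w) V).1) : V < capDen w * I.opt := by
  obtain ⟨A, hA, -, h1⟩ := exists_solution hw hI hV
  have hV' : (0 : ℝ) < V := Nat.cast_pos.2 hV
  have hN : (0 : ℝ) < (units w).length := by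
    rw [length_units hw]; have := m_pos hI; positivity
  have h2 : ((units w).length : ℝ) < (solve (toData w) V).1 := Nat.cast_lt.2 h
  have h3 : (units w).length * (capDen w * I.maxFlow A) ≤
      (units w).length * (capDen w * I.opt) := by
    gcongr
    exact I.maxFlow_le_opt hA
  have h4 : ((units w).length * V : ℝ) < (solve (toData w) V).1 * V := by gcongr
  exact lt_of_mul_lt_mul_left ((h4.trans_le h1).trans_le h3) hN.le

/-- The solution is good at a scale that is not too small, and at most twice the optimum. -/
theorem opt_le_of_solve_le (hw : w.val = I.encode ε) (hI : I.IsSeriesParallel) (hε : 0 < ε)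
    {V : ℕ} (hV : 0 < V) (h : (solve (toData w) V).1 ≤ (units w).length)
    (hopt : (V : ℝ) ≤ 2 * (capDen w * I.opt)) {A : Finset (Fin I.m)}
    (hA : ((solve (toData w) V).1 * V : ℝ) ≤ (units w).length * (capDen w * I.maxFlow A)) :
    I.opt / (1 + (ε : ℝ)) ≤ I.maxFlow A := by
  have hm : 0 < I.m := m_pos hI
  have hV' : (0 : ℝ) < V := Nat.cast_pos.2 hV
  have hD : (0 : ℝ) < capDen w := Nat.cast_pos.2 (capDen_pos hw)
  have hε' : (0 : ℝ) < ε := by exact_mod_cast hε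
  have hlen := length_units hw
  have hk := one_div_lt hε
  set k : ℕ := ε.den / ε.num + 1 with hkdef
  set N := (units w).length
  set r := (solve (toData w) V).1
  have hk1 : 1 ≤ k := Nat.succ_le_succ (Nat.zero_le _)
  have hN1 : 1 ≤ N := by rw [hlen]; exact Nat.mul_pos (by omega) hk1
  -- the value `r + 1` is out of reach of the dynamic program
  have h1 : ((N : ℝ) * (capDen w * I.opt)) < (r + 1 + I.m) * V := by
    by_contra! hc
    have := le_solve hw hI (r := r + 1) hV (by omega) (by push_cast; exact hc)
    omega
  have hN : (N : ℝ) = 8 * I.m * k := by rw [hlen]; push_cast; ring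
  have hm' : (1 : ℝ) ≤ I.m := by exact_mod_cast hm
  have hk' : (1 : ℝ) ≤ k := by exact_mod_cast hk1
  set x := capDen w * I.opt
  set y := capDen w * I.maxFlow A
  have hx : 0 ≤ x := by linarith
  have h2 : (N : ℝ) * x ≤ N * y + 2 * I.m * (2 * x) := by
    calc (N : ℝ) * x ≤ r * V + (1 + I.m) * V := by linarith
      _ ≤ N * y + 2 * I.m * (2 * x) := add_le_add hA (by gcongr; linarith)
  -- divide by `4 m`: `2 k x ≤ 2 k y + x`
  have h3 : 2 * k * x ≤ 2 * k * y + x := by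
    rw [hN] at h2
    have : (4 * I.m : ℝ) * (2 * k * x) ≤ (4 * I.m) * (2 * k * y + x) := by linarith
    exact le_of_mul_le_mul_left this (by linarith)
  have h4 : 1 < ε * (k : ℝ) := by rwa [div_lt_iff₀' hε'] at hk
  have h5 : x ≤ y * (1 + ε) := by
    have h6 : x * (2 * k - 1) ≤ (y * (1 + ε)) * (2 * k - 1) := by
      have hy : 0 ≤ y := by nlinarith
      have h7 : 2 * (k : ℝ) ≤ (1 + ε) * (2 * k - 1) := by nlinarith
      calc x * (2 * k - 1) ≤ y * (2 * k) := by linarith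
        _ ≤ y * ((1 + ε) * (2 * k - 1)) := by gcongr
        _ = _ := by ring
    exact le_of_mul_le_mul_right h6 (by linarith)
  rw [div_le_iff₀ (by linarith)]
  have h6 : capDen w * I.opt ≤ capDen w * (I.maxFlow A * (1 + ε)) := by
    calc _ ≤ _ := h5
      _ = _ := by ring
  exact le_of_mul_le_mul_left h6 hD

end SPFlow

/-! ### Doubling the scale -/

namespace RAM

open HeapRep (rep len)

variable {α β : Type} [HeapRep α] [HeapRep β]

theorem Comp.codRestrict {q : β → Prop} {f : α → β} {T : α → ℕ} (h : Comp f T)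
    (hq : ∀ a, q (f a)) : Comp (fun a => (⟨f a, hq a⟩ : Subtype q)) T := h

end RAM

namespace SPFlow

open RAM Polynomial
open RAM.HeapRep (len)

/-- The word is the code of an instance with a series-parallel graph. -/
def IsInput (w : Word) : Prop :=
  ∃ (I : BCMFP) (ε : ℚ≥0), I.IsSeriesParallel ∧ 0 < ε ∧ w.val = I.encode ε

theorem iterate_double (D : Data) (j : ℕ) :
    double^[j] (initial D) = (D, 2 ^ j, solve D (2 ^ j)) := by
  induction j with
  | zero => rfl
  | succ j ih => rw [Function.iterate_succ_apply', ih, double, pow_succ, mul_two]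

theorem tooSmall_iterate (w : Word) (j : ℕ) :
    tooSmall (double^[j] (initial (toData w))) = true ↔
      (units w).length < (solve (toData w) (2 ^ j)).1 := by
  rw [iterate_double, tooSmall, decide_eq_true_iff]
  rfl

variable {I : BCMFP} {ε : ℚ≥0} {w : Word}

/-- A scale that is too small is less than the scaled optimum, which bounds the number of
doublings. -/
theorem lt_of_tooSmall (hw : w.val = I.encode ε) (hI : I.IsSeriesParallel) {j : ℕ}
    (h : tooSmall (double^[j] (initial (toData w))) = true) :
    (2 : ℝ) ^ j < capDen w * I.opt := by
  have h1 := lt_opt_of_length_lt hw hI (pow_pos two_pos j) ((tooSmall_iterate w j).1 h)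
  push_cast at h1
  exact h1

theorem exists_not_tooSmall (hw : IsInput w) (j : ℕ) :
    ∃ i, tooSmall (double^[i] (double^[j] (initial (toData w)))) = false := by
  obtain ⟨I, ε, hI, -, hw⟩ := hw
  obtain ⟨i, hi⟩ := pow_unbounded_of_one_lt (capDen w * I.opt) (one_lt_two (α := ℝ))
  refine ⟨i, ?_⟩
  rw [← Function.iterate_add_apply]
  by_contra h
  have h1 := lt_of_tooSmall hw hI (Bool.eq_true_of_not_eq_false h)
  have h2 : (2 : ℝ) ^ i ≤ 2 ^ (i + j) := pow_le_pow_right₀ one_le_two (Nat.le_add_right _ _)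
  linarith

/-- The states that the search can reach. Only from these is the search known to stop, so the loop is
a function on this subtype. -/
def Reachable (s : Search) : Prop :=
  ∃ w, IsInput w ∧ ∃ j, s = double^[j] (initial (toData w))

theorem Reachable.double {s : Search} (h : Reachable s) : Reachable (double s) := by
  obtain ⟨w, hw, j, rfl⟩ := h
  exact ⟨w, hw, j + 1, (Function.iterate_succ_apply' ..).symm⟩

theorem Reachable.exists_not_tooSmall {s : Search} (h : Reachable s) :
    ∃ i, tooSmall (SPFlow.double^[i] s) = false := by
  obtain ⟨w, hw, j, rfl⟩ := h
  exact SPFlow.exists_not_tooSmall hw j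

/-- The number of doublings until the scale is not too small. -/
def numDouble (s : Subtype Reachable) : ℕ := Nat.find s.2.exists_not_tooSmall

/-- The state in which the search stops. -/
def search (s : Subtype Reachable) : Subtype Reachable :=
  (fun s => ⟨double s.1, s.2.double⟩)^[numDouble s] s

theorem val_iterate (s : Subtype Reachable) (i : ℕ) :
    (((fun s => ⟨double s.1, s.2.double⟩)^[i] s : Subtype Reachable)).1 = double^[i] s.1 := by
  induction i with
  | zero => rfl
  | succ i ih =>
    rw [Function.iterate_succ_apply', Function.iterate_succ_apply']
    exact congrArg double ih

theorem len_iterate (s : Search) (i : ℕ) : len (double^[i] s) = len s := by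
  induction i with
  | zero => rfl
  | succ i ih => rw [Function.iterate_succ_apply', ← ih]; rfl

theorem comp_search : ∃ r : ℕ[X], Comp search fun s => (numDouble s + 1) * r.eval (len s.1) := by
  obtain ⟨r₀, h₀, -⟩ := poly_tooSmall
  obtain ⟨r₁, h₁, -⟩ := poly_double
  refine ⟨(r₀ + 4) + (r₁ + 4) + 3, ?_⟩
  have hc := h₀.comp (Comp.subtype_val (p := Reachable))
  have hf := (h₁.comp (Comp.subtype_val (p := Reachable))).codRestrict fun s => s.2.double
  refine Comp.while hc hf numDouble _ (fun s i hi => ?_) (fun s => ?_) fun s i _ => ?_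
  · rw [val_iterate]
    exact Bool.eq_true_of_not_eq_false (Nat.find_min s.2.exists_not_tooSmall hi)
  · rw [val_iterate]
    exact Nat.find_spec s.2.exists_not_tooSmall
  · simp only [val_iterate, len_iterate, eval_add, eval_ofNat]
    omega

theorem poly_initial : Poly fun w => initial (toData w) := by
  have := poly_toData
  unfold initial
  fun_prop

/-- The state from which the search starts. -/
def startState (w : Subtype IsInput) : Subtype Reachable :=
  ⟨initial (toData w.1), w.1, w.2, 0, rfl⟩

/-- The edge set found by the algorithm. -/
def solution (w : Subtype IsInput) : List ℕ := decode w.1 (search (startState w)).1.2.2.2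

theorem comp_solution : ∃ r : ℕ[X], Comp solution fun w =>
    (numDouble (startState w) + 1) * r.eval (len w.1) := by
  obtain ⟨r₀, h₀, l₀⟩ := poly_initial
  obtain ⟨r₁, h₁⟩ := comp_search
  obtain ⟨r₂, h₂, -⟩ := poly_decode
  obtain ⟨r₃, h₃, -⟩ := show Poly fun s : Search => s.2.2.2 by fun_prop
  have hi := (h₀.comp (Comp.subtype_val (p := IsInput))).codRestrict
    fun w => (startState w).2
  have hs := h₁.comp hi
  have hm := h₃.comp (Comp.subtype_val.comp hs)
  have hd := h₂.comp ((Comp.subtype_val (p := IsInput)).pair hm)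
  refine ⟨r₀ + r₁.comp r₀ + r₂.comp (X + 1) + r₃.comp r₀ + 30, Comp.mono hd fun w => ?_⟩
  have e1 : len (search (startState w)).1 = len (initial (toData w.1)) := by
    rw [search, val_iterate, len_iterate]; rfl
  have e2 := eval_mono r₁ (l₀ w.1)
  have e3 := eval_mono r₃ ((le_of_eq e1).trans (l₀ w.1))
  have e4 : len (w.1, (search (startState w)).1.2.2.2) = len w.1 + 1 := rfl
  have e5 : (numDouble (startState w) + 1) * r₁.eval (len (startState w).1) ≤
    (numDouble (startState w) + 1) * r₁.eval (r₀.eval (len w.1)) := Nat.mul_le_mul_left _ e2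
  change 2 + (2 + r₀.eval (len w.1) + 2 + (numDouble (startState w) + 1) *
    r₁.eval (len (startState w).1) + 2 + 2 + 2 + r₃.eval (len (search (startState w)).1) + 2) + 8 +
    r₂.eval (len (w.1, (search (startState w)).1.2.2.2)) + 2 ≤ _
  rw [e4]
  simp only [eval_add, eval_comp, eval_ofNat, eval_X, eval_one, mul_add] at *
  have key : ∀ x, x ≤ (numDouble (startState w) + 1) * x := fun x =>
    Nat.le_mul_of_pos_left _ (Nat.succ_pos _)
  have k1 := key (r₀.eval (len w.1))
  have k2 := key (r₂.eval (len w.1 + 1))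
  have k3 := key (r₃.eval (r₀.eval (len w.1)))
  omega

/-- For integral capacities the common denominator is `1`, and the number of doublings is bounded by
the logarithm of the maximum flow. -/
theorem numDouble_le (hw : w.val = I.encode ε) (hI : I.IsSeriesParallel) (h : IsInput w) :
    numDouble (startState ⟨w, h⟩) ≤ Nat.log 2 ⌊capDen w * I.maxFlow Finset.univ⌋₊ + 1 := by
  rcases Nat.eq_zero_or_pos (numDouble (startState ⟨w, h⟩)) with h0 | h0
  · omega
  have h1 := Bool.eq_true_of_not_eq_false (Nat.find_min
    (startState ⟨w, h⟩).2.exists_not_tooSmall (Nat.sub_lt h0 one_pos))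
  have h2 := lt_of_tooSmall hw hI h1
  obtain ⟨A, -, hA⟩ := I.exists_maxFlow_eq_opt
  have h3 : (2 : ℝ) ^ (numDouble (startState ⟨w, h⟩) - 1) ≤ capDen w * I.maxFlow Finset.univ := by
    refine h2.le.trans ?_
    rw [← hA]
    gcongr
    exact I.maxFlow_mono (Finset.subset_univ A)
  have h4 := Nat.le_log_of_pow_le one_lt_two (Nat.le_floor (by exact_mod_cast h3))
  omega

/-- The edge set found by the algorithm is feasible and almost optimal. -/
theorem solution_spec (hw : w.val = I.encode ε) (hI : I.IsSeriesParallel) (hε : 0 < ε)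
    (h : IsInput w) : ∃ A, I.IsFeasible A ∧ (∀ e : Fin I.m, (e : ℕ) ∈ solution ⟨w, h⟩ ↔ e ∈ A) ∧
      I.opt / (1 + (ε : ℝ)) ≤ I.maxFlow A := by
  set j := numDouble (startState ⟨w, h⟩) with hj
  have h1 : (search (startState ⟨w, h⟩)).1 = (toData w, 2 ^ j, solve (toData w) (2 ^ j)) := by
    rw [search, val_iterate]
    exact iterate_double _ _
  have hV : 0 < 2 ^ j := pow_pos two_pos j
  obtain ⟨A, h2, h3, h4⟩ := exists_solution hw hI hV
  refine ⟨A, h2, by rw [solution, h1]; exact h3, ?_⟩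
  rcases le_or_gt I.opt 0 with h0 | h0
  · exact (div_nonpos_of_nonpos_of_nonneg h0 (by positivity)).trans (I.maxFlow_nonneg A)
  refine opt_le_of_solve_le hw hI hε hV ?_ ?_ h4
  · have h5 := Nat.find_spec (startState ⟨w, h⟩).2.exists_not_tooSmall
    have h6 := (tooSmall_iterate w j).not.1 (Bool.not_eq_true _ ▸ h5)
    omega
  · rcases Nat.eq_zero_or_pos j with h5 | h5
    · have := one_le_opt hw h0
      rw [h5]
      push_cast
      linarith
    · -- the scale before the last doubling was too small
      have h6 := Bool.eq_true_of_not_eq_false (Nat.find_min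
        (startState ⟨w, h⟩).2.exists_not_tooSmall (Nat.sub_lt h5 one_pos))
      have h7 := lt_of_tooSmall hw hI h6
      have h8 : (2 : ℝ) ^ j = 2 * 2 ^ (j - 1) := by
        rw [← pow_succ', Nat.sub_add_cancel h5]
      push_cast
      rw [h8]
      change (2 : ℝ) ^ (j - 1) < _ at h7
      linarith

/-! ### Sizes -/

theorem size_field_le (hw : w.val = I.encode ε) (i k : ℕ) :
    (field w i k).val < 2 ^ wordSize (I.encode ε) := by
  rw [field, Word.get_val, hw]
  exact (Nat.lt_size_self _).trans_le (Nat.pow_le_pow_right two_pos (size_le_wordSize _ _))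

theorem length_le_wordSize (W : List ℕ) : W.length ≤ wordSize W := by
  induction W with
  | nil => simp
  | cons a W ih => simp only [wordSize, List.map_cons, List.sum_cons, List.length_cons] at *; omega

theorem m_le_wordSize (I : BCMFP) (ε : ℚ≥0) : I.m ≤ wordSize (I.encode ε) := by
  have := length_le_wordSize (I.encode ε)
  rw [length_encode] at this
  omega

/-- The logarithm of the scaled maximum flow is quadratic in the size of the input: `m` denominators
enter the common denominator. -/
theorem log_maxFlow_le (hw : w.val = I.encode ε) :
    Nat.log 2 ⌊capDen w * I.maxFlow Finset.univ⌋₊ ≤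
      wordSize (I.encode ε) * wordSize (I.encode ε) + 2 * wordSize (I.encode ε) := by
  set S := wordSize (I.encode ε)
  have hm : I.m ≤ S := m_le_wordSize I ε
  have h1 : capDen w ≤ 2 ^ (S * S) := by
    rw [capDen_eq hw]
    calc ∏ e, (I.cap e).den ≤ ∏ _e : Fin I.m, 2 ^ S :=
          Finset.prod_le_prod' fun e _ => (field_cap hw e).2 ▸ (size_field_le hw e 5).le
      _ = 2 ^ (S * I.m) := by rw [Finset.prod_const, Finset.card_univ, Fintype.card_fin, pow_mul]
      _ ≤ 2 ^ (S * S) := Nat.pow_le_pow_right two_pos (Nat.mul_le_mul_left _ hm)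
  have h2 : (∑ e, (I.cap e : ℝ)) ≤ 2 ^ (2 * S) := by
    have h3 : ∀ e, (I.cap e : ℝ) ≤ 2 ^ S := fun e => by
      have h4 := (size_field_le hw e 4).le
      rw [(field_cap hw e).1] at h4
      have h5 : I.cap e ≤ (I.cap e).num := by
        conv_lhs => rw [← NNRat.num_div_den (I.cap e)]
        exact div_le_self (by positivity) (by exact_mod_cast (I.cap e).den_pos)
      have h6 : I.cap e ≤ ((2 ^ S : ℕ) : ℚ≥0) := h5.trans (Nat.cast_le.2 h4)
      have h7 := NNRat.cast_le (K := ℝ) |>.2 h6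
      push_cast at h7
      exact h7
    calc (∑ e, (I.cap e : ℝ)) ≤ ∑ _e : Fin I.m, (2 : ℝ) ^ S := Finset.sum_le_sum fun e _ => h3 e
      _ = I.m * 2 ^ S := by rw [Finset.sum_const, Finset.card_univ, Fintype.card_fin, nsmul_eq_mul]
      _ ≤ 2 ^ S * 2 ^ S := by
        gcongr
        exact_mod_cast hm.trans Nat.lt_two_pow_self.le
      _ = _ := by rw [two_mul, pow_add]
  have h3 : (capDen w : ℝ) * I.maxFlow Finset.univ ≤ 2 ^ (S * S) * 2 ^ (2 * S) := by
    refine mul_le_mul (by exact_mod_cast h1) ((I.maxFlow_le_sum_cap _).trans h2)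
      (I.maxFlow_nonneg _) (by positivity)
  rw [← pow_add] at h3
  have h4 : ⌊capDen w * I.maxFlow Finset.univ⌋₊ ≤ 2 ^ (S * S + 2 * S) := by
    have := Nat.floor_le_floor h3
    rwa [show ((2 : ℝ) ^ (S * S + 2 * S)) = ((2 ^ (S * S + 2 * S) : ℕ) : ℝ) by push_cast; rfl,
      Nat.floor_natCast] at this
  exact (Nat.log_mono_right h4).trans_eq (Nat.log_pow one_lt_two _)

theorem inputLen_le (hI : I.IsSeriesParallel) (hε : 0 < ε) :
    inputLen (I.encode ε) ≤ 10 + 8 * I.m + ⌈1 / ε⌉₊ := by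
  have h1 := n_le hI
  have h2 := den_div_num_le hε
  rw [inputLen, length_encode]
  change 8 + 6 * I.m + I.n + I.m + ε.den / ε.num + 1 ≤ _
  omega

theorem eval_aeval {σ : Type*} (v : σ → ℕ) (R : ℕ[X]) (x : MvPolynomial σ ℕ) :
    MvPolynomial.eval v (aeval x R) = R.eval (MvPolynomial.eval v x) := by
  rw [aeval_def, hom_eval₂, Subsingleton.elim (RingHom.comp _ _) (RingHom.id ℕ)]
  rfl

end SPFlow

theorem theorem2 :
    ∃ (P : RAM.Prog) (p : MvPolynomial (Fin 2) ℕ) (q : MvPolynomial (Fin 3) ℕ),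
      ∀ I : BCMFP, I.IsSeriesParallel → ∀ ε : ℚ≥0, 0 < ε →
        ∃ (σ : RAM.State) (τ β : ℕ),
          RAM.Exec P (RAM.start (I.encode ε)) σ τ β ∧
          I.IsFeasible (I.output σ) ∧
          I.opt / (1 + (ε : ℝ)) ≤ I.maxFlow (I.output σ) ∧
          β ≤ MvPolynomial.eval ![RAM.wordSize (I.encode ε), ⌈1 / ε⌉₊] p ∧
          ((∀ e, (I.cap e).den = 1) →
            τ ≤ MvPolynomial.eval
              ![I.m, ⌈1 / ε⌉₊, Nat.log 2 ⌊I.maxFlow Finset.univ⌋₊] q) := by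
  obtain ⟨r, hr⟩ := SPFlow.comp_solution
  obtain ⟨P, q₀, hP⟩ := RAM.exists_prog (p := SPFlow.IsInput) (by
    rintro w ⟨I, ε, -, -, hw⟩
    rw [hw, SPFlow.length_encode]
    rfl) hr
  -- a bound on the steps in terms of the length of the input and the number of scales
  obtain ⟨R, hR⟩ : ∃ R : Polynomial ℕ, ∀ ℓ k m, m ≤ ℓ →
      q₀.eval ℓ + (k + 1) * r.eval ℓ + 4 * m ≤ R.eval ℓ * (k + 1) := by
    refine ⟨q₀ + r + 4 * Polynomial.X, fun ℓ k m hm => ?_⟩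
    simp only [Polynomial.eval_add, Polynomial.eval_mul, Polynomial.eval_ofNat, Polynomial.eval_X]
    nlinarith [Nat.zero_le (q₀.eval ℓ * k), Nat.zero_le (ℓ * k)]
  let X₀ : MvPolynomial (Fin 2) ℕ := MvPolynomial.X 0
  let t : MvPolynomial (Fin 2) ℕ :=
    Polynomial.aeval (10 + 8 * X₀ + MvPolynomial.X 1) R * (X₀ * X₀ + 2 * X₀ + 1 + 1)
  refine ⟨P, t * (1 + 3 * (X₀ + t + t * (1 + (X₀ + t)))),
    Polynomial.aeval (10 + 8 * MvPolynomial.X 0 + MvPolynomial.X 1) R * (MvPolynomial.X 2 + 1 + 1),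
    fun I hI ε hε => ?_⟩
  let w : RAM.Word := ⟨I.encode ε⟩
  have hw : w.val = I.encode ε := rfl
  have h : SPFlow.IsInput w := ⟨I, ε, hI, hε, hw⟩
  obtain ⟨σ, τ, β, hex, hout, hτ, hβ⟩ := hP ⟨w, h⟩
  obtain ⟨A, hA, hA', hopt⟩ := SPFlow.solution_spec hw hI hε h
  have hσ : I.output σ = A := by
    ext e
    rw [BCMFP.output, Finset.mem_filter, hout, hA']
    simp
  have hlen := SPFlow.inputLen_le hI hε
  have hsol : (SPFlow.solution ⟨w, h⟩).length ≤ I.m := by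
    rw [SPFlow.solution, SPFlow.decode, SPFlow.edgeIds_eq hw]
    exact (List.length_filter_le _ _).trans_eq List.length_range
  have hm : I.m ≤ RAM.inputLen (I.encode ε) := by
    rw [RAM.inputLen, SPFlow.length_encode]
    generalize (I.encode ε).getD 7 0 / (I.encode ε).getD 6 0 = x
    omega
  have hk := SPFlow.numDouble_le hw hI h
  set k := SPFlow.numDouble (SPFlow.startState ⟨w, h⟩)
  have hτ' : τ ≤ R.eval (10 + 8 * I.m + ⌈1 / ε⌉₊) * (k + 1) :=
    (hτ.trans (hR _ k _ (hsol.trans hm))).trans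
      (Nat.mul_le_mul_right _ (RAM.eval_mono R hlen))
  refine ⟨σ, τ, β, hex, hσ ▸ hA, hσ ▸ hopt, ?_, fun hint => ?_⟩
  · have h1 : τ ≤ MvPolynomial.eval ![RAM.wordSize (I.encode ε), ⌈1 / ε⌉₊] t := by
      simp only [t, X₀, map_mul, map_add, SPFlow.eval_aeval, MvPolynomial.eval_X,
        map_ofNat, map_one, Matrix.cons_val_zero, Matrix.cons_val_one]
      have h2 := SPFlow.m_le_wordSize I ε
      have h3 := SPFlow.log_maxFlow_le hw
      refine hτ'.trans (Nat.mul_le_mul (RAM.eval_mono R (by omega)) (by omega))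
    refine hβ.trans ?_
    change τ * (1 + 3 * (RAM.wordSize (I.encode ε) + τ + τ * (1 + (RAM.wordSize (I.encode ε) + τ))))
      ≤ _
    simp only [X₀, map_mul, map_add, MvPolynomial.eval_X, map_ofNat, map_one,
      Matrix.cons_val_zero]
    gcongr
  · have h1 : SPFlow.capDen w = 1 := by
      rw [SPFlow.capDen_eq hw]; exact Finset.prod_eq_one fun e _ => hint e
    rw [h1, Nat.cast_one, one_mul] at hk
    simp only [map_mul, map_add, SPFlow.eval_aeval, MvPolynomial.eval_X,
      map_ofNat, map_one, Matrix.cons_val_zero, Matrix.cons_val_one, Matrix.cons_val_two]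
    exact hτ'.trans (Nat.mul_le_mul le_rfl (by simp; omega))
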